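/- Consider, on the half-line $x>0$, the system $$\omega_t+u\,\omega_x=\frac{\rho}{x},\qquad \rho_t+u\,\rho_x=0,\qquad u(x,t)=-x\int_x^\infty\frac{\omega(y,t)}{y}\,dy. \tag{1}$$ A smooth solution on $[0,T]$ with data $(\omega_0,\rho_0)\in C_0^1(0,\infty)^2$ (continuously differentiable, compactly supported in $(0,\infty)$) is a pair $\omega,\rho\in C([0,T],C_0^1(0,\infty))\cap C^1([0,T],C(0,\infty))$ satisfying (1) classically and having these initial values. **Parameters.** Scales $1>\lambda_{-2}>\lambda_{-1}>\lambda_0>\lambda_1>\dots$ with $0<\lambda_n\to0$, and sequences $p_n,q_n,\phi_n,\psi_n,m_n,M_n$ $(n\ge1)$ are called admissible if $0<\phi_n<\psi_n$, $\phi_n\psi_n=1$, $0<p_n\nearrow\frac12$, $q_n\searrow\frac12$, $p_n+q_n=1$, $0<m_n\nearrow1$, $M_n\searrow1$ (all strictly monotone), $\lambda_n/\lambda_{n-1}\to0$, $\lambda_n^{q_n-q_{n-1}}\to1$, $\phi_1\lambda_0^{-p_1}<\psi_1\lambda_0^{-q_1}$; for $n\ge2$ $$\frac{q_n}{q_{n-1}}\frac{\psi_{n-1}}{\psi_n}\lambda_{n-1}^{q_n-q_{n-1}}\le1\le\frac{p_n}{p_{n-1}}\frac{\phi_{n-1}}{\phi_n}\lambda_{n-1}^{p_n-p_{n-1}},\quad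 \phi_{n-1}\lambda_{n-1}^{-p_{n-1}}\ge\phi_n\lambda_{n-1}^{-p_n},\quad \psi_{n-1}\lambda_{n-1}^{-q_{n-1}}\le\psi_n\lambda_{n-1}^{-q_n};$$ and $\frac{p_n}{m_n(1-p_n)}<1<\frac{q_n}{M_n(1-q_n)}$ for $n\ge1$. **Data.** Given such parameters and $\delta>0$, $R\ge1$, $0<A_0<\lambda_0$ with $\phi_1\lambda_0^{-p_1}<\psi_1\lambda_0^{-q_1}-\delta$, data $(\omega_0,\rho_0)\in C_0^1(0,\infty)^2$ are suitably prepared if: $\omega_0,\rho_0\ge0$; both are supported in $[\varepsilon,\lambda_{-2}+\delta]$ for some $0<\varepsilon<A_0$; $\phi_nx^{-p_n}<\omega_0(x)<\psi_nx^{-q_n}$ for all $n\ge1$ and $x\in[\lambda_n,\lambda_{n-1}]$ with $x\ge A_0$; $\omega_0<\psi_1\lambda_0^{-q_1}-\delta$ on $[\lambda_0,\lambda_{-2}+\delta]$; $\omega_0>\phi_1\lambda_0^{-p_1}$ on $[\lambda_0,\lambda_{-1}]$; $\rho_0=1$ on $[A_0,\lambda_{-2}]$; and $\rho_0\le R$ on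 $[\lambda_{-2},\infty)$. **Theorem.** There are admissible parameters and constants $\phi,\psi,\delta_0>0$ such that for all $0<\delta<\delta_0$ and $R\ge1$, and for all sufficiently small $A_0>0$ (depending on $\delta$ and $R$), the set of suitably prepared data is nonempty, and there is a time $T_1>0$ such that for all suitably prepared data the following hold. 1. The data have a unique maximal smooth solution; its lifetime $T_s$ is finite (the solution exists on $[0,T]$ for every $T<T_s$, and no solution with these data exists on $[0,T]$ with $T\ge T_s$), and $\lim_{t\to T_s}\int_0^t\|\omega(\cdot,s)\|_{L^\infty(0,\infty)}\,ds=\infty$. 2. Let $A(t)$ be the particle trajectory $\dot A(t)=u(A(t),t)$, $A(0)=A_0$. For all $t\in[0,T_s)$ and $x\in(A(t),\lambda_0]$, $$\phi\,x^{-1/2}\le\omega(x,t)\le\psi\,x^{-1/2}.$$ 3. For all $t\in[0,T_s)$ one has $\sqrt{A(t)}\le\sqrt{A_0}\,(1-t/T_1)$ (in particular $T_s\le T_1$), and if the solution stays smooth on $[0,T_1)$, then $\lim_{t\to T_1}A(t)=0$. -/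

import Mathlib

open Set Filter Topology

namespace NonlocalTransport

/-- The velocity `u(x) = -x ∫_x^∞ ω(y)/y dy` generated by a vorticity profile `ω` on `(0, ∞)`. -/
noncomputable def velocity (w : ℝ → ℝ) (x : ℝ) : ℝ :=
  -x * ∫ y in Ioi x, w y / y

/-- The sup norm on `(0, ∞)`. All functions of interest are continuous and compactly supported
in `(0, ∞)`, so this supremum is finite and equals the `L^∞` norm. -/
noncomputable def supNorm (w : ℝ → ℝ) : ℝ :=
  ⨆ x : Ioi (0 : ℝ), |w x|

/-- `f ∈ C₀¹(0, ∞)`: continuously differentiable with compact support in `(0, ∞)`. Functions on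
`(0, ∞)` are represented by functions on `ℝ` whose values outside `(0, ∞)` are irrelevant. -/
def IsC1Compact (f : ℝ → ℝ) : Prop :=
  ContDiffOn ℝ 1 f (Ioi 0) ∧ ∃ a b : ℝ, 0 < a ∧ ∀ x, 0 < x → x ∉ Icc a b → f x = 0

/-- `f ∈ C([0,T], C₀¹(0,∞)) ∩ C¹([0,T], C(0,∞))`, where `f t x` is the value at time `t` and
position `x`. A continuous curve in `C₀¹(0,∞)` on a compact time interval has all its supports in
one compact subset of `(0, ∞)`; given this, continuity into `C₀¹` amounts to joint continuity of
`f` and `∂ₓ f`, and the second space amounts to existence and joint continuity of `∂ₜ f`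
(one-sided at the end points). -/
structure InSolutionSpace (T : ℝ) (f : ℝ → ℝ → ℝ) : Prop where
  support : ∃ a b : ℝ, 0 < a ∧
    ∀ t ∈ Icc 0 T, ∀ x, 0 < x → x ∉ Icc a b → f t x = 0
  continuous : ContinuousOn (fun z : ℝ × ℝ => f z.1 z.2) (Icc 0 T ×ˢ Ioi 0)
  diff_x : ∀ t ∈ Icc 0 T, ∀ x, 0 < x → DifferentiableAt ℝ (f t) x
  continuous_x : ContinuousOn (fun z : ℝ × ℝ => deriv (f z.1) z.2) (Icc 0 T ×ˢ Ioi 0)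
  diff_t : ∀ t ∈ Icc 0 T, ∀ x, 0 < x →
    DifferentiableWithinAt ℝ (fun s => f s x) (Icc 0 T) t
  continuous_t : ContinuousOn
    (fun z : ℝ × ℝ => derivWithin (fun s => f s z.2) (Icc 0 T) z.1) (Icc 0 T ×ˢ Ioi 0)

/-- `(ω, ρ)` is a (smooth, i.e. classical) solution on `[0, T] × (0, ∞)`, `T > 0`, of
`ω_t + u ω_x = ρ / x`, `ρ_t + u ρ_x = 0`, `u = -x ∫_x^∞ ω(y,t)/y dy`,
with initial data `(ω₀, ρ₀)`. -/
structure IsSolution (ω₀ ρ₀ : ℝ → ℝ) (T : ℝ) (ω ρ : ℝ → ℝ → ℝ) : Prop where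
  pos : 0 < T
  omega_mem : InSolutionSpace T ω
  rho_mem : InSolutionSpace T ρ
  omega_init : ∀ x, 0 < x → ω 0 x = ω₀ x
  rho_init : ∀ x, 0 < x → ρ 0 x = ρ₀ x
  omega_eq : ∀ t ∈ Icc 0 T, ∀ x, 0 < x →
    derivWithin (fun s => ω s x) (Icc 0 T) t + velocity (ω t) x * deriv (ω t) x = ρ t x / x
  rho_eq : ∀ t ∈ Icc 0 T, ∀ x, 0 < x →
    derivWithin (fun s => ρ s x) (Icc 0 T) t + velocity (ω t) x * deriv (ρ t) x = 0

/-- `(ω, ρ)` is the unique maximal smooth solution with data `(ω₀, ρ₀)`, and its lifetime is the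
(finite) time `Ts`: it is a solution on `[0, T]` for all `T < Ts`, and every solution with these
data on some `[0, T]` has `T < Ts` and coincides with `(ω, ρ)` there. -/
structure IsMaximalSolution (ω₀ ρ₀ : ℝ → ℝ) (Ts : ℝ) (ω ρ : ℝ → ℝ → ℝ) : Prop where
  pos : 0 < Ts
  solution : ∀ T, 0 < T → T < Ts → IsSolution ω₀ ρ₀ T ω ρ
  maximal : ∀ (T : ℝ) (ω' ρ' : ℝ → ℝ → ℝ), IsSolution ω₀ ρ₀ T ω' ρ' →
    T < Ts ∧ ∀ t ∈ Icc 0 T, ∀ x, 0 < x → ω' t x = ω t x ∧ ρ' t x = ρ t x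

/-- `A` is the particle trajectory in `(0, ∞)` on `[0, Ts)` starting at `A₀`:
`A(0) = A₀`, `A'(t) = u(A(t), t)`. -/
structure IsTrajectory (ω : ℝ → ℝ → ℝ) (Ts A₀ : ℝ) (A : ℝ → ℝ) : Prop where
  init : A 0 = A₀
  pos : ∀ t ∈ Ico 0 Ts, 0 < A t
  ode : ∀ t ∈ Ico 0 Ts, HasDerivWithinAt A (velocity (ω t) (A t)) (Ico 0 Ts) t

/-- The scales and exponents of the barrier construction. `lam n` is `λ_n` for `n ≥ 0`; the two
further scales are `lamNegOne = λ_{-1}`, `lamNegTwo = λ_{-2}`. The other sequences are used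
for indices `n ≥ 1` only. -/
structure Parameters where
  lamNegTwo : ℝ
  lamNegOne : ℝ
  lam : ℕ → ℝ
  p : ℕ → ℝ
  q : ℕ → ℝ
  φ : ℕ → ℝ
  ψ : ℕ → ℝ
  m : ℕ → ℝ
  M : ℕ → ℝ

/-- The conditions imposed on the scales and exponents. Conditions relating the indices `n - 1`
and `n`, `n ≥ 2`, are written for `n` and `n + 1`, `n ≥ 1`. -/
structure Parameters.Admissible (P : Parameters) : Prop where
  lamNegTwo_lt : P.lamNegTwo < 1
  lamNegOne_lt : P.lamNegOne < P.lamNegTwo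
  lam_zero_lt : P.lam 0 < P.lamNegOne
  lam_pos : ∀ n, 0 < P.lam n
  lam_anti : ∀ n, P.lam (n + 1) < P.lam n
  lam_tendsto : Tendsto P.lam atTop (𝓝 0)
  phi_pos : ∀ n, 1 ≤ n → 0 < P.φ n
  phi_lt_psi : ∀ n, 1 ≤ n → P.φ n < P.ψ n
  p_pos : ∀ n, 1 ≤ n → 0 < P.p n
  p_mono : ∀ n, 1 ≤ n → P.p n < P.p (n + 1)
  p_tendsto : Tendsto P.p atTop (𝓝 (1 / 2))
  q_anti : ∀ n, 1 ≤ n → P.q (n + 1) < P.q n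
  q_tendsto : Tendsto P.q atTop (𝓝 (1 / 2))
  p_add_q : ∀ n, 1 ≤ n → P.p n + P.q n = 1
  m_pos : ∀ n, 1 ≤ n → 0 < P.m n
  m_mono : ∀ n, 1 ≤ n → P.m n < P.m (n + 1)
  m_tendsto : Tendsto P.m atTop (𝓝 1)
  M_anti : ∀ n, 1 ≤ n → P.M (n + 1) < P.M n
  M_tendsto : Tendsto P.M atTop (𝓝 1)
  phi_mul_psi : ∀ n, 1 ≤ n → P.φ n * P.ψ n = 1
  lam_ratio : Tendsto (fun n => P.lam (n + 1) / P.lam n) atTop (𝓝 0)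
  lam_rpow : Tendsto (fun n => P.lam (n + 1) ^ (P.q (n + 1) - P.q n)) atTop (𝓝 1)
  psi_quot : ∀ n, 1 ≤ n →
    P.q (n + 1) / P.q n * (P.ψ n / P.ψ (n + 1)) * P.lam n ^ (P.q (n + 1) - P.q n) ≤ 1
  phi_quot : ∀ n, 1 ≤ n →
    1 ≤ P.p (n + 1) / P.p n * (P.φ n / P.φ (n + 1)) * P.lam n ^ (P.p (n + 1) - P.p n)
  relay_start : P.φ 1 * P.lam 0 ^ (-P.p 1) < P.ψ 1 * P.lam 0 ^ (-P.q 1)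
  relay_lower : ∀ n, 1 ≤ n →
    P.φ (n + 1) * P.lam n ^ (-P.p (n + 1)) ≤ P.φ n * P.lam n ^ (-P.p n)
  relay_upper : ∀ n, 1 ≤ n →
    P.ψ n * P.lam n ^ (-P.q n) ≤ P.ψ (n + 1) * P.lam n ^ (-P.q (n + 1))
  trapping_lower : ∀ n, 1 ≤ n → P.p n / (P.m n * (1 - P.p n)) < 1
  trapping_upper : ∀ n, 1 ≤ n → 1 < P.q n / (P.M n * (1 - P.q n))

/-- Suitably prepared initial data for the parameters `P`, the margin `δ` and the position `A₀`.
The number `R` is an upper bound for the part of `ρ₀` to the right of `λ_{-2}`, where `ρ₀` is not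
prescribed. In `barrier`, `x` ranges over `I_{n+1} = [λ_{n+1}, λ_n]`, `n ≥ 0`. -/
structure SuitablyPrepared (P : Parameters) (δ R A₀ : ℝ) (ω₀ ρ₀ : ℝ → ℝ) : Prop where
  omega_C1 : IsC1Compact ω₀
  rho_C1 : IsC1Compact ρ₀
  A₀_pos : 0 < A₀
  A₀_lt : A₀ < P.lam 0
  δ_pos : 0 < δ
  δ_small : P.φ 1 * P.lam 0 ^ (-P.p 1) < P.ψ 1 * P.lam 0 ^ (-P.q 1) - δ
  omega_nonneg : ∀ x, 0 < x → 0 ≤ ω₀ x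
  rho_nonneg : ∀ x, 0 < x → 0 ≤ ρ₀ x
  support : ∃ ε, 0 < ε ∧ ε < A₀ ∧
    ∀ x, 0 < x → x ∉ Icc ε (P.lamNegTwo + δ) → ω₀ x = 0 ∧ ρ₀ x = 0
  barrier : ∀ n : ℕ, ∀ x ∈ Icc (P.lam (n + 1)) (P.lam n), A₀ ≤ x →
    P.φ (n + 1) * x ^ (-P.p (n + 1)) < ω₀ x ∧ ω₀ x < P.ψ (n + 1) * x ^ (-P.q (n + 1))
  upper : ∀ x ∈ Icc (P.lam 0) (P.lamNegTwo + δ), ω₀ x < P.ψ 1 * P.lam 0 ^ (-P.q 1) - δ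
  lower : ∀ x ∈ Icc (P.lam 0) P.lamNegOne, P.φ 1 * P.lam 0 ^ (-P.p 1) < ω₀ x
  rho_eq_one : ∀ x ∈ Icc A₀ P.lamNegTwo, ρ₀ x = 1
  rho_le : ∀ x, P.lamNegTwo ≤ x → ρ₀ x ≤ R

end NonlocalTransport

/-! Blowup is forced because a vorticity that stays comparable to `x^{-1/2}` drives a particle into
the origin in finite time. If `ω ≥ φ y^{-1/2}` between the particle `A` and `λ_0`, and `A ≤ λ_0 /
4`, then `-A'/A = ∫_A^∞ ω/y dy ≥ φ A^{-1/2}`. Hence `√A` decreases at speed at least `φ/2`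
(`sqrt_path_le`). Particles of a smooth solution never reach the origin, so it cannot live beyond
`T₁ = 2√A₀/φ` (`lifetime_le`).

The profile is kept by the barriers `φ_n x^{-p_n}` and `ψ_n x^{-q_n}` on `[λ_n, λ_{n-1}]`. Along a
particle `X` with `ρ = 1`, `ω' = 1/X` and `X' = -X I`, where `I` is the value of `tailMean` at `X`.
Since `p_n + q_n = 1` and `φ_n ψ_n = 1`, the two barriers have product `1/x`. Therefore `ω - lower`
increases along the particle as long as `I ≤ upper / p_n`, and `ω - upper` decreases as long as `I ≥
lower / q_n`. Integrating the barriers gives about `upper / q_n` from above and `lower / p_n` from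
below, and `p_n < 1/2 < q_n` leaves room for the contribution from the right (`tailMean_bounds`).

The value `I(x)` only sees the vorticity to the right of `x` and particles move to the left, so
control is handed from each scale to the next smaller one. At the largest scale the particles come
from a far field that hardly changes before `T₁` if `A₀` is small (`tailMean_lam_zero`). A
continuity argument in time closes the loop (`between`). The exponents tend to `1/2` so fast that
the barriers are comparable to `x^{-1/2}` uniformly in `n` (`doublyExponential.trapping`).

For existence, the Lagrangian unknowns `J = a X_a / X` and `ω ∘ X` solve an ODE with locally
Lipschitz field in a space of bounded continuous functions (`lipschitzOnWith_field`). As lifetimes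
are bounded, a maximal curve has unbounded norm (`exists_maximal_solvesOn`), and since `J = exp ∫ ω
∘ X` this means that `∫ ‖ω‖` diverges (`tendsto_integral_supNorm`). Uniqueness is a weighted maximum
estimate along the flow (`IsFlow.eq_of_isSolution`). -/

namespace NonlocalTransport

/-! ### Autonomous ODEs in Banach spaces: local existence, uniqueness, maximal curves. -/

section AutonomousODE

open Metric
open scoped NNReal

variable {E : Type*} [NormedAddCommGroup E] [NormedSpace ℝ E]

/-- `α` is an integral curve of the autonomous field `F` on the open interval `(a, b)`. -/
def SolvesOn (F : E → E) (α : ℝ → E) (a b : ℝ) : Prop :=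
  ∀ t ∈ Ioo a b, HasDerivAt α (F (α t)) t

theorem SolvesOn.mono {F : E → E} {α : ℝ → E} {a b a' b' : ℝ} (h : SolvesOn F α a b)
    (ha : a ≤ a') (hb : b' ≤ b) : SolvesOn F α a' b' :=
  fun t ht => h t ⟨ha.trans_lt ht.1, ht.2.trans_le hb⟩

theorem SolvesOn.continuousOn {F : E → E} {α : ℝ → E} {a b : ℝ} (h : SolvesOn F α a b) :
    ContinuousOn α (Ioo a b) :=
  fun t ht => (h t ht).continuousAt.continuousWithinAt

/-- A field which is Lipschitz on balls has solutions with a lifetime which only depends on a bound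
for the initial value. -/
theorem exists_uniform_solvesOn [CompleteSpace E] {F : E → E}
    (hF : ∀ R : ℝ, ∃ K : ℝ≥0, LipschitzOnWith K F (closedBall 0 R)) (R : ℝ) :
    ∃ τ : ℝ, 0 < τ ∧ ∀ (t₀ : ℝ) (x : E), ‖x‖ ≤ R →
      ∃ α : ℝ → E, α t₀ = x ∧ SolvesOn F α (t₀ - τ) (t₀ + τ) := by
  obtain ⟨K, hK⟩ := hF (|R| + 1)
  -- `L` bounds the field on the ball of radius `|R| + 1`, so a curve cannot leave the unit ball
  -- around its starting point before time `1 / L`.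
  set L : ℝ≥0 := ‖F 0‖₊ + K * (Real.toNNReal (|R| + 1)) + 1 with hL
  have hLpos : (0 : ℝ) < L := by positivity
  have hτ : (0 : ℝ) < 1 / L := by positivity
  refine ⟨1 / L, hτ, fun t₀ x hx => ?_⟩
  have hsub : closedBall x ((1 : ℝ≥0) : ℝ) ⊆ closedBall (0 : E) (|R| + 1) := by
    intro y hy
    rw [mem_closedBall, dist_eq_norm] at hy
    rw [mem_closedBall_zero_iff]
    have := norm_le_norm_add_norm_sub x y
    rw [norm_sub_rev] at this
    have h2 := le_abs_self R
    simp only [NNReal.coe_one] at hy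
    linarith
  have hb : ∀ y ∈ closedBall x ((1 : ℝ≥0) : ℝ), ‖F y‖ ≤ L := by
    intro y hy
    have hy' := hsub hy
    have h0 : (0 : E) ∈ closedBall (0 : E) (|R| + 1) := by
      rw [mem_closedBall_zero_iff, norm_zero]; positivity
    have h1 := hK.norm_sub_le hy' h0
    rw [sub_zero] at h1
    rw [mem_closedBall_zero_iff] at hy'
    have h2 : ‖F y‖ ≤ ‖F 0‖ + ‖F y - F 0‖ := by
      have := norm_add_le (F 0) (F y - F 0); simpa using this
    have h3 : (K : ℝ) * ‖y‖ ≤ K * (|R| + 1) := by gcongr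
    rw [hL]
    push_cast
    rw [Real.coe_toNNReal _ (by positivity)]
    linarith
  have hP : IsPicardLindelof (fun _ ↦ F) (tmin := t₀ - 1 / L) (tmax := t₀ + 1 / L)
      ⟨t₀, by constructor <;> linarith⟩ x 1 0 L K := by
    refine IsPicardLindelof.of_time_independent hb (hK.mono hsub) ?_
    simp [hLpos.ne']
  obtain ⟨α, hα0, hα⟩ := hP.exists_eq_forall_mem_Icc_hasDerivWithinAt₀
  exact ⟨α, hα0, fun t ht => (hα t (Ioo_subset_Icc_self ht)).hasDerivAt (Icc_mem_nhds ht.1 ht.2)⟩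

theorem SolvesOn.eqOn {F : E → E}
    (hF : ∀ R : ℝ, ∃ K : ℝ≥0, LipschitzOnWith K F (closedBall 0 R)) {α β : ℝ → E} {a b t₀ : ℝ}
    (ht₀ : t₀ ∈ Ioo a b) (hα : SolvesOn F α a b) (hβ : SolvesOn F β a b) (h : α t₀ = β t₀) :
    EqOn α β (Ioo a b) := by
  intro t ht
  obtain ⟨a', ha', ha''⟩ := exists_between (lt_min ht₀.1 ht.1)
  obtain ⟨b', hb', hb''⟩ := exists_between (max_lt ht₀.2 ht.2)
  rw [lt_min_iff] at ha''
  rw [max_lt_iff] at hb'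
  have hsub : Icc a' b' ⊆ Ioo a b := fun s hs => ⟨ha'.trans_le hs.1, hs.2.trans_lt hb''⟩
  -- The field is only Lipschitz on balls; on a compact subinterval both curves stay in a common
  -- one.
  have hαc := hα.continuousOn.mono hsub
  have hβc := hβ.continuousOn.mono hsub
  obtain ⟨C₁, hC₁⟩ := isCompact_Icc.exists_bound_of_continuousOn hαc
  obtain ⟨C₂, hC₂⟩ := isCompact_Icc.exists_bound_of_continuousOn hβc
  obtain ⟨K, hK⟩ := hF (max C₁ C₂)
  refine ODE_solution_unique_of_mem_Icc (v := fun _ => F) (s := fun _ => closedBall 0 (max C₁ C₂))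
    (K := K) (fun _ _ => hK) (t₀ := t₀) ⟨ha''.1, hb'.1⟩ hαc
    (fun s hs => hα s (hsub (Ioo_subset_Icc_self hs))) (fun s hs => ?_) hβc
    (fun s hs => hβ s (hsub (Ioo_subset_Icc_self hs))) (fun s hs => ?_) h ⟨ha''.2.le, hb'.2.le⟩
  · rw [mem_closedBall_zero_iff]
    exact (hC₁ s (Ioo_subset_Icc_self hs)).trans (le_max_left _ _)
  · rw [mem_closedBall_zero_iff]
    exact (hC₂ s (Ioo_subset_Icc_self hs)).trans (le_max_right _ _)

theorem SolvesOn.piecewise {F : E → E} {α β : ℝ → E} {a b c t₁ : ℝ}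
    (ht₁ : t₁ < b) (hα : SolvesOn F α a b) {a' : ℝ} (ha' : a' < t₁) (hβ : SolvesOn F β a' c)
    (h : α t₁ = β t₁) : SolvesOn F (fun t => if t ≤ t₁ then α t else β t) a c := by
  intro t ht
  rcases lt_trichotomy t t₁ with hlt | rfl | hgt
  · have he : (fun t => if t ≤ t₁ then α t else β t) =ᶠ[𝓝 t] α := by
      filter_upwards [Iio_mem_nhds hlt] with s hs
      exact if_pos (le_of_lt hs)
    have := hα t ⟨ht.1, hlt.trans ht₁⟩
    simp only [if_pos hlt.le]
    exact this.congr_of_eventuallyEq he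
  · have h1 := (hα t ⟨ht.1, ht₁⟩).hasDerivWithinAt (s := Iic t)
    have h2 := (hβ t ⟨ha', ht.2⟩).hasDerivWithinAt (s := Ici t)
    rw [← hasDerivWithinAt_univ, ← Iic_union_Ici (a := t)]
    simp only [le_refl, if_true]
    refine (h1.congr (fun s hs => if_pos (mem_Iic.1 hs)) (if_pos le_rfl)).union ?_
    rw [h]
    refine h2.congr (fun s hs => ?_) ((if_pos le_rfl).trans h)
    rcases eq_or_lt_of_le (mem_Ici.1 hs) with rfl | hs'
    · exact (if_pos le_rfl).trans h
    · exact if_neg (not_le.2 hs')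
  · have he : (fun t => if t ≤ t₁ then α t else β t) =ᶠ[𝓝 t] β := by
      filter_upwards [Ioi_mem_nhds hgt] with s hs
      exact if_neg (not_le.2 hs)
    have := hβ t ⟨ha'.trans hgt, ht.2⟩
    simp only [if_neg (not_le.2 hgt)]
    exact this.congr_of_eventuallyEq he

/-- If the lifetimes of all solutions are bounded, there is a solution with a maximal lifetime, and
it is unbounded. -/
theorem exists_maximal_solvesOn [CompleteSpace E] {F : E → E}
    (hF : ∀ R : ℝ, ∃ K : ℝ≥0, LipschitzOnWith K F (closedBall 0 R)) (x₀ : E) (T₁ : ℝ)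
    (hT₁ : ∀ (η T : ℝ) (α : ℝ → E), 0 < η → 0 < T → α 0 = x₀ → SolvesOn F α (-η) T → T ≤ T₁) :
    ∃ (η T : ℝ) (α : ℝ → E), 0 < η ∧ 0 < T ∧ α 0 = x₀ ∧ SolvesOn F α (-η) T ∧
      ∀ R : ℝ, ∃ t ∈ Ico 0 T, R < ‖α t‖ := by
  obtain ⟨η, hη, hloc⟩ := exists_uniform_solvesOn hF ‖x₀‖
  obtain ⟨α₀, hα₀, hα₀s⟩ := hloc 0 x₀ le_rfl
  rw [zero_sub, zero_add] at hα₀s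
  -- The past `-η` is the same for all candidates. It makes time `0` an interior point, so that
  -- derivatives there are two-sided.
  set D : Set ℝ := {T | 0 < T ∧ ∃ α : ℝ → E, α 0 = x₀ ∧ SolvesOn F α (-η) T} with hD
  have hDne : D.Nonempty := ⟨η, hη, α₀, hα₀, hα₀s⟩
  have hDbdd : BddAbove D := ⟨T₁, fun T ⟨hT, α, h0, hα⟩ => hT₁ η T α hη hT h0 hα⟩
  set Ts := sSup D with hTs
  have hTspos : 0 < Ts := hη.trans_le (le_csSup hDbdd ⟨hη, α₀, hα₀, hα₀s⟩)
  -- One curve is chosen for every `t < Ts`. By uniqueness they agree where they overlap, so the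
  -- diagonal `β t t` solves the equation up to `Ts`.
  have hex : ∀ t, ∃ T α, t < Ts → (t < T ∧ 0 < T ∧ α 0 = x₀ ∧ SolvesOn F α (-η) T) := by
    intro t
    by_cases ht : t < Ts
    · obtain ⟨T, ⟨hT, α, h⟩, htT⟩ := exists_lt_of_lt_csSup hDne ht
      exact ⟨T, α, fun _ => ⟨htT, hT, h⟩⟩
    · exact ⟨0, fun _ => 0, fun h => absurd h ht⟩
  choose τ β hβ using hex
  have hagree : ∀ t ∈ Ioo (-η) Ts, ∀ s ∈ Ioo (-η) (τ t), s < Ts → β s s = β t s := by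
    intro t ht s hs hsT
    obtain ⟨h1, h2, h3, h4⟩ := hβ t ht.2
    obtain ⟨k1, k2, k3, k4⟩ := hβ s hsT
    have hmin : 0 < min (τ t) (τ s) := lt_min h2 k2
    exact SolvesOn.eqOn hF (t₀ := 0) ⟨by linarith, hmin⟩ (k4.mono le_rfl (min_le_right _ _))
      (h4.mono le_rfl (min_le_left _ _)) (k3.trans h3.symm) ⟨hs.1, lt_min hs.2 k1⟩
  have hsol : SolvesOn F (fun t => β t t) (-η) Ts := by
    intro t ht
    obtain ⟨h1, h2, h3, h4⟩ := hβ t ht.2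
    refine (h4 t ⟨ht.1, h1⟩).congr_of_eventuallyEq ?_
    filter_upwards [Ioo_mem_nhds ht.1 (lt_min h1 ht.2)] with s hs
    exact hagree t ht s ⟨hs.1, hs.2.trans_le (min_le_left _ _)⟩ (hs.2.trans_le (min_le_right _ _))
  refine ⟨η, Ts, fun t => β t t, hη, hTspos, (hβ 0 hTspos).2.2.1, hsol, ?_⟩
  by_contra! hcon
  obtain ⟨R, hR⟩ := hcon
  obtain ⟨ε, hε, hloc'⟩ := exists_uniform_solvesOn hF R
  have hpos : 0 ≤ max 0 (Ts - ε / 2) := le_max_left _ _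
  -- A bounded curve could be restarted at `t₁`, less than `ε` before `Ts`, and would live for a
  -- further time `ε`.
  set t₁ := max 0 (Ts - ε / 2) with ht₁
  have ht₁T : t₁ < Ts := max_lt hTspos (by linarith)
  obtain ⟨γ, hγ0, hγ⟩ := hloc' t₁ (β t₁ t₁) (hR t₁ ⟨hpos, ht₁T⟩)
  have hnew : Ts < t₁ + ε := by
    have : Ts - ε / 2 ≤ t₁ := le_max_right _ _
    linarith
  have hg := hsol.piecewise (c := t₁ + ε) ht₁T (sub_lt_self t₁ hε) hγ hγ0.symm
  refine absurd (le_csSup hDbdd (a := t₁ + ε) ⟨by linarith, _, ?_, hg⟩) (not_le.2 hnew)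
  simp only [if_pos hpos]
  exact (hβ 0 hTspos).2.2.1

end AutonomousODE

end NonlocalTransport

/-! ### Integral and exponential operators on bounded continuous functions. -/

namespace NonlocalTransport

section Operators

open MeasureTheory BoundedContinuousFunction
open scoped NNReal

/-- The primitive `a ↦ ∫_a^∞ g` of a continuous integrable function has derivative `-g`. -/
theorem hasDerivAt_integral_Ioi {g : ℝ → ℝ} (hg : Continuous g) (hi : Integrable g) (a : ℝ) :
    HasDerivAt (fun a => ∫ b in Ioi a, g b) (-g a) a := by
  have h : (fun a => ∫ b in Ioi a, g b) =
      fun a => (∫ b in Ioi (0 : ℝ), g b) - ∫ b in (0 : ℝ)..a, g b := by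
    funext a
    rw [← intervalIntegral.integral_interval_add_Ioi' (hg.intervalIntegrable 0 a) hi.integrableOn]
    ring
  rw [h, ← zero_sub]
  exact (hasDerivAt_const a _).sub (intervalIntegral.integral_hasDerivAt_right
    (hg.intervalIntegrable _ _) (hg.stronglyMeasurableAtFilter _ _) hg.continuousAt)

theorem integrable_kernel_mul {k : ℝ → ℝ} (hk : Continuous k) (hs : HasCompactSupport k)
    (f : ℝ →ᵇ ℝ) : Integrable fun b => k b * f b :=
  (hk.mul f.continuous).integrable_of_hasCompactSupport hs.mul_right

/-- The operator `f ↦ (a ↦ ∫_a^∞ k f)` on bounded continuous functions. -/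
noncomputable def tailIntegral (k : ℝ → ℝ) (hk : Continuous k) (hs : HasCompactSupport k) :
    (ℝ →ᵇ ℝ) →L[ℝ] (ℝ →ᵇ ℝ) :=
  have bound : ∀ (f : ℝ →ᵇ ℝ) (a : ℝ), ‖∫ b in Ioi a, k b * f b‖ ≤ (∫ b, ‖k b‖) * ‖f‖ := by
    intro f a
    have hki : Integrable k := hk.integrable_of_hasCompactSupport hs
    calc ‖∫ b in Ioi a, k b * f b‖ ≤ ∫ b in Ioi a, ‖k b * f b‖ := norm_integral_le_integral_norm _
      _ ≤ ∫ b, ‖k b * f b‖ := setIntegral_le_integral (integrable_kernel_mul hk hs f).norm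
          (Eventually.of_forall fun _ => norm_nonneg _)
      _ ≤ ∫ b, ‖k b‖ * ‖f‖ := by
          refine integral_mono (integrable_kernel_mul hk hs f).norm (hki.norm.mul_const _)
            fun b => ?_
          simp only [norm_mul]
          gcongr
          exact f.norm_coe_le_norm b
      _ = (∫ b, ‖k b‖) * ‖f‖ := integral_mul_const _ _
  LinearMap.mkContinuous
    { toFun := fun f => ofNormedAddCommGroup (fun a => ∫ b in Ioi a, k b * f b)
        (continuous_iff_continuousAt.2 fun a => (hasDerivAt_integral_Ioi (hk.mul f.continuous)
          (integrable_kernel_mul hk hs f) a).continuousAt) _ (bound f)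
      map_add' := by
        intro f g
        ext a
        simp only [coe_ofNormedAddCommGroup, BoundedContinuousFunction.coe_add, Pi.add_apply,
          mul_add]
        exact integral_add (integrable_kernel_mul hk hs f).integrableOn
          (integrable_kernel_mul hk hs g).integrableOn
      map_smul' := by
        intro c f
        ext a
        simp only [coe_ofNormedAddCommGroup, BoundedContinuousFunction.coe_smul, smul_eq_mul,
          RingHom.id_apply]
        rw [← integral_const_mul]
        congr 1
        funext b
        ring }
    (∫ b, ‖k b‖) (fun f => norm_ofNormedAddCommGroup_le _
      (mul_nonneg (integral_nonneg fun _ => norm_nonneg _) (norm_nonneg _)) (bound f))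

theorem tailIntegral_apply {k : ℝ → ℝ} (hk : Continuous k) (hs : HasCompactSupport k)
    (f : ℝ →ᵇ ℝ) (a : ℝ) : tailIntegral k hk hs f a = ∫ b in Ioi a, k b * f b := rfl

theorem hasDerivAt_tailIntegral {k : ℝ → ℝ} (hk : Continuous k) (hs : HasCompactSupport k)
    (f : ℝ →ᵇ ℝ) (a : ℝ) : HasDerivAt (tailIntegral k hk hs f) (-(k a * f a)) a :=
  hasDerivAt_integral_Ioi (hk.mul f.continuous) (integrable_kernel_mul hk hs f) a

/-- The exponential of a bounded continuous function. -/
noncomputable def bexp (f : ℝ →ᵇ ℝ) : ℝ →ᵇ ℝ :=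
  ofNormedAddCommGroup (fun a => Real.exp (f a)) (Real.continuous_exp.comp f.continuous)
    (Real.exp ‖f‖) fun a => by
      rw [Real.norm_eq_abs, Real.abs_exp, Real.exp_le_exp]
      exact (le_abs_self _).trans (f.norm_coe_le_norm a)

@[simp]
theorem bexp_apply (f : ℝ →ᵇ ℝ) (a : ℝ) : bexp f a = Real.exp (f a) := rfl

theorem norm_bexp_le (f : ℝ →ᵇ ℝ) : ‖bexp f‖ ≤ Real.exp ‖f‖ :=
  norm_ofNormedAddCommGroup_le _ (Real.exp_pos _).le _

theorem abs_exp_sub_exp_le {M x y : ℝ} (hx : x ≤ M) (hy : y ≤ M) :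
    |Real.exp x - Real.exp y| ≤ Real.exp M * |x - y| := by
  have := Convex.norm_image_sub_le_of_norm_deriv_le (f := Real.exp) (C := Real.exp M) (s := Iic M)
    (fun z _ => Real.differentiableAt_exp) (fun z hz => by
      rw [Real.deriv_exp, Real.norm_eq_abs, Real.abs_exp]; exact Real.exp_le_exp.2 hz)
    (convex_Iic M) (x := y) (y := x) hy hx
  simpa using this

theorem norm_bexp_sub_le {M : ℝ} {f g : ℝ →ᵇ ℝ} (hf : ‖f‖ ≤ M) (hg : ‖g‖ ≤ M) :
    ‖bexp f - bexp g‖ ≤ Real.exp M * ‖f - g‖ := by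
  refine (BoundedContinuousFunction.norm_le (by positivity)).2 fun a => ?_
  have h1 : f a ≤ M := ((le_abs_self _).trans (f.norm_coe_le_norm a)).trans hf
  have h2 : g a ≤ M := ((le_abs_self _).trans (g.norm_coe_le_norm a)).trans hg
  refine (abs_exp_sub_exp_le h1 h2).trans ?_
  gcongr
  exact (f - g).norm_coe_le_norm a

theorem continuous_bexp : Continuous bexp := by
  rw [continuous_iff_continuousAt]
  intro f
  have hL : LipschitzOnWith (Real.toNNReal (Real.exp (‖f‖ + 1))) bexp (Metric.closedBall 0 (‖f‖ + 1)) := by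
    refine LipschitzOnWith.of_dist_le_mul fun x hx y hy => ?_
    rw [mem_closedBall_zero_iff] at hx hy
    rw [dist_eq_norm, dist_eq_norm, Real.coe_toNNReal _ (Real.exp_pos _).le]
    exact norm_bexp_sub_le hx hy
  refine hL.continuousOn.continuousAt ?_
  refine mem_of_superset (Metric.closedBall_mem_nhds f one_pos) fun g hg => ?_
  rw [Metric.mem_closedBall, dist_eq_norm] at hg
  rw [mem_closedBall_zero_iff]
  have := norm_le_norm_add_norm_sub f g
  rw [norm_sub_rev] at this
  linarith

/-- A continuous function with compact support in `(0, ∞)` which equals `1 / b` on `[l, L]`. -/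
noncomputable def cutoffInv (l L b : ℝ) : ℝ :=
  max 0 (min 1 (min (2 * (b / l) - 1) (2 - b / L))) / max b l

theorem continuous_cutoffInv {l : ℝ} (hl : 0 < l) (L : ℝ) : Continuous (cutoffInv l L) := by
  unfold cutoffInv
  refine Continuous.div (by fun_prop) (by fun_prop) fun b => ?_
  exact (hl.trans_le (le_max_right _ _)).ne'

theorem hasCompactSupport_cutoffInv {l L : ℝ} (hl : 0 < l) (hL : 0 < L) :
    HasCompactSupport (cutoffInv l L) := by
  refine HasCompactSupport.intro (K := Icc (l / 2) (2 * L)) isCompact_Icc fun b hb => ?_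
  unfold cutoffInv
  rw [div_eq_zero_iff]
  left
  rw [max_eq_left_iff]
  rcases lt_or_ge b (l / 2) with h | h
  · refine (min_le_right _ _).trans ((min_le_left _ _).trans ?_)
    have : b / l < 1 / 2 := by rw [div_lt_iff₀ hl]; linarith
    linarith
  · have h' : 2 * L < b := by
      by_contra! hc
      exact hb ⟨h, hc⟩
    refine (min_le_right _ _).trans ((min_le_right _ _).trans ?_)
    have : 2 ≤ b / L := by rw [le_div_iff₀ hL]; linarith
    linarith

theorem cutoffInv_of_mem {l L b : ℝ} (hl : 0 < l) (hb : b ∈ Icc l L) : cutoffInv l L b = 1 / b := by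
  have hL : 0 < L := hl.trans_le (hb.1.trans hb.2)
  unfold cutoffInv
  have h1 : 1 ≤ b / l := by rw [le_div_iff₀ hl]; linarith [hb.1]
  have h2 : b / L ≤ 1 := by rw [div_le_one hL]; exact hb.2
  rw [max_eq_left hb.1, min_eq_left, max_eq_right zero_le_one]
  exact le_min (by linarith) (by linarith)

end Operators

/-! ### The system in Lagrangian coordinates as an ODE. -/

/-- Initial data for the Lagrangian system: continuously differentiable functions with support in
`[l, L]`, where `0 < l`. -/
structure LagrangianData where
  l : ℝ
  L : ℝ
  w : ℝ → ℝ
  r : ℝ → ℝ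
  l_pos : 0 < l
  l_lt : l < L
  w_contDiff : ContDiff ℝ 1 w
  r_contDiff : ContDiff ℝ 1 r
  w_support : ∀ x, x ∉ Icc l L → w x = 0
  r_support : ∀ x, x ∉ Icc l L → r x = 0

namespace LagrangianData

open MeasureTheory BoundedContinuousFunction
open scoped NNReal

variable (D : LagrangianData)

theorem L_pos : 0 < D.L := D.l_pos.trans D.l_lt

/-- The kernel of the velocity in Lagrangian coordinates. -/
noncomputable def k : ℝ → ℝ := cutoffInv D.l D.L

theorem continuous_k : Continuous D.k := continuous_cutoffInv D.l_pos _

theorem hasCompactSupport_k : HasCompactSupport D.k := hasCompactSupport_cutoffInv D.l_pos D.L_pos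

theorem mul_k {a : ℝ} (ha : a ∈ Icc D.l D.L) : a * D.k a = 1 := by
  rw [k, cutoffInv_of_mem D.l_pos ha, mul_one_div_cancel (D.l_pos.trans_le ha.1).ne']

/-- The source `r / x` as a function of the label. -/
noncomputable def s (a : ℝ) : ℝ := D.r a / max a (D.l / 2)

theorem s_eq (a : ℝ) : D.s a = D.r a / a := by
  by_cases ha : a ∈ Icc D.l D.L
  · rw [s, max_eq_left]
    linarith [ha.1, D.l_pos]
  · rw [s, D.r_support a ha, zero_div, zero_div]

theorem contDiff_s : ContDiff ℝ 1 D.s := by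
  rw [contDiff_iff_contDiffAt]
  intro a
  rcases lt_or_ge a D.l with h | h
  · refine (contDiffAt_const (c := 0)).congr_of_eventuallyEq ?_
    filter_upwards [Iio_mem_nhds h] with b hb
    rw [s, D.r_support b (fun hc => absurd hc.1 (not_le.2 hb)), zero_div]
  · have ha : 0 < a := D.l_pos.trans_le h
    refine (D.r_contDiff.contDiffAt.div contDiffAt_id ha.ne').congr_of_eventuallyEq ?_
    exact Eventually.of_forall fun b => D.s_eq b

theorem exists_bound {f : ℝ → ℝ} (hf : Continuous f) (h : ∀ x, x ∉ Icc D.l D.L → f x = 0) :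
    ∃ C, ∀ x, ‖f x‖ ≤ C := by
  have hs : HasCompactSupport f := HasCompactSupport.intro isCompact_Icc h
  exact hs.exists_bound_of_continuous hf

theorem s_support (x : ℝ) (hx : x ∉ Icc D.l D.L) : D.s x = 0 := by
  rw [s, D.r_support x hx, zero_div]

/-- The initial vorticity as a bounded continuous function. -/
noncomputable def wB : ℝ →ᵇ ℝ :=
  ofNormedAddCommGroup D.w D.w_contDiff.continuous _
    (D.exists_bound D.w_contDiff.continuous D.w_support).choose_spec

noncomputable def sB : ℝ →ᵇ ℝ :=
  ofNormedAddCommGroup D.s D.contDiff_s.continuous _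
    (D.exists_bound D.contDiff_s.continuous D.s_support).choose_spec

noncomputable def tail : (ℝ →ᵇ ℝ) →L[ℝ] (ℝ →ᵇ ℝ) :=
  tailIntegral D.k D.continuous_k D.hasCompactSupport_k

/-- The vector field of the system in Lagrangian coordinates; the unknowns are `J = a X_a / X` and
the vorticity, as functions of the label `a`. -/
noncomputable def field (x : (ℝ →ᵇ ℝ) × (ℝ →ᵇ ℝ)) : (ℝ →ᵇ ℝ) × (ℝ →ᵇ ℝ) :=
  -- From `u_x = u/x + ω`, `(log J)_t = u_x - u/X = ω`. From `∂_a log X = J / a`, `log (a / X) =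
  -- ∫_a^∞ (J - 1) / b db`, and this exponent turns the source `r / X` into `(r / a) exp (log (a /
  -- X))`.
  (x.1 * x.2, D.sB * bexp (D.tail (x.1 - 1)))

/-- No derivative of the unknowns enters the field: it is built from a product, a bounded linear
operator and the exponential, each Lipschitz on bounded sets. -/
theorem lipschitzOnWith_field (R : ℝ) :
    ∃ K : ℝ≥0, LipschitzOnWith K D.field (Metric.closedBall 0 R) := by
  set C : ℝ := ‖D.tail‖ with hC
  have hC0 : 0 ≤ C := by rw [hC]; positivity
  set K : ℝ := max (2 * |R|) (‖D.sB‖ * (Real.exp (C * (|R| + 1)) * C)) with hK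
  have hK0 : 0 ≤ K := le_max_of_le_left (by positivity)
  refine ⟨Real.toNNReal K, LipschitzOnWith.of_dist_le_mul fun x hx y hy => ?_⟩
  rw [mem_closedBall_zero_iff] at hx hy
  rw [dist_eq_norm, dist_eq_norm, Real.coe_toNNReal _ hK0]
  have hR := le_abs_self R
  have x1 : ‖x.1‖ ≤ |R| := (norm_fst_le x).trans (hx.trans hR)
  have x2 : ‖x.2‖ ≤ |R| := (norm_snd_le x).trans (hx.trans hR)
  have y1 : ‖y.1‖ ≤ |R| := (norm_fst_le y).trans (hy.trans hR)
  have d1 : ‖x.1 - y.1‖ ≤ ‖x - y‖ := norm_fst_le (x - y)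
  have d2 : ‖x.2 - y.2‖ ≤ ‖x - y‖ := norm_snd_le (x - y)
  have tb : ∀ z : ℝ →ᵇ ℝ, ‖z‖ ≤ |R| → ‖D.tail (z - 1)‖ ≤ C * (|R| + 1) := by
    intro z hz
    refine (D.tail.le_opNorm _).trans ?_
    have : ‖z - 1‖ ≤ |R| + 1 := (norm_sub_le _ _).trans (by rw [norm_one]; linarith)
    gcongr
  rw [Prod.norm_def]
  refine max_le ?_ ?_
  · have he : (D.field x - D.field y).1 = (x.1 - y.1) * x.2 + y.1 * (x.2 - y.2) := by
      simp only [field, Prod.fst_sub]; ring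
    rw [he]
    calc ‖(x.1 - y.1) * x.2 + y.1 * (x.2 - y.2)‖
        ≤ ‖x.1 - y.1‖ * ‖x.2‖ + ‖y.1‖ * ‖x.2 - y.2‖ :=
          (norm_add_le _ _).trans (add_le_add (norm_mul_le _ _) (norm_mul_le _ _))
      _ ≤ ‖x - y‖ * |R| + |R| * ‖x - y‖ := by gcongr
      _ = 2 * |R| * ‖x - y‖ := by ring
      _ ≤ K * ‖x - y‖ := by gcongr; exact le_max_left _ _
  · have he : (D.field x - D.field y).2 =
        D.sB * (bexp (D.tail (x.1 - 1)) - bexp (D.tail (y.1 - 1))) := by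
      simp only [field, Prod.snd_sub]; ring
    rw [he]
    have h2 : D.tail (x.1 - 1) - D.tail (y.1 - 1) = D.tail (x.1 - y.1) := by
      rw [← map_sub]; congr 1; ring
    calc ‖D.sB * (bexp (D.tail (x.1 - 1)) - bexp (D.tail (y.1 - 1)))‖
        ≤ ‖D.sB‖ * ‖bexp (D.tail (x.1 - 1)) - bexp (D.tail (y.1 - 1))‖ := norm_mul_le _ _
      _ ≤ ‖D.sB‖ * (Real.exp (C * (|R| + 1)) * ‖D.tail (x.1 - 1) - D.tail (y.1 - 1)‖) := by
          gcongr
          exact norm_bexp_sub_le (tb _ x1) (tb _ y1)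
      _ ≤ ‖D.sB‖ * (Real.exp (C * (|R| + 1)) * (C * ‖x - y‖)) := by
          rw [h2]
          gcongr
          exact (D.tail.le_opNorm _).trans (by gcongr)
      _ = ‖D.sB‖ * (Real.exp (C * (|R| + 1)) * C) * ‖x - y‖ := by ring
      _ ≤ K * ‖x - y‖ := by gcongr; exact le_max_right _ _

end LagrangianData

end NonlocalTransport

/-! ### Inverting the flow: regularity of functions in Eulerian coordinates. -/

namespace NonlocalTransport

/-- `N` has the continuous partial derivatives `Nt`, `Na` on `I × ℝ`. -/
structure RegularOn (I : Set ℝ) (N Nt Na : ℝ → ℝ → ℝ) : Prop where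
  hasDerivAt_t : ∀ t ∈ I, ∀ a, HasDerivAt (fun s => N s a) (Nt t a) t
  hasDerivAt_a : ∀ t ∈ I, ∀ a, HasDerivAt (N t) (Na t a) a
  continuousOn_t : ContinuousOn (fun z : ℝ × ℝ => Nt z.1 z.2) (I ×ˢ univ)
  continuousOn_a : ContinuousOn (fun z : ℝ × ℝ => Na z.1 z.2) (I ×ˢ univ)

/-- The linear form `(τ, β) ↦ c τ + d β`. -/
noncomputable def linForm (c d : ℝ) : ℝ × ℝ →L[ℝ] ℝ :=
  c • ContinuousLinearMap.fst ℝ ℝ ℝ + d • ContinuousLinearMap.snd ℝ ℝ ℝ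

@[simp]
theorem linForm_apply (c d : ℝ) (z : ℝ × ℝ) : linForm c d z = c * z.1 + d * z.2 := by
  simp [linForm]

theorem hasStrictFDerivAt_of_partial {U : Set (ℝ × ℝ)} {N Nt Na : ℝ → ℝ → ℝ} {t a : ℝ}
    (hU : U ∈ 𝓝 (t, a)) (ht : ∀ z ∈ U, HasDerivAt (fun s => N s z.2) (Nt z.1 z.2) z.1)
    (ha : ∀ z ∈ U, HasDerivAt (N z.1) (Na z.1 z.2) z.2)
    (ct : ContinuousOn (fun z : ℝ × ℝ => Nt z.1 z.2) U)
    (ca : ContinuousOn (fun z : ℝ × ℝ => Na z.1 z.2) U) :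
    HasStrictFDerivAt (fun z : ℝ × ℝ => N z.1 z.2) (linForm (Nt t a) (Na t a)) (t, a) := by
  have hc : ∀ {g : ℝ → ℝ → ℝ}, ContinuousOn (fun z : ℝ × ℝ => g z.1 z.2) U →
      ContinuousAt (fun z : ℝ × ℝ => ContinuousLinearMap.toSpanSingleton ℝ (g z.1 z.2)) (t, a) := by
    intro g hg
    exact ((ContinuousLinearMap.toSpanSingletonCLE (𝕜 := ℝ) (E := ℝ)).continuous.continuousAt).comp
      (hg.continuousAt hU)
  have := hasStrictFDerivAt_uncurry_coprod (𝕜 := ℝ) (u := (t, a)) (f := N)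
    (f₁ := fun t a => ContinuousLinearMap.toSpanSingleton ℝ (Nt t a))
    (f₂ := fun t a => ContinuousLinearMap.toSpanSingleton ℝ (Na t a))
    (by filter_upwards [hU] with z hz; exact (ht z hz).hasFDerivAt)
    (by filter_upwards [hU] with z hz; exact (ha z hz).hasFDerivAt) (hc ct) (hc ca)
  refine HasStrictFDerivAt.congr_fderiv this ?_
  ext <;> simp [Function.HasUncurry.uncurry]

theorem RegularOn.hasStrictFDerivAt {I : Set ℝ} (hI : IsOpen I) {N Nt Na : ℝ → ℝ → ℝ}
    (h : RegularOn I N Nt Na) {t a : ℝ} (ht : t ∈ I) :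
    HasStrictFDerivAt (fun z : ℝ × ℝ => N z.1 z.2) (linForm (Nt t a) (Na t a)) (t, a) :=
  hasStrictFDerivAt_of_partial ((hI.prod isOpen_univ).mem_nhds ⟨ht, mem_univ _⟩)
    (fun z hz => h.hasDerivAt_t z.1 hz.1 z.2) (fun z hz => h.hasDerivAt_a z.1 hz.1 z.2)
    h.continuousOn_t h.continuousOn_a

theorem RegularOn.continuousOn {I : Set ℝ} (hI : IsOpen I) {N Nt Na : ℝ → ℝ → ℝ}
    (h : RegularOn I N Nt Na) : ContinuousOn (fun z : ℝ × ℝ => N z.1 z.2) (I ×ˢ univ) :=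
  fun z hz => (h.hasStrictFDerivAt hI (a := z.2) hz.1).continuousAt.continuousWithinAt

/-- The label map `x ↦ X(t, ·)⁻¹(x)` of a flow. -/
noncomputable def label (X : ℝ → ℝ → ℝ) (t x : ℝ) : ℝ := Function.invFun (X t) x

section Label

variable {I : Set ℝ} {X Xt Xa : ℝ → ℝ → ℝ}

theorem flow_label (hsurj : ∀ t ∈ I, Function.Surjective (X t)) {t : ℝ} (ht : t ∈ I) (x : ℝ) :
    X t (label X t x) = x :=
  Function.rightInverse_invFun (hsurj t ht) x

theorem label_flow (hX : ∀ t ∈ I, StrictMono (X t)) {t : ℝ} (ht : t ∈ I) (a : ℝ) :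
    label X t (X t a) = a :=
  Function.leftInverse_invFun (hX t ht).injective a

/-- By monotonicity the label of `x` lies above `a` exactly when `X t a < x`, which is an open
condition on `(t, x)` for fixed `a`; likewise from below. -/
theorem continuousAt_label (hI : IsOpen I) (h : RegularOn I X Xt Xa)
    (hX : ∀ t ∈ I, StrictMono (X t)) (hsurj : ∀ t ∈ I, Function.Surjective (X t)) {t : ℝ}
    (ht : t ∈ I) (x : ℝ) : ContinuousAt (fun z : ℝ × ℝ => label X z.1 z.2) (t, x) := by
  have hline : ∀ a, ContinuousAt (fun z : ℝ × ℝ => X z.1 a) (t, x) := by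
    intro a
    have : ContinuousAt (fun s => X s a) t := (h.hasDerivAt_t t ht a).continuousAt
    exact ContinuousAt.comp (f := Prod.fst) (x := (t, x)) this continuousAt_fst
  have hI' : ∀ᶠ z : ℝ × ℝ in 𝓝 (t, x), z.1 ∈ I := continuousAt_fst.eventually (hI.mem_nhds ht)
  refine tendsto_order.2 ⟨fun a ha => ?_, fun a ha => ?_⟩
  · have hlt : X t a < x := by
      rw [← flow_label hsurj ht x]; exact hX t ht ha
    filter_upwards [hI', (hline a).eventually_lt continuousAt_snd hlt] with z hz hzl
    rw [← flow_label hsurj hz z.2] at hzl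
    exact (hX _ hz).lt_iff_lt.1 hzl
  · have hlt : x < X t a := by
      rw [← flow_label hsurj ht x]; exact hX t ht ha
    filter_upwards [hI', continuousAt_snd.eventually_lt (hline a) hlt] with z hz hzl
    rw [← flow_label hsurj hz z.2] at hzl
    exact (hX _ hz).lt_iff_lt.1 hzl

/-- The map `(t, a) ↦ (t, X t a)` has a triangular derivative, invertible because `X_a > 0`. With
continuity of the inverse already known, the inverse is differentiable. -/
theorem hasFDerivAt_label (hI : IsOpen I) (h : RegularOn I X Xt Xa)
    (hpos : ∀ t ∈ I, ∀ a, 0 < Xa t a)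
    (hX : ∀ t ∈ I, StrictMono (X t)) (hsurj : ∀ t ∈ I, Function.Surjective (X t)) {t : ℝ}
    (ht : t ∈ I) (x : ℝ) :
    HasFDerivAt (fun z : ℝ × ℝ => label X z.1 z.2)
      (linForm (-(Xt t (label X t x) / Xa t (label X t x))) (1 / Xa t (label X t x))) (t, x) := by
  set b := label X t x with hb
  have hne : Xa t b ≠ 0 := (hpos t ht b).ne'
  let e : (ℝ × ℝ) ≃L[ℝ] (ℝ × ℝ) := ContinuousLinearEquiv.equivOfInverse
    ((ContinuousLinearMap.fst ℝ ℝ ℝ).prod (linForm (Xt t b) (Xa t b)))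
    ((ContinuousLinearMap.fst ℝ ℝ ℝ).prod (linForm (-(Xt t b / Xa t b)) (1 / Xa t b)))
    (fun z => by ext <;> simp; field_simp; ring)
    (fun z => by ext <;> simp; field_simp; ring)
  have hf : HasFDerivAt (fun z : ℝ × ℝ => (z.1, X z.1 z.2)) (e : (ℝ × ℝ) →L[ℝ] (ℝ × ℝ)) (t, b) := by
    have h1 : HasFDerivAt (fun z : ℝ × ℝ => z.1) (ContinuousLinearMap.fst ℝ ℝ ℝ) (t, b) :=
      hasFDerivAt_fst
    exact h1.prodMk (h.hasStrictFDerivAt hI (a := b) ht).hasFDerivAt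
  have hI' : ∀ᶠ z : ℝ × ℝ in 𝓝 (t, x), z.1 ∈ I := continuousAt_fst.eventually (hI.mem_nhds ht)
  have hg := HasFDerivAt.of_local_left_inverse (f := fun z : ℝ × ℝ => (z.1, X z.1 z.2)) (f' := e)
    (g := fun z : ℝ × ℝ => (z.1, label X z.1 z.2)) (a := (t, x))
    (continuousAt_fst.prodMk (continuousAt_label hI h hX hsurj ht x)) hf
    (by filter_upwards [hI'] with z hz; simp [flow_label hsurj hz])
  have h2 : HasFDerivAt (fun z : ℝ × ℝ => z.2) (ContinuousLinearMap.snd ℝ ℝ ℝ) (t, b) :=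
    hasFDerivAt_snd
  exact (HasFDerivAt.comp (t, x) h2 hg)

theorem RegularOn.comp_label (hI : IsOpen I) (h : RegularOn I X Xt Xa)
    (hpos : ∀ t ∈ I, ∀ a, 0 < Xa t a)
    (hX : ∀ t ∈ I, StrictMono (X t)) (hsurj : ∀ t ∈ I, Function.Surjective (X t))
    {N Nt Na : ℝ → ℝ → ℝ} (hN : RegularOn I N Nt Na) :
    RegularOn I (fun t x => N t (label X t x))
      (fun t x => Nt t (label X t x) -
        Xt t (label X t x) * (Na t (label X t x) / Xa t (label X t x)))
      (fun t x => Na t (label X t x) / Xa t (label X t x)) := by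
  have hD : ∀ t ∈ I, ∀ x, HasFDerivAt (fun z : ℝ × ℝ => N z.1 (label X z.1 z.2))
      (linForm (Nt t (label X t x) - Xt t (label X t x) *
        (Na t (label X t x) / Xa t (label X t x))) (Na t (label X t x) / Xa t (label X t x)))
      (t, x) := by
    intro t ht x
    have h1 : HasFDerivAt (fun z : ℝ × ℝ => z.1) (ContinuousLinearMap.fst ℝ ℝ ℝ) (t, x) :=
      hasFDerivAt_fst
    have h2 := h1.prodMk (hasFDerivAt_label hI h hpos hX hsurj ht x)
    have h3 := (hN.hasStrictFDerivAt hI (a := label X t x) ht).hasFDerivAt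
    have h4 := HasFDerivAt.comp (t, x) h3 h2
    refine HasFDerivAt.congr_fderiv h4 ?_
    ext <;> simp <;> ring
  have hlab : ContinuousOn (fun z : ℝ × ℝ => (z.1, label X z.1 z.2)) (I ×ˢ univ) := fun z hz =>
    (continuousAt_fst.prodMk
      (continuousAt_label hI h hX hsurj (t := z.1) hz.1 z.2)).continuousWithinAt
  have hmap : MapsTo (fun z : ℝ × ℝ => (z.1, label X z.1 z.2)) (I ×ˢ univ) (I ×ˢ univ) :=
    fun z hz => ⟨hz.1, mem_univ _⟩
  have cNt := hN.continuousOn_t.comp hlab hmap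
  have cNa := hN.continuousOn_a.comp hlab hmap
  have cXt := h.continuousOn_t.comp hlab hmap
  have cXa := h.continuousOn_a.comp hlab hmap
  have cq := cNa.div cXa fun z hz => (hpos z.1 hz.1 _).ne'
  refine ⟨fun t ht x => ?_, fun t ht x => ?_, cNt.sub (cXt.mul cq), cq⟩
  · have h2 : HasDerivAt (fun s : ℝ => (s, x)) ((1 : ℝ), (0 : ℝ)) t :=
      (hasDerivAt_id t).prodMk (hasDerivAt_const t x)
    have := (hD t ht x).comp_hasDerivAt t h2
    refine HasDerivAt.congr_deriv this ?_
    simp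
  · have h2 : HasDerivAt (fun y : ℝ => (t, y)) ((0 : ℝ), (1 : ℝ)) x :=
      (hasDerivAt_const x t).prodMk (hasDerivAt_id x)
    have := (hD t ht x).comp_hasDerivAt x h2
    refine HasDerivAt.congr_deriv this ?_
    simp

end Label

theorem RegularOn.derivWithin_t {I : Set ℝ} {N Nt Na : ℝ → ℝ → ℝ} (h : RegularOn I N Nt Na)
    {T : ℝ} (hT : 0 < T) (hTI : Icc 0 T ⊆ I) {t : ℝ} (ht : t ∈ Icc 0 T) (x : ℝ) :
    derivWithin (fun s => N s x) (Icc 0 T) t = Nt t x :=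
  (h.hasDerivAt_t t (hTI ht) x).hasDerivWithinAt.derivWithin (uniqueDiffOn_Icc hT t ht)

theorem RegularOn.inSolutionSpace {I : Set ℝ} (hI : IsOpen I) {N Nt Na : ℝ → ℝ → ℝ}
    (h : RegularOn I N Nt Na) {T : ℝ} (hT : 0 < T) (hTI : Icc 0 T ⊆ I) {a b : ℝ} (ha : 0 < a)
    (hs : ∀ t ∈ Icc 0 T, ∀ x, 0 < x → x ∉ Icc a b → N t x = 0) : InSolutionSpace T N := by
  have hsub : Icc 0 T ×ˢ Ioi (0 : ℝ) ⊆ I ×ˢ univ := prod_mono hTI (subset_univ _)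
  refine ⟨⟨a, b, ha, hs⟩, (h.continuousOn hI).mono hsub,
    fun t ht x _ => (h.hasDerivAt_a t (hTI ht) x).differentiableAt, ?_,
    fun t ht x _ => (h.hasDerivAt_t t (hTI ht) x).differentiableAt.differentiableWithinAt, ?_⟩
  · exact (h.continuousOn_a.mono hsub).congr fun z hz => (h.hasDerivAt_a z.1 (hTI hz.1) z.2).deriv
  · exact (h.continuousOn_t.mono hsub).congr fun z hz => h.derivWithin_t hT hTI hz.1 z.2

end NonlocalTransport

/-! ### From Lagrangian curves to the flow, the vorticity and the velocity. -/

namespace NonlocalTransport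

theorem eq_of_hasDerivAt_zero {f : ℝ → ℝ} {a b : ℝ} (h : ∀ t ∈ Ioo a b, HasDerivAt f 0 t) {x y : ℝ}
    (hx : x ∈ Ioo a b) (hy : y ∈ Ioo a b) : f x = f y :=
  isOpen_Ioo.is_const_of_deriv_eq_zero isPreconnected_Ioo
    (fun t ht => (h t ht).differentiableAt.differentiableWithinAt) (fun t ht => (h t ht).deriv) hx hy

theorem hasDerivAt_primitive {E : Type*} [NormedAddCommGroup E] [NormedSpace ℝ E] [CompleteSpace E]
    {β : ℝ → E} {a b : ℝ} (hβ : ContinuousOn β (Ioo a b)) (h0 : (0 : ℝ) ∈ Ioo a b) {t : ℝ}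
    (ht : t ∈ Ioo a b) : HasDerivAt (fun t => ∫ s in (0 : ℝ)..t, β s) (β t) t :=
  intervalIntegral.integral_hasDerivAt_right
    (hβ.mono (ordConnected_Ioo.uIcc_subset h0 ht)).intervalIntegrable
    (hβ.stronglyMeasurableAtFilter isOpen_Ioo t ht) (hβ.continuousAt (isOpen_Ioo.mem_nhds ht))

namespace LagrangianData

open MeasureTheory BoundedContinuousFunction
open scoped NNReal

variable (D : LagrangianData)

noncomputable def kB : ℝ →ᵇ ℝ :=
  ofNormedAddCommGroup D.k D.continuous_k _
    (D.hasCompactSupport_k.exists_bound_of_continuous D.continuous_k).choose_spec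

@[simp]
theorem kB_apply (a : ℝ) : D.kB a = D.k a := rfl

/-- `α` solves the system in Lagrangian coordinates on `(-η, T)`, with the initial data `D`. -/
structure IsCurve (α : ℝ → (ℝ →ᵇ ℝ) × (ℝ →ᵇ ℝ)) (η T : ℝ) : Prop where
  η_pos : 0 < η
  T_pos : 0 < T
  init : α 0 = (1, D.wB)
  solves : SolvesOn D.field α (-η) T

/-- `log (a / X)` as a function of time and label. -/
noncomputable def G (α : ℝ → (ℝ →ᵇ ℝ) × (ℝ →ᵇ ℝ)) (t a : ℝ) : ℝ := D.tail ((α t).1 - 1) a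

/-- `-u / X` as a function of time and label. -/
noncomputable def V (α : ℝ → (ℝ →ᵇ ℝ) × (ℝ →ᵇ ℝ)) (t a : ℝ) : ℝ := D.tail ((α t).1 * (α t).2) a

/-- The particle trajectories. -/
noncomputable def flow (α : ℝ → (ℝ →ᵇ ℝ) × (ℝ →ᵇ ℝ)) (t a : ℝ) : ℝ := a * Real.exp (-D.G α t a)

/-- The vorticity in Eulerian coordinates. -/
noncomputable def omega (α : ℝ → (ℝ →ᵇ ℝ) × (ℝ →ᵇ ℝ)) (t x : ℝ) : ℝ :=
  (α t).2 (label (D.flow α) t x)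

/-- The density in Eulerian coordinates. -/
noncomputable def rho (α : ℝ → (ℝ →ᵇ ℝ) × (ℝ →ᵇ ℝ)) (t x : ℝ) : ℝ :=
  D.r (label (D.flow α) t x)

namespace IsCurve

variable {D} {α : ℝ → (ℝ →ᵇ ℝ) × (ℝ →ᵇ ℝ)} {η T : ℝ}

theorem zero_mem (h : D.IsCurve α η T) : (0 : ℝ) ∈ Ioo (-η) T :=
  ⟨by linarith [h.η_pos], h.T_pos⟩

theorem continuousOn (h : D.IsCurve α η T) : ContinuousOn α (Ioo (-η) T) := h.solves.continuousOn

theorem continuousOn_J (h : D.IsCurve α η T) : ContinuousOn (fun t => (α t).1) (Ioo (-η) T) :=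
  continuous_fst.comp_continuousOn h.continuousOn

theorem continuousOn_Om (h : D.IsCurve α η T) : ContinuousOn (fun t => (α t).2) (Ioo (-η) T) :=
  continuous_snd.comp_continuousOn h.continuousOn

theorem continuousOn_eval {β : ℝ → ℝ →ᵇ ℝ} {I : Set ℝ} (hβ : ContinuousOn β I) :
    ContinuousOn (fun z : ℝ × ℝ => β z.1 z.2) (I ×ˢ univ) := by
  have h1 : ContinuousOn (fun z : ℝ × ℝ => (β z.1, z.2)) (I ×ˢ univ) :=
    (hβ.comp continuousOn_fst fun z hz => hz.1).prodMk continuousOn_snd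
  exact (continuous_eval (F := ℝ →ᵇ ℝ) (X := ℝ) (Y := ℝ)).comp_continuousOn h1

theorem hasDerivAt_eval {β : ℝ → ℝ →ᵇ ℝ} {β' : ℝ →ᵇ ℝ} {t : ℝ} (hβ : HasDerivAt β β' t) (a : ℝ) :
    HasDerivAt (fun s => β s a) (β' a) t :=
  (evalCLM ℝ a : (ℝ →ᵇ ℝ) →L[ℝ] ℝ).hasFDerivAt.comp_hasDerivAt t hβ

theorem hasDerivAt_J (h : D.IsCurve α η T) {t : ℝ} (ht : t ∈ Ioo (-η) T) :
    HasDerivAt (fun s => (α s).1) ((α t).1 * (α t).2) t :=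
  (ContinuousLinearMap.fst ℝ (ℝ →ᵇ ℝ) (ℝ →ᵇ ℝ)).hasFDerivAt.comp_hasDerivAt t (h.solves t ht)

theorem hasDerivAt_Om (h : D.IsCurve α η T) {t : ℝ} (ht : t ∈ Ioo (-η) T) :
    HasDerivAt (fun s => (α s).2) (D.sB * bexp (D.tail ((α t).1 - 1))) t :=
  (ContinuousLinearMap.snd ℝ (ℝ →ᵇ ℝ) (ℝ →ᵇ ℝ)).hasFDerivAt.comp_hasDerivAt t (h.solves t ht)

theorem hasDerivAt_Om_apply (h : D.IsCurve α η T) {t : ℝ} (ht : t ∈ Ioo (-η) T) (a : ℝ) :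
    HasDerivAt (fun s => (α s).2 a) (D.s a * Real.exp (D.G α t a)) t :=
  hasDerivAt_eval (h.hasDerivAt_Om ht) a

theorem hasDerivAt_G (h : D.IsCurve α η T) {t : ℝ} (ht : t ∈ Ioo (-η) T) (a : ℝ) :
    HasDerivAt (fun s => D.G α s a) (D.V α t a) t :=
  hasDerivAt_eval (D.tail.hasFDerivAt.comp_hasDerivAt t ((h.hasDerivAt_J ht).sub_const 1)) a

theorem hasDerivAt_G_label (α : ℝ → (ℝ →ᵇ ℝ) × (ℝ →ᵇ ℝ)) (t a : ℝ) :
    HasDerivAt (D.G α t) (-(D.k a * ((α t).1 a - 1))) a :=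
  hasDerivAt_tailIntegral D.continuous_k D.hasCompactSupport_k _ a

theorem continuousOn_tail (h : D.IsCurve α η T) :
    ContinuousOn (fun t => D.tail ((α t).1 - 1)) (Ioo (-η) T) :=
  D.tail.continuous.comp_continuousOn (h.continuousOn_J.sub continuousOn_const)

theorem continuousOn_G (h : D.IsCurve α η T) :
    ContinuousOn (fun z : ℝ × ℝ => D.G α z.1 z.2) (Ioo (-η) T ×ˢ univ) :=
  continuousOn_eval h.continuousOn_tail

theorem continuousOn_V (h : D.IsCurve α η T) :
    ContinuousOn (fun z : ℝ × ℝ => D.V α z.1 z.2) (Ioo (-η) T ×ˢ univ) :=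
  continuousOn_eval (D.tail.continuous.comp_continuousOn (h.continuousOn_J.mul h.continuousOn_Om))

theorem Om_zero (h : D.IsCurve α η T) (a : ℝ) : (α 0).2 a = D.w a := by rw [h.init]; rfl

theorem J_zero (h : D.IsCurve α η T) (a : ℝ) : (α 0).1 a = 1 := by rw [h.init]; rfl

/-- For each label the first equation is linear in `J` and has an integrating factor. The formula
gives `J > 0`, hence a monotone flow, and it is the source of the continuation criterion. -/
theorem J_eq (h : D.IsCurve α η T) {t : ℝ} (ht : t ∈ Ioo (-η) T) (a : ℝ) :
    (α t).1 a = Real.exp (∫ s in (0 : ℝ)..t, (α s).2 a) := by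
  have hc : ContinuousOn (fun s => (α s).2 a) (Ioo (-η) T) :=
    (continuous_eval_const a).comp_continuousOn h.continuousOn_Om
  have key := eq_of_hasDerivAt_zero (a := -η) (b := T)
    (f := fun t => (α t).1 a * Real.exp (-∫ s in (0 : ℝ)..t, (α s).2 a)) (fun t ht => by
      have h1 := hasDerivAt_eval (h.hasDerivAt_J ht) a
      have h2 := (hasDerivAt_primitive hc h.zero_mem ht).neg.exp
      refine (h1.mul h2).congr_deriv ?_
      simp only [BoundedContinuousFunction.coe_mul, Pi.mul_apply, Pi.neg_apply]
      ring) ht h.zero_mem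
  simp only [intervalIntegral.integral_same, h.J_zero, neg_zero, Real.exp_zero, mul_one] at key
  rw [Real.exp_neg, ← div_eq_mul_inv, div_eq_one_iff_eq (Real.exp_pos _).ne'] at key
  exact key

theorem J_pos (h : D.IsCurve α η T) {t : ℝ} (ht : t ∈ Ioo (-η) T) (a : ℝ) : 0 < (α t).1 a := by
  rw [h.J_eq ht]; exact Real.exp_pos _

theorem Om_support (h : D.IsCurve α η T) {t : ℝ} (ht : t ∈ Ioo (-η) T) {a : ℝ}
    (ha : a ∉ Icc D.l D.L) : (α t).2 a = 0 := by
  have := eq_of_hasDerivAt_zero (a := -η) (b := T) (f := fun t => (α t).2 a) (fun t ht => by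
      simpa [D.s_support a ha] using h.hasDerivAt_Om_apply ht a) ht h.zero_mem
  rw [this, h.Om_zero, D.w_support a ha]

theorem J_support (h : D.IsCurve α η T) {t : ℝ} (ht : t ∈ Ioo (-η) T) {a : ℝ}
    (ha : a ∉ Icc D.l D.L) : (α t).1 a = 1 := by
  rw [h.J_eq ht, intervalIntegral.integral_congr (g := fun _ => (0 : ℝ))]
  · simp
  · intro s hs
    exact h.Om_support (ordConnected_Ioo.uIcc_subset h.zero_mem ht hs) ha

theorem hasDerivAt_flow (h : D.IsCurve α η T) {t : ℝ} (ht : t ∈ Ioo (-η) T) (a : ℝ) :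
    HasDerivAt (fun s => D.flow α s a) (-(D.flow α t a * D.V α t a)) t := by
  refine ((h.hasDerivAt_G ht a).fun_neg.exp.const_mul a).congr_deriv ?_
  simp only [flow]
  ring

theorem hasDerivAt_flow_label (h : D.IsCurve α η T) {t : ℝ} (ht : t ∈ Ioo (-η) T) (a : ℝ) :
    HasDerivAt (D.flow α t) (Real.exp (-D.G α t a) * (α t).1 a) a := by
  have := (hasDerivAt_id a).mul (hasDerivAt_G_label (D := D) α t a).fun_neg.exp
  refine HasDerivAt.congr_deriv this ?_
  simp only [id]
  -- The cutoff in the kernel is harmless: `a k(a) = 1` on `[l, L]`, and `J - 1` vanishes elsewhere.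
  by_cases ha : a ∈ Icc D.l D.L
  · linear_combination (Real.exp (-D.G α t a) * ((α t).1 a - 1)) * D.mul_k ha
  · rw [h.J_support ht ha]; ring

theorem continuousOn_flow (h : D.IsCurve α η T) :
    ContinuousOn (fun z : ℝ × ℝ => D.flow α z.1 z.2) (Ioo (-η) T ×ˢ univ) :=
  continuousOn_snd.mul (Real.continuous_exp.comp_continuousOn h.continuousOn_G.neg)

theorem regularOn_flow (h : D.IsCurve α η T) :
    RegularOn (Ioo (-η) T) (D.flow α) (fun t a => -(D.flow α t a * D.V α t a))
      (fun t a => Real.exp (-D.G α t a) * (α t).1 a) :=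
  ⟨fun _ ht a => h.hasDerivAt_flow ht a, fun _ ht a => h.hasDerivAt_flow_label ht a,
    (h.continuousOn_flow.mul h.continuousOn_V).neg,
    (Real.continuous_exp.comp_continuousOn h.continuousOn_G.neg).mul
      (continuousOn_eval h.continuousOn_J)⟩

theorem flow_deriv_pos (h : D.IsCurve α η T) {t : ℝ} (ht : t ∈ Ioo (-η) T) (a : ℝ) :
    0 < Real.exp (-D.G α t a) * (α t).1 a := mul_pos (Real.exp_pos _) (h.J_pos ht a)

theorem strictMono_flow (h : D.IsCurve α η T) {t : ℝ} (ht : t ∈ Ioo (-η) T) :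
    StrictMono (D.flow α t) :=
  strictMono_of_deriv_pos fun a => by
    rw [(h.hasDerivAt_flow_label ht a).deriv]; exact h.flow_deriv_pos ht a

theorem flow_pos (α : ℝ → (ℝ →ᵇ ℝ) × (ℝ →ᵇ ℝ)) (t : ℝ) {a : ℝ} (ha : 0 < a) : 0 < D.flow α t a :=
  mul_pos ha (Real.exp_pos _)

/-- At fixed time `X / a` is bounded below by a positive constant, so `X` tends to `±∞` with `a`. -/
theorem surjective_flow (h : D.IsCurve α η T) {t : ℝ} (ht : t ∈ Ioo (-η) T) :
    Function.Surjective (D.flow α t) := by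
  set M := ‖D.tail ((α t).1 - 1)‖ with hM
  have hb : ∀ a, Real.exp (-M) ≤ Real.exp (-D.G α t a) := fun a =>
    Real.exp_le_exp.2 (neg_le_neg ((le_abs_self _).trans
      ((D.tail ((α t).1 - 1)).norm_coe_le_norm a)))
  have hc : Continuous (D.flow α t) := continuous_iff_continuousAt.2 fun a =>
    (h.hasDerivAt_flow_label ht a).continuousAt
  refine hc.surjective ?_ ?_
  · refine tendsto_atTop_mono' atTop ?_ (tendsto_id.atTop_mul_const (Real.exp_pos (-M)))
    filter_upwards [eventually_ge_atTop 0] with a ha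
    exact mul_le_mul_of_nonneg_left (hb a) ha
  · refine tendsto_atBot_mono' atBot ?_ (tendsto_id.atBot_mul_const (Real.exp_pos (-M)))
    filter_upwards [eventually_le_atBot 0] with a ha
    exact mul_le_mul_of_nonpos_left (hb a) ha

theorem flow_zero (h : D.IsCurve α η T) (a : ℝ) : D.flow α 0 a = a := by
  have : D.G α 0 a = 0 := by
    unfold G; rw [h.init, sub_self, map_zero]; rfl
  simp [flow, this]

theorem label_zero (h : D.IsCurve α η T) (x : ℝ) : label (D.flow α) 0 x = x := by
  have := label_flow (I := Ioo (-η) T) (X := D.flow α) (fun t ht => h.strictMono_flow ht)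
    h.zero_mem x
  rwa [h.flow_zero] at this

theorem omega_flow (h : D.IsCurve α η T) {t : ℝ} (ht : t ∈ Ioo (-η) T) (a : ℝ) :
    D.omega α t (D.flow α t a) = (α t).2 a := by
  rw [omega, label_flow (I := Ioo (-η) T) (fun t ht => h.strictMono_flow ht) ht]

theorem rho_flow (h : D.IsCurve α η T) {t : ℝ} (ht : t ∈ Ioo (-η) T) (a : ℝ) :
    D.rho α t (D.flow α t a) = D.r a := by
  rw [rho, label_flow (I := Ioo (-η) T) (fun t ht => h.strictMono_flow ht) ht]

/-- The substitution `y = X(t, b)` turns `dy / y` into `J db / b`; this links the nonlocal velocity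
to `V`. -/
theorem velocity_flow (h : D.IsCurve α η T) {t : ℝ} (ht : t ∈ Ioo (-η) T) {a : ℝ} (ha : 0 < a) :
    velocity (D.omega α t) (D.flow α t a) = -(D.flow α t a * D.V α t a) := by
  have himg : D.flow α t '' Ioi a = Ioi (D.flow α t a) := by
    ext y
    constructor
    · rintro ⟨b, hb, rfl⟩
      exact h.strictMono_flow ht hb
    · intro hy
      obtain ⟨b, rfl⟩ := h.surjective_flow ht y
      exact ⟨b, (h.strictMono_flow ht).lt_iff_lt.1 hy, rfl⟩
  have hV : ∫ y in Ioi (D.flow α t a), D.omega α t y / y = D.V α t a := by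
    rw [← himg, integral_image_eq_integral_abs_deriv_smul measurableSet_Ioi
      (fun b _ => (h.hasDerivAt_flow_label ht b).hasDerivWithinAt)
      (h.strictMono_flow ht).injective.injOn]
    unfold V tail
    rw [tailIntegral_apply]
    refine setIntegral_congr_fun measurableSet_Ioi fun b hb => ?_
    have hb0 : 0 < b := ha.trans hb
    simp only [smul_eq_mul, BoundedContinuousFunction.coe_mul, Pi.mul_apply]
    rw [h.omega_flow ht, abs_of_pos (h.flow_deriv_pos ht b)]
    by_cases hb' : b ∈ Icc D.l D.L
    · have := D.mul_k hb'
      have hk : D.k b = 1 / b := by field_simp; linarith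
      rw [hk, flow]
      have := (Real.exp_pos (-D.G α t b)).ne'
      field_simp
    · rw [h.Om_support ht hb']; simp
  rw [velocity, hV]
  ring

theorem exists_bound_Icc {β : ℝ → ℝ →ᵇ ℝ} {I : Set ℝ} (hI : I.OrdConnected)
    (hβ : ContinuousOn β I) {a b : ℝ} (ha : a ∈ I) (hb : b ∈ I) :
    ∃ C, ∀ s ∈ uIcc a b, ‖β s‖ ≤ C :=
  isCompact_uIcc.exists_bound_of_continuousOn (hβ.mono (hI.uIcc_subset ha hb))

/-- The phase space only knows continuity in the label. Differentiability of the vorticity comes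
from its explicit formula `Om_eq`, whose only implicit part is this integral; `G` itself is a
primitive in the label. -/
theorem hasDerivAt_integral_exp_G (h : D.IsCurve α η T) {t : ℝ} (ht : t ∈ Ioo (-η) T) (a : ℝ) :
    HasDerivAt (fun a => (∫ s in (0 : ℝ)..t, bexp (D.tail ((α s).1 - 1))) a)
      (-((∫ s in (0 : ℝ)..t, bexp (D.tail ((α s).1 - 1)) * (D.kB * ((α s).1 - 1))) a)) a := by
  have c1 : ContinuousOn (fun s => bexp (D.tail ((α s).1 - 1))) (Ioo (-η) T) :=
    continuous_bexp.comp_continuousOn h.continuousOn_tail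
  have c2 : ContinuousOn (fun s => bexp (D.tail ((α s).1 - 1)) * (D.kB * ((α s).1 - 1)))
      (Ioo (-η) T) := c1.mul (continuousOn_const.mul (h.continuousOn_J.sub continuousOn_const))
  have hsub := ordConnected_Ioo.uIcc_subset h.zero_mem ht
  have i1 : IntervalIntegrable (fun s => bexp (D.tail ((α s).1 - 1))) volume 0 t :=
    (c1.mono hsub).intervalIntegrable
  have i2 : IntervalIntegrable (fun s => bexp (D.tail ((α s).1 - 1)) * (D.kB * ((α s).1 - 1)))
    volume 0 t := (c2.mono hsub).intervalIntegrable
  have e1 : ∀ a, (∫ s in (0 : ℝ)..t, bexp (D.tail ((α s).1 - 1))) a =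
      ∫ s in (0 : ℝ)..t, bexp (D.tail ((α s).1 - 1)) a := fun a =>
    ((evalCLM ℝ a : (ℝ →ᵇ ℝ) →L[ℝ] ℝ).intervalIntegral_comp_comm i1).symm
  have e2 : ∀ a, (∫ s in (0 : ℝ)..t, bexp (D.tail ((α s).1 - 1)) * (D.kB * ((α s).1 - 1))) a =
      ∫ s in (0 : ℝ)..t, (bexp (D.tail ((α s).1 - 1)) * (D.kB * ((α s).1 - 1))) a := fun a =>
    ((evalCLM ℝ a : (ℝ →ᵇ ℝ) →L[ℝ] ℝ).intervalIntegral_comp_comm i2).symm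
  obtain ⟨C, hC⟩ := exists_bound_Icc ordConnected_Ioo c2 h.zero_mem ht
  simp only [e1, e2, ← intervalIntegral.integral_neg]
  have ev1 : ∀ a, ContinuousOn (fun s => bexp (D.tail ((α s).1 - 1)) a) (uIcc 0 t) := fun a =>
    (continuous_eval_const a).comp_continuousOn (c1.mono hsub)
  have ev2 : ContinuousOn (fun s =>
      -((bexp (D.tail ((α s).1 - 1)) * (D.kB * ((α s).1 - 1))) a)) (uIcc 0 t) :=
    ((continuous_eval_const a).comp_continuousOn (c2.mono hsub)).neg
  refine (intervalIntegral.hasDerivAt_integral_of_dominated_loc_of_deriv_le (s := univ)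
    (F := fun a s => bexp (D.tail ((α s).1 - 1)) a)
    (F' := fun a s => -((bexp (D.tail ((α s).1 - 1)) * (D.kB * ((α s).1 - 1))) a))
    (bound := fun _ => C) univ_mem ?_ ?_ ?_ ?_ ?_ ?_).2
  · exact Eventually.of_forall fun a =>
      ((ev1 a).mono uIoc_subset_uIcc).aestronglyMeasurable measurableSet_uIoc
  · exact (ev1 a).intervalIntegrable
  · exact (ev2.mono uIoc_subset_uIcc).aestronglyMeasurable measurableSet_uIoc
  · refine Eventually.of_forall fun s hs b _ => ?_
    rw [norm_neg]
    exact (norm_coe_le_norm _ b).trans (hC s (uIoc_subset_uIcc hs))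
  · exact intervalIntegrable_const
  · refine Eventually.of_forall fun s hs b _ => ?_
    refine (hasDerivAt_G_label (D := D) α s b).exp.congr_deriv ?_
    simp only [BoundedContinuousFunction.coe_mul, Pi.mul_apply, bexp_apply, kB_apply,
      BoundedContinuousFunction.coe_sub, Pi.sub_apply, BoundedContinuousFunction.coe_one,
      Pi.one_apply, G]
    ring

theorem Om_eq (h : D.IsCurve α η T) {t : ℝ} (ht : t ∈ Ioo (-η) T) (a : ℝ) :
    (α t).2 a = D.w a + D.s a * (∫ s in (0 : ℝ)..t, bexp (D.tail ((α s).1 - 1))) a := by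
  have c1 : ContinuousOn (fun s => bexp (D.tail ((α s).1 - 1))) (Ioo (-η) T) :=
    continuous_bexp.comp_continuousOn h.continuousOn_tail
  have key := eq_of_hasDerivAt_zero (a := -η) (b := T)
    (f := fun t => (α t).2 a - D.s a * (∫ s in (0 : ℝ)..t, bexp (D.tail ((α s).1 - 1))) a)
    (fun t ht => by
      refine ((h.hasDerivAt_Om_apply ht a).sub ((hasDerivAt_eval
        (hasDerivAt_primitive c1 h.zero_mem ht) a).const_mul (D.s a))).congr_deriv ?_
      simp [G]) ht h.zero_mem
  simp only [intervalIntegral.integral_same, h.Om_zero, BoundedContinuousFunction.coe_zero,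
    Pi.zero_apply, mul_zero, sub_zero] at key
  linarith

theorem regularOn_Om (h : D.IsCurve α η T) :
    RegularOn (Ioo (-η) T) (fun t a => (α t).2 a) (fun t a => D.s a * Real.exp (D.G α t a))
      (fun t a => deriv D.w a + (deriv D.s a *
        (∫ s in (0 : ℝ)..t, bexp (D.tail ((α s).1 - 1))) a + D.s a *
        -((∫ s in (0 : ℝ)..t, bexp (D.tail ((α s).1 - 1)) * (D.kB * ((α s).1 - 1))) a))) := by
  have c1 : ContinuousOn (fun s => bexp (D.tail ((α s).1 - 1))) (Ioo (-η) T) :=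
    continuous_bexp.comp_continuousOn h.continuousOn_tail
  have c2 : ContinuousOn (fun s => bexp (D.tail ((α s).1 - 1)) * (D.kB * ((α s).1 - 1)))
      (Ioo (-η) T) := c1.mul (continuousOn_const.mul (h.continuousOn_J.sub continuousOn_const))
  have hprim : ∀ {β : ℝ → ℝ →ᵇ ℝ}, ContinuousOn β (Ioo (-η) T) →
      ContinuousOn (fun z : ℝ × ℝ => (∫ s in (0 : ℝ)..z.1, β s) z.2) (Ioo (-η) T ×ˢ univ) :=
    fun hβ => continuousOn_eval (β := fun t => ∫ s in (0 : ℝ)..t, _) fun t ht =>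
      (hasDerivAt_primitive hβ h.zero_mem ht).continuousAt.continuousWithinAt
  have cw : Continuous (deriv D.w) := D.w_contDiff.continuous_deriv le_rfl
  have cs : Continuous (deriv D.s) := D.contDiff_s.continuous_deriv le_rfl
  refine ⟨fun t ht a => h.hasDerivAt_Om_apply ht a, fun t ht a => ?_, ?_, ?_⟩
  · have e : (fun a => (α t).2 a) =
        fun a => D.w a + D.s a * (∫ s in (0 : ℝ)..t, bexp (D.tail ((α s).1 - 1))) a :=
      funext fun a => h.Om_eq ht a
    have dw : HasDerivAt D.w (deriv D.w a) a :=
      (D.w_contDiff.differentiable one_ne_zero a).hasDerivAt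
    have ds : HasDerivAt D.s (deriv D.s a) a :=
      (D.contDiff_s.differentiable one_ne_zero a).hasDerivAt
    change HasDerivAt (fun a => (α t).2 a) _ a
    rw [e]
    exact dw.add (ds.mul (h.hasDerivAt_integral_exp_G ht a))
  · exact (D.contDiff_s.continuous.comp_continuousOn continuousOn_snd).mul
      (Real.continuous_exp.comp_continuousOn h.continuousOn_G)
  · exact (cw.comp_continuousOn continuousOn_snd).add
      (((cs.comp_continuousOn continuousOn_snd).mul (hprim c1)).add
        ((D.contDiff_s.continuous.comp_continuousOn continuousOn_snd).mul (hprim c2).neg))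

theorem regularOn_r (D : LagrangianData) (I : Set ℝ) :
    RegularOn I (fun _ a => D.r a) (fun _ _ => 0) (fun _ a => deriv D.r a) := by
  have cr : Continuous (deriv D.r) := D.r_contDiff.continuous_deriv le_rfl
  exact ⟨fun t _ a => hasDerivAt_const _ _,
    fun t _ a => (D.r_contDiff.differentiable one_ne_zero a).hasDerivAt, continuousOn_const,
    cr.comp_continuousOn continuousOn_snd⟩

end IsCurve

end LagrangianData

end NonlocalTransport

/-! ### Classical solutions from Lagrangian curves, and the continuation criterion. -/

namespace NonlocalTransport

/-- `(ω, ρ)` is a classical solution on `[0, T)` with the data `(w, r)`, and `X` is its flow. -/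
structure IsFlow (w r : ℝ → ℝ) (T : ℝ) (X ω ρ : ℝ → ℝ → ℝ) : Prop where
  T_pos : 0 < T
  init : ∀ a, X 0 a = a
  pos : ∀ t ∈ Ico 0 T, ∀ a, 0 < a → 0 < X t a
  strictMono : ∀ t ∈ Ico 0 T, StrictMono (X t)
  surj : ∀ t ∈ Ico 0 T, ∀ x, 0 < x → ∃ a, 0 < a ∧ X t a = x
  continuousOn_flow : ContinuousOn (fun z : ℝ × ℝ => X z.1 z.2) (Ico 0 T ×ˢ univ)
  continuousOn_omega : ContinuousOn (fun z : ℝ × ℝ => ω z.1 z.2) (Ico 0 T ×ˢ univ)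
  hasDerivAt_flow : ∀ t ∈ Ico 0 T, ∀ a, 0 < a →
    HasDerivAt (fun s => X s a) (velocity (ω t) (X t a)) t
  hasDerivAt_omega : ∀ t ∈ Ico 0 T, ∀ a, 0 < a →
    HasDerivAt (fun s => ω s (X s a)) (r a / X t a) t
  omega_init : ∀ a, 0 < a → ω 0 a = w a
  rho_flow : ∀ t ∈ Ico 0 T, ∀ a, 0 < a → ρ t (X t a) = r a
  solution : ∀ T', 0 < T' → T' < T → IsSolution w r T' ω ρ

theorem exists_lagrangianData {w r : ℝ → ℝ} (hw : IsC1Compact w) (hr : IsC1Compact r) :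
    ∃ D : LagrangianData, (∀ x, 0 < x → D.w x = w x) ∧ ∀ x, 0 < x → D.r x = r x := by
  obtain ⟨hw1, a₁, b₁, ha₁, hw2⟩ := hw
  obtain ⟨hr1, a₂, b₂, ha₂, hr2⟩ := hr
  set l := min a₁ a₂ with hl
  set L := max (max b₁ b₂) (l + 1) with hL
  have hl0 : 0 < l := lt_min ha₁ ha₂
  have key : ∀ {f : ℝ → ℝ} {a b : ℝ}, ContDiffOn ℝ 1 f (Ioi 0) →
      (∀ x, 0 < x → x ∉ Icc a b → f x = 0) → l ≤ a → b ≤ L →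
      ContDiff ℝ 1 ((Ioi 0).indicator f) ∧ (∀ x, x ∉ Icc l L → (Ioi 0).indicator f x = 0) := by
    intro f a b hf h0 hla hbL
    have hs : ∀ x, x ∉ Icc l L → (Ioi 0).indicator f x = 0 := by
      intro x hx
      by_cases hx0 : 0 < x
      · rw [indicator_of_mem (mem_Ioi.2 hx0)]
        exact h0 x hx0 fun hc => hx ⟨hla.trans hc.1, hc.2.trans hbL⟩
      · rw [indicator_of_notMem (by simpa using hx0)]
    refine ⟨contDiff_iff_contDiffAt.2 fun x => ?_, hs⟩
    rcases lt_or_ge x l with h | h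
    · refine (contDiffAt_const (c := 0)).congr_of_eventuallyEq ?_
      filter_upwards [Iio_mem_nhds h] with y hy
      exact hs y fun hc => absurd hc.1 (not_le.2 hy)
    · have hx0 : 0 < x := hl0.trans_le h
      refine (hf.contDiffAt (Ioi_mem_nhds hx0)).congr_of_eventuallyEq ?_
      filter_upwards [Ioi_mem_nhds hx0] with y hy
      exact indicator_of_mem hy f
  obtain ⟨w1, w2⟩ := key hw1 hw2 (min_le_left _ _)
    ((le_max_left _ _).trans (le_max_left _ _) : b₁ ≤ L)
  obtain ⟨r1, r2⟩ := key hr1 hr2 (min_le_right _ _)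
    ((le_max_right _ _).trans (le_max_left _ _) : b₂ ≤ L)
  have hlL : l < L := lt_of_lt_of_le (by linarith) (le_max_right (max b₁ b₂) (l + 1))
  exact ⟨⟨l, L, _, _, hl0, hlL, w1, r1, w2, r2⟩, fun x hx => indicator_of_mem (mem_Ioi.2 hx) w,
    fun x hx => indicator_of_mem (mem_Ioi.2 hx) r⟩

namespace LagrangianData

open MeasureTheory BoundedContinuousFunction

namespace IsCurve

variable {D : LagrangianData} {α : ℝ → (ℝ →ᵇ ℝ) × (ℝ →ᵇ ℝ)} {η T : ℝ}

/-- The space derivative may remain an unnamed `g`: in the equation, the term `u ω_x` cancels the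
part of the time derivative that contains it. -/
theorem regularOn_omega (h : D.IsCurve α η T) :
    ∃ g : ℝ → ℝ → ℝ, RegularOn (Ioo (-η) T) (D.omega α)
      (fun t x => D.s (label (D.flow α) t x) * Real.exp (D.G α t (label (D.flow α) t x)) -
        -(D.flow α t (label (D.flow α) t x) * D.V α t (label (D.flow α) t x)) * g t x) g :=
  ⟨_, h.regularOn_flow.comp_label isOpen_Ioo
    (fun _ ht a => h.flow_deriv_pos ht a) (fun _ ht => h.strictMono_flow ht)
    (fun _ ht => h.surjective_flow ht) h.regularOn_Om⟩

theorem regularOn_rho (h : D.IsCurve α η T) :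
    ∃ g : ℝ → ℝ → ℝ, RegularOn (Ioo (-η) T) (D.rho α)
      (fun t x => 0 -
        -(D.flow α t (label (D.flow α) t x) * D.V α t (label (D.flow α) t x)) * g t x) g :=
  ⟨_, h.regularOn_flow.comp_label isOpen_Ioo
    (fun _ ht a => h.flow_deriv_pos ht a) (fun _ ht => h.strictMono_flow ht)
    (fun _ ht => h.surjective_flow ht) (regularOn_r D (Ioo (-η) T))⟩

theorem exists_label (h : D.IsCurve α η T) {t : ℝ} (ht : t ∈ Ioo (-η) T) {x : ℝ} (hx : 0 < x) :
    ∃ a, 0 < a ∧ D.flow α t a = x := by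
  obtain ⟨a, rfl⟩ := h.surjective_flow ht x
  exact ⟨a, pos_of_mul_pos_left hx (Real.exp_pos _).le, rfl⟩

/-- The flow carries the label support `[l, L]` along; the extrema of its two end paths over a
compact time interval bound the supports uniformly. -/
theorem exists_support (h : D.IsCurve α η T) {T' : ℝ} (hT0 : 0 < T') (hT' : T' < T) :
    ∃ a b : ℝ, 0 < a ∧ ∀ t ∈ Icc 0 T', ∀ x, 0 < x → x ∉ Icc a b →
      label (D.flow α) t x ∉ Icc D.l D.L := by
  have hsub : Icc 0 T' ⊆ Ioo (-η) T := fun t ht =>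
    ⟨by linarith [h.η_pos, ht.1], ht.2.trans_lt hT'⟩
  have hc : ∀ a, ContinuousOn (fun t => D.flow α t a) (Icc 0 T') := fun a t ht =>
    (h.hasDerivAt_flow (hsub ht) a).continuousAt.continuousWithinAt
  have hne : (Icc 0 T').Nonempty := nonempty_Icc.2 hT0.le
  obtain ⟨t₁, ht₁, hmin⟩ := isCompact_Icc.exists_isMinOn hne (hc D.l)
  obtain ⟨t₂, ht₂, hmax⟩ := isCompact_Icc.exists_isMaxOn hne (hc D.L)
  refine ⟨D.flow α t₁ D.l, D.flow α t₂ D.L, flow_pos α t₁ D.l_pos, fun t ht x _ hxI hlab => hxI ?_⟩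
  have hx := flow_label (I := Ioo (-η) T) (fun t ht => h.surjective_flow ht) (hsub ht) x
  rw [← hx]
  exact ⟨(hmin ht).trans ((h.strictMono_flow (hsub ht)).monotone hlab.1),
    ((h.strictMono_flow (hsub ht)).monotone hlab.2).trans (hmax ht)⟩

theorem isSolution (h : D.IsCurve α η T) {w r : ℝ → ℝ} (hw : ∀ x, 0 < x → D.w x = w x)
    (hr : ∀ x, 0 < x → D.r x = r x) {T' : ℝ} (hT0 : 0 < T') (hT' : T' < T) :
    IsSolution w r T' (D.omega α) (D.rho α) := by
  have hsub : Icc 0 T' ⊆ Ioo (-η) T := fun t ht =>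
    ⟨by linarith [h.η_pos, ht.1], ht.2.trans_lt hT'⟩
  obtain ⟨a, b, ha, hs⟩ := h.exists_support hT0 hT'
  obtain ⟨g₁, hg₁⟩ := h.regularOn_omega
  obtain ⟨g₂, hg₂⟩ := h.regularOn_rho
  refine ⟨hT0, ?_, ?_, fun x hx => ?_, fun x hx => ?_, fun t ht x hx => ?_, fun t ht x hx => ?_⟩
  · exact hg₁.inSolutionSpace isOpen_Ioo hT0 hsub ha fun t ht x hx hxI =>
      h.Om_support (hsub ht) (hs t ht x hx hxI)
  · exact hg₂.inSolutionSpace isOpen_Ioo hT0 hsub ha fun t ht x hx hxI =>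
      D.r_support _ (hs t ht x hx hxI)
  · rw [omega, h.label_zero, h.Om_zero, hw x hx]
  · rw [rho, h.label_zero, hr x hx]
  · have e1 := hg₁.derivWithin_t hT0 hsub ht x
    have e2 := (hg₁.hasDerivAt_a t (hsub ht) x).deriv
    obtain ⟨c, hc, rfl⟩ := h.exists_label (hsub ht) hx
    rw [e1, e2, h.velocity_flow (hsub ht) hc, h.rho_flow (hsub ht),
      label_flow (I := Ioo (-η) T) (fun t ht => h.strictMono_flow ht) (hsub ht), s_eq, flow,
      Real.exp_neg]
    have := (Real.exp_pos (D.G α t c)).ne'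
    field_simp
    ring
  · have e1 := hg₂.derivWithin_t hT0 hsub ht x
    have e2 := (hg₂.hasDerivAt_a t (hsub ht) x).deriv
    obtain ⟨c, hc, rfl⟩ := h.exists_label (hsub ht) hx
    rw [e1, e2, h.velocity_flow (hsub ht) hc,
      label_flow (I := Ioo (-η) T) (fun t ht => h.strictMono_flow ht) (hsub ht)]
    ring

theorem isFlow (h : D.IsCurve α η T) {w r : ℝ → ℝ} (hw : ∀ x, 0 < x → D.w x = w x)
    (hr : ∀ x, 0 < x → D.r x = r x) : IsFlow w r T (D.flow α) (D.omega α) (D.rho α) := by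
  have hsub : Ico 0 T ⊆ Ioo (-η) T := fun t ht => ⟨by linarith [h.η_pos, ht.1], ht.2⟩
  refine ⟨h.T_pos, h.flow_zero, fun t _ a ha => flow_pos α t ha,
    fun t ht => h.strictMono_flow (hsub ht), fun t ht x hx => h.exists_label (hsub ht) hx,
    h.continuousOn_flow.mono (prod_mono_left hsub),
    (h.regularOn_omega.choose_spec.continuousOn isOpen_Ioo).mono (prod_mono_left hsub),
    fun t ht a ha => ?_, fun t ht a ha => ?_, fun a ha => ?_, fun t ht a ha => ?_,
    fun T' h0 h1 => h.isSolution hw hr h0 h1⟩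
  · rw [h.velocity_flow (hsub ht) ha]
    exact h.hasDerivAt_flow (hsub ht) a
  · have h1 := h.hasDerivAt_Om_apply (hsub ht) a
    have e : D.s a * Real.exp (D.G α t a) = r a / D.flow α t a := by
      rw [s_eq, hr a ha, flow, Real.exp_neg]
      have := (Real.exp_pos (D.G α t a)).ne'
      field_simp
    rw [e] at h1
    refine h1.congr_of_eventuallyEq ?_
    filter_upwards [isOpen_Ioo.mem_nhds (hsub ht)] with s hs
    exact h.omega_flow hs a
  · rw [omega, h.label_zero, h.Om_zero, hw a ha]
  · rw [h.rho_flow (hsub ht), hr a ha]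

theorem supNorm_omega (h : D.IsCurve α η T) {t : ℝ} (ht : t ∈ Ioo (-η) T) :
    supNorm (D.omega α t) = ‖(α t).2‖ := by
  have hb : BddAbove (range fun x : Ioi (0 : ℝ) => |D.omega α t x|) := by
    refine ⟨‖(α t).2‖, ?_⟩
    rintro _ ⟨x, rfl⟩
    exact (α t).2.norm_coe_le_norm _
  have hne : Nonempty (Ioi (0 : ℝ)) := ⟨⟨1, mem_Ioi.2 one_pos⟩⟩
  refine le_antisymm (ciSup_le fun x => (α t).2.norm_coe_le_norm _) ?_
  refine (BoundedContinuousFunction.norm_le (Real.iSup_nonneg fun x => abs_nonneg _)).2 fun a => ?_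
  by_cases ha : 0 < a
  · rw [← h.omega_flow ht a]
    exact le_ciSup hb ⟨D.flow α t a, flow_pos α t ha⟩
  · rw [h.Om_support ht fun hc => ha (D.l_pos.trans_le hc.1), norm_zero]
    exact Real.iSup_nonneg fun x => abs_nonneg _

/-- A solution of the Lagrangian system stays bounded as long as the time integral of the maximum
of the vorticity does. -/
theorem norm_le_of_integral_le (h : D.IsCurve α η T) {K : ℝ}
    (hK : ∀ t ∈ Ico 0 T, ∫ s in (0 : ℝ)..t, ‖(α s).2‖ ≤ K) :
    ∃ C, ∀ t ∈ Ico 0 T, ‖α t‖ ≤ C := by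
  have hsub : Ico 0 T ⊆ Ioo (-η) T := fun t ht => ⟨by linarith [h.η_pos, ht.1], ht.2⟩
  -- The integral bound controls `J` through its exponential formula. This bounds the exponent `G`,
  -- hence the source, and then the vorticity grows at most linearly in time.
  have hJ : ∀ t ∈ Ico 0 T, ‖(α t).1‖ ≤ Real.exp K := by
    intro t ht
    refine (BoundedContinuousFunction.norm_le (Real.exp_pos _).le).2 fun a => ?_
    rw [h.J_eq (hsub ht), Real.norm_eq_abs, Real.abs_exp, Real.exp_le_exp]
    refine (le_abs_self _).trans (le_trans ?_ (hK t ht))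
    have hus : uIcc 0 t ⊆ Ioo (-η) T := ordConnected_Ioo.uIcc_subset h.zero_mem (hsub ht)
    have hc := h.continuousOn_Om.mono hus
    rw [← Real.norm_eq_abs]
    refine (intervalIntegral.norm_integral_le_integral_norm ht.1).trans ?_
    refine intervalIntegral.integral_mono_on ht.1
      ((continuous_eval_const a).comp_continuousOn hc).norm.intervalIntegrable
      hc.norm.intervalIntegrable fun s _ => (α s).2.norm_coe_le_norm a
  set M := ‖D.sB‖ * Real.exp (‖D.tail‖ * (Real.exp K + 1)) with hM
  have hO : ∀ t ∈ Ico 0 T, ‖(α t).2‖ ≤ ‖D.wB‖ + M * T := by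
    intro t ht
    have hcc : Icc 0 t ⊆ Ico 0 T := fun s hs => ⟨hs.1, hs.2.trans_lt ht.2⟩
    have hb := norm_image_sub_le_of_norm_deriv_right_le_segment (E := ℝ →ᵇ ℝ) (f := fun s => (α s).2)
      (f' := fun s => D.sB * bexp (D.tail ((α s).1 - 1))) (C := M) (a := 0) (b := t)
      (h.continuousOn_Om.mono (hcc.trans hsub))
      (fun s hs => (h.hasDerivAt_Om (hsub (hcc (Ico_subset_Icc_self hs)))).hasDerivWithinAt)
      (fun s hs => by
        have hs' := hcc (Ico_subset_Icc_self hs)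
        refine (norm_mul_le _ _).trans ?_
        rw [hM]
        gcongr
        refine (norm_bexp_le _).trans (Real.exp_le_exp.2 ((D.tail.le_opNorm _).trans ?_))
        gcongr
        refine (norm_sub_le _ _).trans ?_
        rw [norm_one]
        linarith [hJ s hs'])
      t ⟨ht.1, le_rfl⟩
    rw [h.init, sub_zero] at hb
    have h1 := norm_le_norm_add_norm_sub D.wB (α t).2
    rw [norm_sub_rev] at h1
    have h2 : M * t ≤ M * T := mul_le_mul_of_nonneg_left ht.2.le (by positivity)
    simp only at hb
    linarith
  refine ⟨max (Real.exp K) (‖D.wB‖ + M * T), fun t ht => ?_⟩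
  exact max_le_max (hJ t ht) (hO t ht)

theorem tendsto_integral_supNorm (h : D.IsCurve α η T)
    (hunb : ∀ R : ℝ, ∃ t ∈ Ico 0 T, R < ‖α t‖) :
    Tendsto (fun t => ∫ s in (0 : ℝ)..t, supNorm (D.omega α s)) (𝓝[<] T) atTop := by
  have hsub : Ico 0 T ⊆ Ioo (-η) T := fun t ht => ⟨by linarith [h.η_pos, ht.1], ht.2⟩
  have heq : ∀ t ∈ Ico 0 T, ∫ s in (0 : ℝ)..t, supNorm (D.omega α s) =
      ∫ s in (0 : ℝ)..t, ‖(α s).2‖ := fun t ht =>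
    intervalIntegral.integral_congr fun s hs =>
      h.supNorm_omega (ordConnected_Ioo.uIcc_subset h.zero_mem (hsub ht) hs)
  refine tendsto_atTop.2 fun K => ?_
  -- The integral is monotone in time, so exceeding `K` once suffices for divergence.
  obtain ⟨t₀, ht₀, hK⟩ : ∃ t ∈ Ico 0 T, K < ∫ s in (0 : ℝ)..t, ‖(α s).2‖ := by
    by_contra! hcon
    obtain ⟨C, hC⟩ := h.norm_le_of_integral_le hcon
    obtain ⟨t, ht, hlt⟩ := hunb C
    exact absurd (hC t ht) (not_le.2 hlt)
  filter_upwards [Ioo_mem_nhdsLT ht₀.2] with t ht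
  have ht' : t ∈ Ico 0 T := ⟨ht₀.1.trans ht.1.le, ht.2⟩
  rw [heq t ht']
  refine hK.le.trans (intervalIntegral.integral_mono_interval le_rfl ht₀.1 ht.1.le
    (Eventually.of_forall fun s => norm_nonneg _) ?_)
  exact ((h.continuousOn_Om.mono
    (ordConnected_Ioo.uIcc_subset h.zero_mem (hsub ht'))).norm).intervalIntegrable

end IsCurve

end LagrangianData

/-- If the lifetimes of all flows with given data are bounded, there is a flow with these data which
blows up. -/
theorem exists_flow_blowup {w r : ℝ → ℝ} (hw : IsC1Compact w) (hr : IsC1Compact r) (T₁ : ℝ)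
    (hT₁ : ∀ T X ω ρ, IsFlow w r T X ω ρ → T ≤ T₁) :
    ∃ T X ω ρ, IsFlow w r T X ω ρ ∧
      Tendsto (fun t => ∫ s in (0 : ℝ)..t, supNorm (ω s)) (𝓝[<] T) atTop := by
  obtain ⟨D, hDw, hDr⟩ := exists_lagrangianData hw hr
  obtain ⟨η, T, α, hη, hT, h0, hα, hunb⟩ := exists_maximal_solvesOn D.lipschitzOnWith_field
    (1, D.wB) T₁ fun η T α hη hT h0 hα =>
      hT₁ T _ _ _ ((⟨hη, hT, h0, hα⟩ : D.IsCurve α η T).isFlow hDw hDr)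
  have h : D.IsCurve α η T := ⟨hη, hT, h0, hα⟩
  exact ⟨T, _, _, _, h.isFlow hDw hDr, h.tendsto_integral_supNorm hunb⟩

end NonlocalTransport

/-! ### Uniqueness and maximality. -/

namespace NonlocalTransport

open MeasureTheory

theorem integrableOn_div_Ioi {f : ℝ → ℝ} {a b : ℝ} (ha : 0 < a)
    (hf : ∀ x, 0 < x → x ∉ Icc a b → f x = 0) (cf : ContinuousOn f (Ioi 0)) {x : ℝ} (hx : 0 < x) :
    IntegrableOn (fun y => f y / y) (Ioi x) := by
  have hsub : Icc a b ⊆ Ioi 0 := fun y hy => ha.trans_le hy.1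
  have h : IntegrableOn (fun y => f y / y) (Icc a b) :=
    ((cf.mono hsub).div continuousOn_id fun y hy => (hsub hy).ne').integrableOn_Icc
  refine h.of_forall_sdiff_eq_zero measurableSet_Ioi fun y hy => ?_
  rw [hf y (hx.trans hy.1) hy.2, zero_div]

theorem abs_velocity_sub_le {f g : ℝ → ℝ} {a b m : ℝ} (ha : 0 < a) (hab : a ≤ b)
    (hf : ∀ x, 0 < x → x ∉ Icc a b → f x = 0) (hg : ∀ x, 0 < x → x ∉ Icc a b → g x = 0)
    (cf : ContinuousOn f (Ioi 0)) (cg : ContinuousOn g (Ioi 0))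
    (hm : ∀ x, 0 < x → |f x - g x| ≤ m) {x : ℝ} (hx : 0 < x) :
    |velocity f x - velocity g x| ≤ x * (m / a * (b - a)) := by
  have e : velocity f x - velocity g x = -x * ∫ y in Ioi x, (f y / y - g y / y) := by
    rw [integral_sub (integrableOn_div_Ioi ha hf cf hx) (integrableOn_div_Ioi ha hg cg hx)]
    simp only [velocity]
    ring
  rw [e, abs_mul, abs_neg, abs_of_pos hx]
  have hm0 : 0 ≤ m := (abs_nonneg _).trans (hm x hx)
  gcongr
  have hi : IntegrableOn (fun _ : ℝ => m / a) (Icc a b) := integrableOn_const (by simp)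
  have hI : IntegrableOn ((Icc a b).indicator fun _ => m / a) (Ioi x) :=
    ((integrable_indicator_iff measurableSet_Icc).2 hi).integrableOn
  calc |∫ y in Ioi x, (f y / y - g y / y)| ≤ ∫ y in Ioi x, (Icc a b).indicator (fun _ => m / a) y := by
        rw [← Real.norm_eq_abs]
        refine norm_integral_le_of_norm_le hI ((ae_restrict_iff' measurableSet_Ioi).2
          (Eventually.of_forall fun y hy => ?_))
        have hy0 : 0 < y := hx.trans hy
        by_cases hyI : y ∈ Icc a b
        · rw [indicator_of_mem hyI, ← sub_div, norm_div, Real.norm_eq_abs, Real.norm_eq_abs,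
            abs_of_pos hy0]
          exact div_le_div₀ hm0 (hm y hy0) ha hyI.1
        · rw [indicator_of_notMem hyI, hf y hy0 hyI, hg y hy0 hyI]
          simp
    _ ≤ ∫ y, (Icc a b).indicator (fun _ => m / a) y := by
        refine setIntegral_le_integral ((integrable_indicator_iff measurableSet_Icc).2 hi)
          (Eventually.of_forall fun y => ?_)
        exact indicator_nonneg (fun _ _ => by positivity) y
    _ = m / a * (b - a) := by
        rw [integral_indicator measurableSet_Icc, setIntegral_const]
        simp [hab, mul_comm]

theorem InSolutionSpace.hasDerivAt_comp {T : ℝ} {f : ℝ → ℝ → ℝ} (h : InSolutionSpace T f) {t : ℝ}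
    (ht : t ∈ Ioo 0 T) {γ : ℝ → ℝ} {c : ℝ} (hγ : HasDerivAt γ c t) (hpos : 0 < γ t) :
    HasDerivAt (fun s => f s (γ s))
      (derivWithin (fun s => f s (γ t)) (Icc 0 T) t + deriv (f t) (γ t) * c) t := by
  have hU : Ioo 0 T ×ˢ Ioi (0 : ℝ) ∈ 𝓝 (t, γ t) :=
    (isOpen_Ioo.prod isOpen_Ioi).mem_nhds ⟨ht, hpos⟩
  have hsub : Ioo 0 T ×ˢ Ioi (0 : ℝ) ⊆ Icc 0 T ×ˢ Ioi 0 := prod_mono_left Ioo_subset_Icc_self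
  have h1 := (hasStrictFDerivAt_of_partial (N := f)
    (Nt := fun t x => derivWithin (fun s => f s x) (Icc 0 T) t) (Na := fun t x => deriv (f t) x) hU
    (fun z hz => (h.diff_t z.1 (hsub hz).1 z.2 hz.2).hasDerivWithinAt.hasDerivAt
      (Icc_mem_nhds hz.1.1 hz.1.2))
    (fun z hz => (h.diff_x z.1 (hsub hz).1 z.2 hz.2).hasDerivAt)
    (h.continuous_t.mono hsub) (h.continuous_x.mono hsub)).hasFDerivAt
  have h2 : HasDerivAt (fun s => (s, γ s)) (1, c) t := (hasDerivAt_id t).prodMk hγ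
  have := h1.comp_hasDerivAt t h2
  refine HasDerivAt.congr_deriv this ?_
  simp

theorem InSolutionSpace.deriv_eq_zero {T : ℝ} {f : ℝ → ℝ → ℝ} {a b : ℝ}
    (hs : ∀ t ∈ Icc 0 T, ∀ x, 0 < x → x ∉ Icc a b → f t x = 0) {t : ℝ} (ht : t ∈ Icc 0 T) {x : ℝ}
    (hx : 0 < x) (hxI : x ∉ Icc a b) : deriv (f t) x = 0 := by
  have : f t =ᶠ[𝓝 x] fun _ => 0 := by
    filter_upwards [Ioi_mem_nhds hx, isClosed_Icc.isOpen_compl.mem_nhds hxI] with y hy hyI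
    exact hs t ht y hy hyI
  rw [this.deriv_eq, deriv_const]

theorem abs_le_of_abs_deriv_le_exp {f f' : ℝ → ℝ} {S c κ : ℝ} (hκ : 0 < κ)
    (hf : ContinuousOn f (Icc 0 S)) (h0 : f 0 = 0) (hf' : ∀ t ∈ Ioo 0 S, HasDerivAt f (f' t) t)
    (hb : ∀ t ∈ Ioo 0 S, |f' t| ≤ c * Real.exp (κ * t)) {t : ℝ} (ht : t ∈ Icc 0 S) :
    |f t| ≤ c / κ * (Real.exp (κ * t) - 1) := by
  have hB : ∀ t, HasDerivAt (fun t => c / κ * Real.exp (κ * t)) (c * Real.exp (κ * t)) t := by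
    intro t
    have := (((hasDerivAt_id t).const_mul κ).exp).const_mul (c / κ)
    refine this.congr_deriv ?_
    simp only [id]
    field_simp
  have hBc : ContinuousOn (fun t => c / κ * Real.exp (κ * t)) (Icc 0 S) := fun t _ =>
    (hB t).continuousAt.continuousWithinAt
  have h0S : (0 : ℝ) ∈ Icc 0 S := ⟨le_rfl, ht.1.trans ht.2⟩
  have h1 : MonotoneOn (fun t => c / κ * Real.exp (κ * t) - f t) (Icc 0 S) := by
    refine monotoneOn_of_hasDerivWithinAt_nonneg (convex_Icc 0 S) (hBc.sub hf)
      (f' := fun t => c * Real.exp (κ * t) - f' t) (fun t ht => ?_) fun t ht => ?_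
    all_goals rw [interior_Icc] at ht
    · exact ((hB t).sub (hf' t ht)).hasDerivWithinAt
    · linarith [hb t ht, le_abs_self (f' t)]
  have h2 : MonotoneOn (fun t => c / κ * Real.exp (κ * t) + f t) (Icc 0 S) := by
    refine monotoneOn_of_hasDerivWithinAt_nonneg (convex_Icc 0 S) (hBc.add hf)
      (f' := fun t => c * Real.exp (κ * t) + f' t) (fun t ht => ?_) fun t ht => ?_
    all_goals rw [interior_Icc] at ht
    · exact ((hB t).add (hf' t ht)).hasDerivWithinAt
    · linarith [hb t ht, neg_abs_le (f' t)]
  have k1 := h1 h0S ht ht.1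
  have k2 := h2 h0S ht ht.1
  simp only [mul_zero, Real.exp_zero, h0] at k1 k2
  rw [abs_le]
  constructor <;> linarith

theorem InSolutionSpace.exists_common_support {T : ℝ} {f g : ℝ → ℝ → ℝ} (hf : InSolutionSpace T f)
    (hg : InSolutionSpace T g) : ∃ a b : ℝ, 0 < a ∧ a ≤ b ∧ ∀ t ∈ Icc 0 T, ∀ x, 0 < x →
      x ∉ Icc a b → f t x = 0 ∧ g t x = 0 := by
  obtain ⟨a₁, b₁, ha₁, h₁⟩ := hf.support
  obtain ⟨a₂, b₂, ha₂, h₂⟩ := hg.support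
  refine ⟨min a₁ a₂, max (max b₁ b₂) (min a₁ a₂), lt_min ha₁ ha₂, le_max_right _ _,
    fun t ht x hx hxI => ⟨h₁ t ht x hx fun hc => hxI ?_, h₂ t ht x hx fun hc => hxI ?_⟩⟩
  · exact ⟨(min_le_left _ _).trans hc.1,
      hc.2.trans ((le_max_left _ _).trans (le_max_left _ _))⟩
  · exact ⟨(min_le_right _ _).trans hc.1,
      hc.2.trans ((le_max_right _ _).trans (le_max_left _ _))⟩

/-- Both differences are followed along the flow of the known solution, so the competitor needs no
flow of its own. The velocity difference multiplies derivatives of the competitor only, which are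
bounded on a compact set. -/
theorem IsFlow.eq_of_isSolution {w r : ℝ → ℝ} {T T' S : ℝ} {X ω ρ ω' ρ' : ℝ → ℝ → ℝ}
    (h : IsFlow w r T X ω ρ) (h' : IsSolution w r T' ω' ρ') (hS : 0 < S) (hST : S < T)
    (hST' : S ≤ T') : ∀ t ∈ Icc 0 S, ∀ x, 0 < x → ω' t x = ω t x ∧ ρ' t x = ρ t x := by
  have hs := h.solution S hS hST
  have hI : Icc 0 S ⊆ Icc 0 T' := Icc_subset_Icc_right hST'
  have hIT : Icc 0 S ⊆ Ico 0 T := fun t ht => ⟨ht.1, ht.2.trans_lt hST⟩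
  obtain ⟨a₁, b₁, ha₁, hab₁, s₁⟩ := hs.omega_mem.exists_common_support hs.rho_mem
  obtain ⟨a₂, b₂, ha₂, hab₂, s₂⟩ := h'.omega_mem.exists_common_support h'.rho_mem
  set a := min a₁ a₂ with hadef
  set b := max b₁ b₂ with hbdef
  have ha : 0 < a := lt_min ha₁ ha₂
  have hab : a ≤ b := (min_le_left _ _).trans (hab₁.trans (le_max_left _ _))
  have hs₁ : ∀ t ∈ Icc 0 S, ∀ x, 0 < x → x ∉ Icc a b → ω t x = 0 ∧ ρ t x = 0 :=
    fun t ht x hx hxI => s₁ t ht x hx fun hc =>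
      hxI ⟨(min_le_left _ _).trans hc.1, hc.2.trans (le_max_left _ _)⟩
  have hs₂ : ∀ t ∈ Icc 0 S, ∀ x, 0 < x → x ∉ Icc a b → ω' t x = 0 ∧ ρ' t x = 0 :=
    fun t ht x hx hxI => s₂ t (hI ht) x hx fun hc =>
      hxI ⟨(min_le_right _ _).trans hc.1, hc.2.trans (le_max_right _ _)⟩
  set Q : Set (ℝ × ℝ) := Icc 0 S ×ˢ Icc a b with hQ
  have hQc : IsCompact Q := isCompact_Icc.prod isCompact_Icc
  have hQs : Q ⊆ Icc 0 S ×ˢ Ioi 0 := prod_mono_right fun y hy => ha.trans_le hy.1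
  have hQs' : Q ⊆ Icc 0 T' ×ˢ Ioi 0 := hQs.trans (prod_mono_left hI)
  obtain ⟨B₁, hB₁⟩ := hQc.exists_bound_of_continuousOn (h'.omega_mem.continuous_x.mono hQs')
  obtain ⟨B₂, hB₂⟩ := hQc.exists_bound_of_continuousOn (h'.rho_mem.continuous_x.mono hQs')
  set B := max 0 (max B₁ B₂) with hB
  have hB0 : 0 ≤ B := le_max_left _ _
  -- The first term bounds the effect of `(ρ' - ρ) / x`, the second that of the velocity difference.
  set C := 1 / a + b / a * (b - a) * B with hC
  have hb0 : 0 < b := ha.trans_le hab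
  have hCpos : 0 < C := by
    have : 0 ≤ b / a * (b - a) * B := mul_nonneg (mul_nonneg (by positivity) (by linarith)) hB0
    have : 0 < 1 / a := by positivity
    linarith
  -- The rate in the weight is twice the growth constant `C`: integrating `C M exp (2 C s)` in time
  -- then yields `M / 2`, so the weighted maximum satisfies `M ≤ M / 2`.
  set μ : ℝ × ℝ → ℝ := fun z =>
    Real.exp (-(2 * C * z.1)) * max |ω' z.1 z.2 - ω z.1 z.2| |ρ' z.1 z.2 - ρ z.1 z.2| with hμ
  have hμc : ContinuousOn μ Q := by
    have c1 := (h'.omega_mem.continuous.mono hQs').sub (hs.omega_mem.continuous.mono hQs)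
    have c2 := (h'.rho_mem.continuous.mono hQs').sub (hs.rho_mem.continuous.mono hQs)
    exact ContinuousOn.mul (by fun_prop) (c1.abs.sup c2.abs)
  have hQne : Q.Nonempty := ⟨(0, a), ⟨le_rfl, hS.le⟩, le_rfl, hab⟩
  obtain ⟨z₀, hz₀, hmax⟩ := hQc.exists_isMaxOn hQne hμc
  set M := μ z₀ with hM
  have hM0 : 0 ≤ M := mul_nonneg (Real.exp_pos _).le (le_max_of_le_left (abs_nonneg _))
  have hbound : ∀ t ∈ Icc 0 S, ∀ x, 0 < x →
      |ω' t x - ω t x| ≤ M * Real.exp (2 * C * t) ∧ |ρ' t x - ρ t x| ≤ M * Real.exp (2 * C * t) := by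
    intro t ht x hx
    rw [← max_le_iff]
    by_cases hxI : x ∈ Icc a b
    · have := hmax (show (t, x) ∈ Q from ⟨ht, hxI⟩)
      simp only [hμ, mem_ofPred_eq] at this
      rw [Real.exp_neg, inv_mul_le_iff₀ (Real.exp_pos _)] at this
      rw [mul_comm]
      exact this
    · rw [(hs₁ t ht x hx hxI).1, (hs₁ t ht x hx hxI).2, (hs₂ t ht x hx hxI).1,
        (hs₂ t ht x hx hxI).2]
      simp only [sub_self, abs_zero, max_self]
      positivity
  have slice : ∀ {T : ℝ} {f : ℝ → ℝ → ℝ}, InSolutionSpace T f → ∀ t ∈ Icc 0 T,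
      ContinuousOn (f t) (Ioi 0) := fun hf t ht =>
    fun x hx => (hf.diff_x t ht x hx).continuousAt.continuousWithinAt
  -- transport of a difference
  have hder : ∀ {d : ℝ → ℝ}, (∀ t ∈ Icc 0 S, ∀ x, 0 < x → x ∉ Icc a b → d x = 0) →
      ∀ t ∈ Icc 0 S, ∀ x, 0 < x → (x ∈ Icc a b → |d x| ≤ B) →
      |(velocity (ω t) x - velocity (ω' t) x) * d x| ≤
        b / a * (b - a) * B * (M * Real.exp (2 * C * t)) := by
    intro d hd t ht x hx hdB
    by_cases hxI : x ∈ Icc a b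
    · have hv := abs_velocity_sub_le ha hab (fun x hx hxI => (hs₁ t ht x hx hxI).1)
        (fun x hx hxI => (hs₂ t ht x hx hxI).1) (slice hs.omega_mem t ht)
        (slice h'.omega_mem t (hI ht))
        (m := M * Real.exp (2 * C * t))
        (fun x hx => by rw [abs_sub_comm]; exact (hbound t ht x hx).1) hx
      have hba : 0 ≤ b - a := by linarith
      rw [abs_mul]
      calc |velocity (ω t) x - velocity (ω' t) x| * |d x|
          ≤ (x * (M * Real.exp (2 * C * t) / a * (b - a))) * B := by
            gcongr
            exact hdB hxI
        _ ≤ (b * (M * Real.exp (2 * C * t) / a * (b - a))) * B := by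
            gcongr
            exact hxI.2
        _ = b / a * (b - a) * B * (M * Real.exp (2 * C * t)) := by ring
    · rw [hd t ht x hx hxI, mul_zero, abs_zero]
      have hba : 0 ≤ b - a := by linarith
      positivity
  have main : ∀ t ∈ Icc 0 S, ∀ x, 0 < x →
      |ω' t x - ω t x| ≤ C * M / (2 * C) * (Real.exp (2 * C * t) - 1) ∧
      |ρ' t x - ρ t x| ≤ C * M / (2 * C) * (Real.exp (2 * C * t) - 1) := by
    intro t ht x hx
    obtain ⟨c, hc, rfl⟩ := h.surj t (hIT ht) x hx
    have hXpos : ∀ s ∈ Icc 0 S, 0 < X s c := fun s hs => h.pos s (hIT hs) c hc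
    have hXc : ContinuousOn (fun s => (s, X s c)) (Icc 0 S) := fun s hs =>
      (continuousAt_id.prodMk
        (h.hasDerivAt_flow s (hIT hs) c hc).continuousAt).continuousWithinAt
    have hmaps : MapsTo (fun s => (s, X s c)) (Icc 0 S) (Icc 0 S ×ˢ Ioi 0) :=
      fun s hs => ⟨hs, hXpos s hs⟩
    have hmaps' : MapsTo (fun s => (s, X s c)) (Icc 0 S) (Icc 0 T' ×ˢ Ioi 0) :=
      fun s hs => ⟨hI hs, hXpos s hs⟩
    have hT' : Ioo 0 S ⊆ Ioo 0 T' := Ioo_subset_Ioo_right hST'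
    constructor
    · refine abs_le_of_abs_deriv_le_exp (f := fun s => ω' s (X s c) - ω s (X s c))
        (f' := fun s => (ρ' s (X s c) - ρ s (X s c)) / X s c +
          (velocity (ω s) (X s c) - velocity (ω' s) (X s c)) * deriv (ω' s) (X s c)) (S := S)
        (by positivity) ?_ ?_ (fun s hs' => ?_) (fun s hs' => ?_) ht
      · exact (h'.omega_mem.continuous.comp hXc hmaps').sub
          (hs.omega_mem.continuous.comp hXc hmaps)
      · rw [h.init, h'.omega_init c hc, h.omega_init c hc, sub_self]
      · have hs'' := Ioo_subset_Icc_self hs'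
        have d1 := h'.omega_mem.hasDerivAt_comp (hT' hs') (h.hasDerivAt_flow s (hIT hs'') c hc)
          (hXpos s hs'')
        have d2 := h.hasDerivAt_omega s (hIT hs'') c hc
        refine (d1.sub d2).congr_deriv ?_
        have e := h'.omega_eq s (hI hs'') (X s c) (hXpos s hs'')
        rw [← h.rho_flow s (hIT hs'') c hc]
        rw [sub_div]
        linear_combination e
      · have hs'' := Ioo_subset_Icc_self hs'
        have hx0 := hXpos s hs''
        have k1 : |(ρ' s (X s c) - ρ s (X s c)) / X s c| ≤ 1 / a * (M * Real.exp (2 * C * s)) := by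
          by_cases hxI : X s c ∈ Icc a b
          · rw [abs_div, abs_of_pos hx0, div_eq_inv_mul, one_div]
            gcongr
            · exact hxI.1
            · exact (hbound s hs'' _ hx0).2
          · rw [(hs₁ s hs'' _ hx0 hxI).2, (hs₂ s hs'' _ hx0 hxI).2]
            simp only [sub_self, zero_div, abs_zero]
            positivity
        have k2 := hder (d := fun x => deriv (ω' s) x)
          (fun t ht x hx hxI => InSolutionSpace.deriv_eq_zero
            (fun t ht x hx hxI => (hs₂ t ht x hx hxI).1) hs'' hx hxI) s hs'' (X s c) hx0
          (fun hxI => (hB₁ (s, X s c) ⟨hs'', hxI⟩).trans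
            ((le_max_left _ _).trans (le_max_right _ _)))
        calc _ ≤ _ := abs_add_le _ _
          _ ≤ 1 / a * (M * Real.exp (2 * C * s)) +
              b / a * (b - a) * B * (M * Real.exp (2 * C * s)) := add_le_add k1 k2
          _ = C * M * Real.exp (2 * C * s) := by rw [hC]; ring
    · refine abs_le_of_abs_deriv_le_exp (f := fun s => ρ' s (X s c) - ρ s (X s c))
        (f' := fun s =>
          (velocity (ω s) (X s c) - velocity (ω' s) (X s c)) * deriv (ρ' s) (X s c)) (S := S)
        (by positivity) ?_ ?_ (fun s hs' => ?_) (fun s hs' => ?_) ht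
      · exact (h'.rho_mem.continuous.comp hXc hmaps').sub
          (hs.rho_mem.continuous.comp hXc hmaps)
      · rw [h.init, h'.rho_init c hc, hs.rho_init c hc, sub_self]
      · have hs'' := Ioo_subset_Icc_self hs'
        have d1 := h'.rho_mem.hasDerivAt_comp (hT' hs') (h.hasDerivAt_flow s (hIT hs'') c hc)
          (hXpos s hs'')
        have d2 : HasDerivAt (fun s => ρ s (X s c)) 0 s := by
          refine (hasDerivAt_const s (r c)).congr_of_eventuallyEq ?_
          filter_upwards [Ioo_mem_nhds hs'.1 hs'.2] with σ hσ
          exact h.rho_flow σ (hIT (Ioo_subset_Icc_self hσ)) c hc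
        refine (d1.sub d2).congr_deriv ?_
        have e := h'.rho_eq s (hI hs'') (X s c) (hXpos s hs'')
        linear_combination e
      · have hs'' := Ioo_subset_Icc_self hs'
        have hx0 := hXpos s hs''
        have k2 := hder (d := fun x => deriv (ρ' s) x)
          (fun t ht x hx hxI => InSolutionSpace.deriv_eq_zero
            (fun t ht x hx hxI => (hs₂ t ht x hx hxI).2) hs'' hx hxI) s hs'' (X s c) hx0
          (fun hxI => (hB₂ (s, X s c) ⟨hs'', hxI⟩).trans
            ((le_max_right _ _).trans (le_max_right _ _)))
        refine k2.trans ?_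
        have : 0 ≤ 1 / a * (M * Real.exp (2 * C * s)) := by positivity
        have e : C * M * Real.exp (2 * C * s) = 1 / a * (M * Real.exp (2 * C * s)) +
            b / a * (b - a) * B * (M * Real.exp (2 * C * s)) := by rw [hC]; ring
        linarith
  have hMle : M ≤ M / 2 := by
    have hz := main z₀.1 hz₀.1 z₀.2 (ha.trans_le hz₀.2.1)
    have hmx := max_le hz.1 hz.2
    have hCM : C * M / (2 * C) = M / 2 := by field_simp
    rw [hCM] at hmx
    calc M = Real.exp (-(2 * C * z₀.1)) *
          max |ω' z₀.1 z₀.2 - ω z₀.1 z₀.2| |ρ' z₀.1 z₀.2 - ρ z₀.1 z₀.2| := rfl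
      _ ≤ Real.exp (-(2 * C * z₀.1)) * (M / 2 * (Real.exp (2 * C * z₀.1) - 1)) := by gcongr
      _ ≤ Real.exp (-(2 * C * z₀.1)) * (M / 2 * Real.exp (2 * C * z₀.1)) := by
          gcongr
          linarith
      _ = M / 2 := by
          rw [Real.exp_neg]
          have := (Real.exp_pos (2 * C * z₀.1)).ne'
          field_simp
  have hMz : M = 0 := by linarith
  intro t ht x hx
  have := hbound t ht x hx
  rw [hMz, zero_mul] at this
  exact ⟨sub_eq_zero.1 (abs_nonpos_iff.1 this.1), sub_eq_zero.1 (abs_nonpos_iff.1 this.2)⟩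

/-- A solution on `[0, T']` with `T' ≥ T` is bounded, and by uniqueness equals `ω` before `T`; then
`∫ ‖ω‖` could not diverge at `T`. -/
theorem IsFlow.isMaximalSolution {w r : ℝ → ℝ} {T : ℝ} {X ω ρ : ℝ → ℝ → ℝ}
    (h : IsFlow w r T X ω ρ)
    (hb : Tendsto (fun t => ∫ s in (0 : ℝ)..t, supNorm (ω s)) (𝓝[<] T) atTop) :
    IsMaximalSolution w r T ω ρ := by
  refine ⟨h.T_pos, h.solution, fun T' ω' ρ' h' => ?_⟩
  have hlt : T' < T := by
    by_contra! hTT'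
    obtain ⟨a, b, ha, hs⟩ := h'.omega_mem.support
    obtain ⟨B, hB⟩ := (isCompact_Icc.prod isCompact_Icc).exists_bound_of_continuousOn
      (h'.omega_mem.continuous.mono (prod_mono_right
        (fun y (hy : y ∈ Icc a b) => mem_Ioi.2 (ha.trans_le hy.1))))
    have hB' : ∀ t ∈ Icc 0 T', ∀ x, 0 < x → |ω' t x| ≤ max 0 B := by
      intro t ht x hx
      by_cases hxI : x ∈ Icc a b
      · exact (hB (t, x) ⟨ht, hxI⟩).trans (le_max_right _ _)
      · rw [hs t ht x hx hxI, abs_zero]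
        exact le_max_left _ _
    have hsup : ∀ t ∈ Ico 0 T, supNorm (ω t) ≤ max 0 B := by
      intro t ht
      have hne : Nonempty (Ioi (0 : ℝ)) := ⟨⟨1, mem_Ioi.2 one_pos⟩⟩
      refine ciSup_le fun x => ?_
      obtain ⟨S, hS1, hS2⟩ := exists_between ht.2
      have := (h.eq_of_isSolution h' (ht.1.trans_lt hS1) hS2 (hS2.le.trans hTT') t
        ⟨ht.1, hS1.le⟩ x x.2).1
      rw [← this]
      exact hB' t ⟨ht.1, ht.2.le.trans hTT'⟩ x x.2
    have hint : ∀ t ∈ Ico 0 T, ∫ s in (0 : ℝ)..t, supNorm (ω s) ≤ max 0 B * T := by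
      intro t ht
      refine (le_abs_self _).trans ?_
      have := intervalIntegral.norm_integral_le_of_norm_le_const (a := 0) (b := t)
        (f := fun s => supNorm (ω s)) (C := max 0 B) (fun s hs => by
          rw [uIoc_of_le ht.1] at hs
          have h0 : 0 ≤ supNorm (ω s) := Real.iSup_nonneg fun x => abs_nonneg _
          rw [Real.norm_eq_abs, abs_of_nonneg h0]
          exact hsup s ⟨hs.1.le, hs.2.trans_lt ht.2⟩)
      rw [sub_zero, abs_of_nonneg ht.1] at this
      exact this.trans (mul_le_mul_of_nonneg_left ht.2.le (le_max_left _ _))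
    obtain ⟨t, ht1, ht2⟩ := ((hb.eventually_gt_atTop (max 0 B * T)).and
      (Ioo_mem_nhdsLT h.T_pos)).exists
    exact absurd (hint t ⟨ht2.1.le, ht2.2⟩) (not_le.2 ht1)
  exact ⟨hlt, h.eq_of_isSolution h' h'.pos hlt le_rfl⟩

end NonlocalTransport

/-! ### The barriers and the tail means they generate. -/

namespace NonlocalTransport

open MeasureTheory

/-- `∫_x^∞ f(y)/y dy`. -/
noncomputable def tailMean (f : ℝ → ℝ) (x : ℝ) : ℝ := ∫ y in Ioi x, f y / y

theorem velocity_eq (f : ℝ → ℝ) (x : ℝ) : velocity f x = -(x * tailMean f x) := by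
  rw [velocity, tailMean, neg_mul]

theorem tailMean_split {f : ℝ → ℝ} {x y : ℝ} (hf : IntegrableOn (fun z => f z / z) (Ioi x))
    (hxy : x ≤ y) : tailMean f x = (∫ z in x..y, f z / z) + tailMean f y :=
  (intervalIntegral.integral_interval_add_Ioi hf (hf.mono_set (Ioi_subset_Ioi hxy))).symm

theorem integral_rpow_div {c s x y : ℝ} (hx : 0 < x) (hxy : x ≤ y) (hs : 0 < s) :
    IntervalIntegrable (fun z => c * z ^ (-s) / z) volume x y ∧
    ∫ z in x..y, c * z ^ (-s) / z = c / s * (x ^ (-s) - y ^ (-s)) := by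
  have hpos : ∀ z ∈ uIcc x y, 0 < z := fun z hz => by
    rw [uIcc_of_le hxy] at hz
    exact hx.trans_le hz.1
  have hd : ∀ z ∈ uIcc x y, HasDerivAt (fun z => -(c / s) * z ^ (-s)) (c * z ^ (-s) / z) z := by
    intro z hz
    have hz0 := hpos z hz
    refine ((Real.hasDerivAt_rpow_const (p := -s) (Or.inl hz0.ne')).const_mul (-(c / s))).congr_deriv ?_
    rw [Real.rpow_sub_one hz0.ne']
    field_simp
  have hc : ContinuousOn (fun z => c * z ^ (-s) / z) (uIcc x y) := by
    refine ContinuousOn.div (continuousOn_const.mul ?_) continuousOn_id fun z hz => (hpos z hz).ne'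
    exact fun z hz =>
      (Real.continuousAt_rpow_const z (-s) (Or.inl (hpos z hz).ne')).continuousWithinAt
  refine ⟨hc.intervalIntegrable, ?_⟩
  rw [intervalIntegral.integral_eq_sub_of_hasDerivAt hd hc.intervalIntegrable]
  ring

theorem intervalIntegrable_of_Ioi {g : ℝ → ℝ} {x y : ℝ} (hg : IntegrableOn g (Ioi x))
    (hxy : x ≤ y) : IntervalIntegrable g volume x y :=
  (intervalIntegrable_iff_integrableOn_Ioc_of_le hxy).2 (hg.mono_set Ioc_subset_Ioi_self)

theorem tailMean_le {f : ℝ → ℝ} {c s x y : ℝ} (hx : 0 < x) (hxy : x ≤ y) (hs : 0 < s)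
    (hf : IntegrableOn (fun z => f z / z) (Ioi x)) (hb : ∀ z ∈ Icc x y, f z ≤ c * z ^ (-s)) :
    tailMean f x ≤ c / s * (x ^ (-s) - y ^ (-s)) + tailMean f y := by
  obtain ⟨h1, h2⟩ := integral_rpow_div (c := c) hx hxy hs
  rw [tailMean_split hf hxy, ← h2]
  gcongr
  refine intervalIntegral.integral_mono_on hxy (intervalIntegrable_of_Ioi hf hxy) h1 fun z hz => ?_
  have := hx.trans_le hz.1
  gcongr
  exact hb z hz

theorem le_tailMean {f : ℝ → ℝ} {c s x y : ℝ} (hx : 0 < x) (hxy : x ≤ y) (hs : 0 < s)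
    (hf : IntegrableOn (fun z => f z / z) (Ioi x)) (hb : ∀ z ∈ Icc x y, c * z ^ (-s) ≤ f z) :
    c / s * (x ^ (-s) - y ^ (-s)) + tailMean f y ≤ tailMean f x := by
  obtain ⟨h1, h2⟩ := integral_rpow_div (c := c) hx hxy hs
  rw [tailMean_split hf hxy, ← h2]
  gcongr
  refine intervalIntegral.integral_mono_on hxy h1 (intervalIntegrable_of_Ioi hf hxy) fun z hz => ?_
  have := hx.trans_le hz.1
  gcongr
  exact hb z hz

namespace Parameters

/-- The lower barrier on `[λ_{n+1}, λ_n]`. -/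
noncomputable def lower (P : Parameters) (n : ℕ) (x : ℝ) : ℝ := P.φ (n + 1) * x ^ (-P.p (n + 1))

/-- The upper barrier on `[λ_{n+1}, λ_n]`. -/
noncomputable def upper (P : Parameters) (n : ℕ) (x : ℝ) : ℝ := P.ψ (n + 1) * x ^ (-P.q (n + 1))

/-- Quantitative conditions on admissible parameters under which the barriers are trapping and
enclose the profile `x^{-1/2}` up to the factors `φ` and `ψ`. -/
structure Trapping (P : Parameters) (φ ψ : ℝ) : Prop extends P.Admissible where
  profile_phi_pos : 0 < φ
  p_lt_half : ∀ n, 1 ≤ n → P.p n < 1 / 2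
  ratio_rpow_q : ∀ n, (P.lam (n + 1) / P.lam n) ^ P.q (n + 1) ≤ P.p (n + 1)
  ratio_rpow_p : ∀ n, (P.lam (n + 1) / P.lam n) ^ P.p (n + 1) ≤ P.q (n + 1)
  le_lower : ∀ n, ∀ x ∈ Icc (P.lam (n + 1)) (P.lam n), φ * x ^ (-(1 / 2) : ℝ) ≤ P.lower n x
  upper_le : ∀ n, ∀ x ∈ Icc (P.lam (n + 1)) (P.lam n), P.upper n x ≤ ψ * x ^ (-(1 / 2) : ℝ)

/-- `f` lies between the barriers on `[A, λ_0]`. -/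
def Between (P : Parameters) (A : ℝ) (f : ℝ → ℝ) : Prop :=
  ∀ n, ∀ x ∈ Icc (P.lam (n + 1)) (P.lam n), A ≤ x → P.lower n x < f x ∧ f x < P.upper n x

namespace Trapping

variable {P : Parameters} {φ ψ : ℝ}

theorem p_succ_pos (h : P.Trapping φ ψ) (n : ℕ) : 0 < P.p (n + 1) := h.p_pos _ (by omega)

theorem p_lt (h : P.Trapping φ ψ) (n : ℕ) : P.p (n + 1) < 1 / 2 := h.p_lt_half _ (by omega)

theorem q_eq (h : P.Trapping φ ψ) (n : ℕ) : P.q (n + 1) = 1 - P.p (n + 1) := by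
  linarith [h.p_add_q (n + 1) (by omega)]

theorem q_succ_pos (h : P.Trapping φ ψ) (n : ℕ) : 0 < P.q (n + 1) := by
  rw [h.q_eq]; linarith [h.p_lt n]

theorem phi_succ_pos (h : P.Trapping φ ψ) (n : ℕ) : 0 < P.φ (n + 1) := h.phi_pos _ (by omega)

theorem psi_succ_pos (h : P.Trapping φ ψ) (n : ℕ) : 0 < P.ψ (n + 1) :=
  (h.phi_succ_pos n).trans (h.phi_lt_psi _ (by omega))

theorem lower_pos (h : P.Trapping φ ψ) (n : ℕ) {x : ℝ} (hx : 0 < x) : 0 < P.lower n x :=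
  mul_pos (h.phi_succ_pos n) (Real.rpow_pos_of_pos hx _)

theorem upper_pos (h : P.Trapping φ ψ) (n : ℕ) {x : ℝ} (hx : 0 < x) : 0 < P.upper n x :=
  mul_pos (h.psi_succ_pos n) (Real.rpow_pos_of_pos hx _)

/-- This duality makes the barriers work: `1 / x` is the source of the vorticity where `ρ = 1`, and
each barrier is trapping under a bound for the tail mean by the other one. -/
theorem lower_mul_upper (h : P.Trapping φ ψ) (n : ℕ) {x : ℝ} (hx : 0 < x) :
    P.lower n x * P.upper n x = 1 / x := by
  have e : P.lower n x * P.upper n x =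
      P.φ (n + 1) * P.ψ (n + 1) * (x ^ (-P.p (n + 1)) * x ^ (-P.q (n + 1))) := by
    simp only [lower, upper]; ring
  rw [e, h.phi_mul_psi _ (by omega), one_mul, ← Real.rpow_add hx, h.q_eq]
  rw [show -P.p (n + 1) + -(1 - P.p (n + 1)) = -1 by ring, Real.rpow_neg_one, one_div]

theorem lower_relay (h : P.Trapping φ ψ) (n : ℕ) :
    P.lower (n + 1) (P.lam (n + 1)) ≤ P.lower n (P.lam (n + 1)) := h.relay_lower (n + 1) (by omega)

theorem upper_relay (h : P.Trapping φ ψ) (n : ℕ) :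
    P.upper n (P.lam (n + 1)) ≤ P.upper (n + 1) (P.lam (n + 1)) := h.relay_upper (n + 1) (by omega)

theorem rpow_ratio (h : P.Trapping φ ψ) (n : ℕ) (s : ℝ) :
    P.lam n ^ (-s) = (P.lam (n + 1) / P.lam n) ^ s * P.lam (n + 1) ^ (-s) := by
  have h1 := h.lam_pos n
  have h2 := h.lam_pos (n + 1)
  rw [Real.div_rpow h2.le h1.le, Real.rpow_neg h1.le, Real.rpow_neg h2.le]
  have := (Real.rpow_pos_of_pos h2 s).ne'
  field_simp

theorem lam_antitone (h : P.Trapping φ ψ) : Antitone P.lam :=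
  antitone_nat_of_succ_le fun n => (h.lam_anti n).le

theorem exists_mem_Icc (h : P.Trapping φ ψ) {x : ℝ} (hx : 0 < x) (hx0 : x ≤ P.lam 0) :
    ∃ n, x ∈ Icc (P.lam (n + 1)) (P.lam n) := by
  have hex : ∃ n, P.lam (n + 1) ≤ x := by
    obtain ⟨n, hn⟩ := (h.lam_tendsto.eventually (gt_mem_nhds hx)).exists
    exact ⟨n, (h.lam_antitone (Nat.le_succ n)).trans hn.le⟩
  classical
  refine ⟨Nat.find hex, Nat.find_spec hex, ?_⟩
  rcases hn : Nat.find hex with _ | m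
  · exact hx0
  · have := Nat.find_min hex (m := m) (by omega)
    exact (not_le.1 this).le

/-- The upper bound for the tail mean at the right end of an interval is inherited by the points of
this interval. -/
theorem tailMean_lt_upper_div (h : P.Trapping φ ψ) {f : ℝ → ℝ} {n : ℕ} {x : ℝ}
    (hx0 : 0 < x) (hx : x ≤ P.lam n) (hf : IntegrableOn (fun z => f z / z) (Ioi x))
    (hb : ∀ z ∈ Icc x (P.lam n), f z ≤ P.upper n z)
    (hI : tailMean f (P.lam n) < P.upper n (P.lam n) / P.p (n + 1)) :
    tailMean f x < P.upper n x / P.p (n + 1) := by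
  have hp := h.p_succ_pos n
  have hq := h.q_succ_pos n
  have hψ := h.psi_succ_pos n
  have h1 := tailMean_le hx0 hx hq hf hb
  have hmono : P.lam n ^ (-P.q (n + 1)) ≤ x ^ (-P.q (n + 1)) :=
    Real.rpow_le_rpow_of_nonpos hx0 hx (by linarith)
  have hpq : P.ψ (n + 1) / P.q (n + 1) ≤ P.ψ (n + 1) / P.p (n + 1) := by
    have := h.p_lt n
    gcongr
    rw [h.q_eq]
    linarith
  have h2 := mul_le_mul_of_nonneg_right hpq (sub_nonneg.2 hmono)
  simp only [upper] at hI ⊢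
  calc tailMean f x ≤ _ := h1
    _ < P.ψ (n + 1) / P.p (n + 1) * (x ^ (-P.q (n + 1)) - P.lam n ^ (-P.q (n + 1))) +
        P.ψ (n + 1) * P.lam n ^ (-P.q (n + 1)) / P.p (n + 1) := by linarith
    _ = _ := by ring

/-- The barrier contributes `φ_{n+1} / p_{n+1}` times a difference of powers. Replacing `p_{n+1}` by
the larger `q_{n+1}` makes the end point terms telescope. -/
theorem lower_div_lt_tailMean (h : P.Trapping φ ψ) {f : ℝ → ℝ} {n : ℕ} {x : ℝ}
    (hx0 : 0 < x) (hx : x ≤ P.lam n) (hf : IntegrableOn (fun z => f z / z) (Ioi x))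
    (hb : ∀ z ∈ Icc x (P.lam n), P.lower n z ≤ f z)
    (hI : P.lower n (P.lam n) / P.q (n + 1) < tailMean f (P.lam n)) :
    P.lower n x / P.q (n + 1) < tailMean f x := by
  have hp := h.p_succ_pos n
  have hq := h.q_succ_pos n
  have hφ := h.phi_succ_pos n
  have h1 := le_tailMean hx0 hx hp hf hb
  have hmono : P.lam n ^ (-P.p (n + 1)) ≤ x ^ (-P.p (n + 1)) :=
    Real.rpow_le_rpow_of_nonpos hx0 hx (by linarith)
  have hpq : P.φ (n + 1) / P.q (n + 1) ≤ P.φ (n + 1) / P.p (n + 1) := by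
    have := h.p_lt n
    gcongr
    rw [h.q_eq]
    linarith
  have h2 := mul_le_mul_of_nonneg_right hpq (sub_nonneg.2 hmono)
  simp only [lower] at hI ⊢
  calc P.φ (n + 1) * x ^ (-P.p (n + 1)) / P.q (n + 1)
      = P.φ (n + 1) / P.q (n + 1) * (x ^ (-P.p (n + 1)) - P.lam n ^ (-P.p (n + 1))) +
        P.φ (n + 1) * P.lam n ^ (-P.p (n + 1)) / P.q (n + 1) := by ring
    _ < _ := by linarith
    _ ≤ _ := h1

/-- Across a whole interval the contribution from the right end is damped by a power of the scale
ratio. Its smallness gives the constant `2`, which lies below `1 / p` for every `p < 1/2`; so the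
bound survives the change of exponents. -/
theorem tailMean_lam_lt (h : P.Trapping φ ψ) {f : ℝ → ℝ} {n : ℕ}
    (hf : IntegrableOn (fun z => f z / z) (Ioi (P.lam (n + 1))))
    (hb : ∀ z ∈ Icc (P.lam (n + 1)) (P.lam n), f z ≤ P.upper n z)
    (hI : tailMean f (P.lam n) < P.upper n (P.lam n) / P.p (n + 1)) :
    tailMean f (P.lam (n + 1)) < P.upper (n + 1) (P.lam (n + 1)) / P.p (n + 2) := by
  have hp := h.p_succ_pos n
  have hq := h.q_succ_pos n
  have hψ := h.psi_succ_pos n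
  have hp' := h.p_succ_pos (n + 1)
  have h1 := tailMean_le (h.lam_pos (n + 1)) (h.lam_anti n).le hq hf hb
  have hr := h.ratio_rpow_q n
  have hr0 : 0 ≤ (P.lam (n + 1) / P.lam n) ^ P.q (n + 1) :=
    Real.rpow_nonneg (div_pos (h.lam_pos _) (h.lam_pos _)).le _
  have hrel := h.upper_relay n
  have hY : 0 < P.lam (n + 1) ^ (-P.q (n + 1)) := Real.rpow_pos_of_pos (h.lam_pos _) _
  have hup : P.upper n (P.lam n) = P.ψ (n + 1) * ((P.lam (n + 1) / P.lam n) ^ P.q (n + 1) *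
      P.lam (n + 1) ^ (-P.q (n + 1))) := by rw [← h.rpow_ratio]; rfl
  rw [hup] at hI
  rw [h.rpow_ratio n] at h1
  set ρ := (P.lam (n + 1) / P.lam n) ^ P.q (n + 1)
  set Y := P.lam (n + 1) ^ (-P.q (n + 1))
  -- The left side increases with `ρ`, and it equals `2` at `ρ = p_{n+1}` because `p + q = 1`.
  have key : 1 / P.q (n + 1) * (1 - ρ) + ρ / P.p (n + 1) ≤ 2 := by
    have e : 1 / P.q (n + 1) * (1 - ρ) + ρ / P.p (n + 1) =
        1 / P.q (n + 1) + ρ * (1 / P.p (n + 1) - 1 / P.q (n + 1)) := by ring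
    have hpq : 0 ≤ 1 / P.p (n + 1) - 1 / P.q (n + 1) := by
      rw [sub_nonneg]
      have := h.p_lt n
      gcongr
      rw [h.q_eq]
      linarith
    rw [e]
    calc _ ≤ 1 / P.q (n + 1) + P.p (n + 1) * (1 / P.p (n + 1) - 1 / P.q (n + 1)) := by gcongr
      _ = 2 := by
        have hq' := h.q_eq n
        rw [hq'] at hq ⊢
        field_simp
        ring
  have h2 : (2 : ℝ) ≤ 1 / P.p (n + 2) := by
    rw [le_div_iff₀ hp']
    linarith [h.p_lt (n + 1)]
  calc tailMean f (P.lam (n + 1)) ≤ _ := h1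
    _ < P.ψ (n + 1) / P.q (n + 1) * (Y - ρ * Y) + P.ψ (n + 1) * (ρ * Y) / P.p (n + 1) := by linarith
    _ = P.ψ (n + 1) * Y * (1 / P.q (n + 1) * (1 - ρ) + ρ / P.p (n + 1)) := by ring
    _ ≤ P.ψ (n + 1) * Y * (1 / P.p (n + 2)) := by
        gcongr
        exact key.trans h2
    _ = P.upper n (P.lam (n + 1)) / P.p (n + 2) := by simp only [upper, Y]; ring
    _ ≤ _ := by
        gcongr

/-- The mirror image: with the ratio power at most `q_{n+1}` the constant is at least `2`, which
exceeds `1 / q` for every `q > 1/2`. -/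
theorem lt_tailMean_lam (h : P.Trapping φ ψ) {f : ℝ → ℝ} {n : ℕ}
    (hf : IntegrableOn (fun z => f z / z) (Ioi (P.lam (n + 1))))
    (hb : ∀ z ∈ Icc (P.lam (n + 1)) (P.lam n), P.lower n z ≤ f z)
    (hI : P.lower n (P.lam n) / P.q (n + 1) < tailMean f (P.lam n)) :
    P.lower (n + 1) (P.lam (n + 1)) / P.q (n + 2) < tailMean f (P.lam (n + 1)) := by
  have hp := h.p_succ_pos n
  have hq := h.q_succ_pos n
  have hφ := h.phi_succ_pos n
  have hq' := h.q_succ_pos (n + 1)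
  have h1 := le_tailMean (h.lam_pos (n + 1)) (h.lam_anti n).le hp hf hb
  have hr := h.ratio_rpow_p n
  have hrel := h.lower_relay n
  have hY : 0 < P.lam (n + 1) ^ (-P.p (n + 1)) := Real.rpow_pos_of_pos (h.lam_pos _) _
  have hlo : P.lower n (P.lam n) = P.φ (n + 1) * ((P.lam (n + 1) / P.lam n) ^ P.p (n + 1) *
      P.lam (n + 1) ^ (-P.p (n + 1))) := by rw [← h.rpow_ratio]; rfl
  rw [hlo] at hI
  rw [h.rpow_ratio n] at h1
  set ρ := (P.lam (n + 1) / P.lam n) ^ P.p (n + 1)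
  set Y := P.lam (n + 1) ^ (-P.p (n + 1))
  have key : 2 ≤ 1 / P.p (n + 1) * (1 - ρ) + ρ / P.q (n + 1) := by
    have e : 1 / P.p (n + 1) * (1 - ρ) + ρ / P.q (n + 1) =
        1 / P.p (n + 1) - ρ * (1 / P.p (n + 1) - 1 / P.q (n + 1)) := by ring
    have hpq : 0 ≤ 1 / P.p (n + 1) - 1 / P.q (n + 1) := by
      rw [sub_nonneg]
      have := h.p_lt n
      gcongr
      rw [h.q_eq]
      linarith
    rw [e]
    calc 2 = 1 / P.p (n + 1) - P.q (n + 1) * (1 / P.p (n + 1) - 1 / P.q (n + 1)) := by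
          have hq' := h.q_eq n
          rw [hq'] at hq ⊢
          field_simp
          ring
      _ ≤ _ := by gcongr
  have h2 : 1 / P.q (n + 2) ≤ (2 : ℝ) := by
    rw [div_le_iff₀ hq']
    have := h.q_eq (n + 1)
    linarith [h.p_lt (n + 1)]
  calc P.lower (n + 1) (P.lam (n + 1)) / P.q (n + 2)
      ≤ P.lower n (P.lam (n + 1)) / P.q (n + 2) := by
        gcongr
    _ = P.φ (n + 1) * Y * (1 / P.q (n + 2)) := by simp only [lower, Y]; ring
    _ ≤ P.φ (n + 1) * Y * (1 / P.p (n + 1) * (1 - ρ) + ρ / P.q (n + 1)) := by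
        gcongr
        exact h2.trans key
    _ = P.φ (n + 1) / P.p (n + 1) * (Y - ρ * Y) + P.φ (n + 1) * (ρ * Y) / P.q (n + 1) := by ring
    _ < _ := by linarith
    _ ≤ _ := h1

/-- Profiles between the barriers generate velocities for which the barriers are trapping. -/
theorem tailMean_bounds (h : P.Trapping φ ψ) {f : ℝ → ℝ} {A : ℝ} (hA : 0 < A)
    (hf : ∀ x, 0 < x → IntegrableOn (fun z => f z / z) (Ioi x)) (hb : P.Between A f)
    (hI : P.lower 0 (P.lam 0) / P.q 1 < tailMean f (P.lam 0))
    (hI' : tailMean f (P.lam 0) < P.upper 0 (P.lam 0) / P.p 1) (n : ℕ) {x : ℝ}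
    (hx : x ∈ Icc (P.lam (n + 1)) (P.lam n)) (hAx : A ≤ x) :
    P.lower n x / P.q (n + 1) < tailMean f x ∧ tailMean f x < P.upper n x / P.p (n + 1) := by
  -- The bounds travel leftwards through the points `λ_n`, then from a right end point into its
  -- interval.
  have knots : ∀ n, A ≤ P.lam n → P.lower n (P.lam n) / P.q (n + 1) < tailMean f (P.lam n) ∧
      tailMean f (P.lam n) < P.upper n (P.lam n) / P.p (n + 1) := by
    intro n
    induction n with
    | zero => exact fun _ => ⟨hI, hI'⟩
    | succ n ih =>
      intro hAn
      obtain ⟨i1, i2⟩ := ih (hAn.trans (h.lam_anti n).le)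
      exact ⟨h.lt_tailMean_lam (hf _ (h.lam_pos _))
          (fun z hz => (hb n z hz (hAn.trans hz.1)).1.le) i1,
        h.tailMean_lam_lt (hf _ (h.lam_pos _))
          (fun z hz => (hb n z hz (hAn.trans hz.1)).2.le) i2⟩
  have hx0 : 0 < x := hA.trans_le hAx
  obtain ⟨i1, i2⟩ := knots n (hAx.trans hx.2)
  exact ⟨h.lower_div_lt_tailMean hx0 hx.2 (hf x hx0)
      (fun z hz => (hb n z ⟨hx.1.trans hz.1, hz.2⟩ (hAx.trans hz.1)).1.le) i1,
    h.tailMean_lt_upper_div hx0 hx.2 (hf x hx0)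
      (fun z hz => (hb n z ⟨hx.1.trans hz.1, hz.2⟩ (hAx.trans hz.1)).2.le) i2⟩

end Trapping

end Parameters

end NonlocalTransport

/-! ### Continuous induction, transport along paths, and the far field. -/

namespace NonlocalTransport

open MeasureTheory

/-- Continuous induction on `[0, S]`. -/
theorem forall_mem_Icc_of_continuous_induction {p : ℝ → Prop} {S : ℝ}
    (hclosed : ∀ t ∈ Icc 0 S, (∀ s ∈ Ico 0 t, p s) → p t)
    (hopen : ∀ t ∈ Icc 0 S, p t → ∀ᶠ s in 𝓝[>] t, p s) : ∀ t ∈ Icc 0 S, p t := by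
  by_contra! hcon
  obtain ⟨t₁, ht₁, hpt₁⟩ := hcon
  set B : Set ℝ := {t | t ∈ Icc 0 S ∧ ¬p t} with hB
  have hBne : B.Nonempty := ⟨t₁, ht₁, hpt₁⟩
  have hBb : BddBelow B := ⟨0, fun t ht => ht.1.1⟩
  have hb0 : 0 ≤ sInf B := le_csInf hBne fun t ht => ht.1.1
  have hbS : sInf B ≤ S := (csInf_le hBb ⟨ht₁, hpt₁⟩).trans ht₁.2
  have hbelow : ∀ s ∈ Ico 0 (sInf B), p s := by
    intro s hs
    by_contra hps
    exact absurd (csInf_le hBb (show s ∈ B from ⟨⟨hs.1, hs.2.le.trans hbS⟩, hps⟩)) (not_le.2 hs.2)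
  have hp := hclosed _ ⟨hb0, hbS⟩ hbelow
  obtain ⟨u, hu, hus⟩ := mem_nhdsGT_iff_exists_Ioo_subset.1 (hopen _ ⟨hb0, hbS⟩ hp)
  obtain ⟨t, ht, htu⟩ := exists_lt_of_csInf_lt hBne (mem_Ioi.1 hu)
  rcases eq_or_lt_of_le (csInf_le hBb ht) with he | hlt
  · exact ht.2 (he ▸ hp)
  · exact ht.2 (hus ⟨hlt, htu⟩)

namespace IsFlow

variable {w r : ℝ → ℝ} {T : ℝ} {X ω ρ : ℝ → ℝ → ℝ}

theorem continuousOn_path (h : IsFlow w r T X ω ρ) {a : ℝ} (ha : 0 < a) :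
    ContinuousOn (fun s => X s a) (Ico 0 T) :=
  fun s hs => (h.hasDerivAt_flow s hs a ha).continuousAt.continuousWithinAt

theorem continuousOn_omega_path (h : IsFlow w r T X ω ρ) {a : ℝ} (ha : 0 < a) :
    ContinuousOn (fun s => ω s (X s a)) (Ico 0 T) :=
  fun s hs => (h.hasDerivAt_omega s hs a ha).continuousAt.continuousWithinAt

theorem omega_path_mono (h : IsFlow w r T X ω ρ) (hr : ∀ x, 0 < x → 0 ≤ r x) {a : ℝ} (ha : 0 < a) :
    MonotoneOn (fun s => ω s (X s a)) (Ico 0 T) := by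
  refine monotoneOn_of_hasDerivWithinAt_nonneg (convex_Ico 0 T) (h.continuousOn_omega_path ha)
    (f' := fun s => r a / X s a) (fun s hs => ?_) fun s hs => ?_
  · exact (h.hasDerivAt_omega s (interior_subset hs) a ha).hasDerivWithinAt
  · exact div_nonneg (hr a ha) (h.pos s (interior_subset hs) a ha).le

theorem zero_mem (h : IsFlow w r T X ω ρ) : (0 : ℝ) ∈ Ico 0 T := ⟨le_rfl, h.T_pos⟩

theorem init_le_omega (h : IsFlow w r T X ω ρ) (hr : ∀ x, 0 < x → 0 ≤ r x) {a t : ℝ} (ha : 0 < a)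
    (ht : t ∈ Ico 0 T) : w a ≤ ω t (X t a) := by
  have := h.omega_path_mono hr ha h.zero_mem ht ht.1
  simp only [h.init, h.omega_init a ha] at this
  exact this

theorem omega_nonneg (h : IsFlow w r T X ω ρ) (hw : ∀ x, 0 < x → 0 ≤ w x)
    (hr : ∀ x, 0 < x → 0 ≤ r x) {t x : ℝ} (ht : t ∈ Ico 0 T) (hx : 0 < x) : 0 ≤ ω t x := by
  obtain ⟨a, ha, rfl⟩ := h.surj t ht x hx
  exact (hw a ha).trans (h.init_le_omega hr ha ht)

theorem tailMean_nonneg (h : IsFlow w r T X ω ρ) (hw : ∀ x, 0 < x → 0 ≤ w x)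
    (hr : ∀ x, 0 < x → 0 ≤ r x) {t x : ℝ} (ht : t ∈ Ico 0 T) (hx : 0 < x) :
    0 ≤ tailMean (ω t) x :=
  setIntegral_nonneg measurableSet_Ioi fun _ hy =>
    div_nonneg (h.omega_nonneg hw hr ht (hx.trans hy)) (hx.trans hy).le

theorem hasDerivAt_path (h : IsFlow w r T X ω ρ) {a t : ℝ} (ha : 0 < a) (ht : t ∈ Ico 0 T) :
    HasDerivAt (fun s => X s a) (-(X t a * tailMean (ω t) (X t a))) t := by
  rw [← velocity_eq]
  exact h.hasDerivAt_flow t ht a ha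

theorem path_antitone (h : IsFlow w r T X ω ρ) (hw : ∀ x, 0 < x → 0 ≤ w x)
    (hr : ∀ x, 0 < x → 0 ≤ r x) {a : ℝ} (ha : 0 < a) :
    AntitoneOn (fun s => X s a) (Ico 0 T) := by
  refine antitoneOn_of_hasDerivWithinAt_nonpos (convex_Ico 0 T) (h.continuousOn_path ha)
    (f' := fun s => -(X s a * tailMean (ω s) (X s a))) (fun s hs => ?_) fun s hs => ?_
  · exact (h.hasDerivAt_path ha (interior_subset hs)).hasDerivWithinAt
  · have hs' := interior_subset hs
    have := h.pos s hs' a ha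
    have := h.tailMean_nonneg hw hr hs' this
    simp only [Left.neg_nonpos_iff]
    positivity

theorem path_le (h : IsFlow w r T X ω ρ) (hw : ∀ x, 0 < x → 0 ≤ w x)
    (hr : ∀ x, 0 < x → 0 ≤ r x) {a t : ℝ} (ha : 0 < a) (ht : t ∈ Ico 0 T) : X t a ≤ a := by
  have := h.path_antitone hw hr ha h.zero_mem ht ht.1
  simpa only [h.init] using this

theorem integrableOn (h : IsFlow w r T X ω ρ) {t x : ℝ} (ht : t ∈ Ico 0 T) (hx : 0 < x) :
    IntegrableOn (fun z => ω t z / z) (Ioi x) := by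
  obtain ⟨S, hS1, hS2⟩ := exists_between ht.2
  have hs := (h.solution S (ht.1.trans_lt hS1) hS2).omega_mem
  have htS : t ∈ Icc 0 S := ⟨ht.1, hS1.le⟩
  obtain ⟨a, b, ha, hab⟩ := hs.support
  exact integrableOn_div_Ioi ha (hab t htS)
    (fun y hy => (hs.diff_x t htS y hy).continuousAt.continuousWithinAt) hx

/-- If `w` and `r` vanish to the right of `L`, so does the vorticity. -/
theorem omega_eq_zero (h : IsFlow w r T X ω ρ) (hw : ∀ x, 0 < x → 0 ≤ w x)
    (hr : ∀ x, 0 < x → 0 ≤ r x) {L : ℝ} (hwL : ∀ x, 0 < x → L < x → w x = 0)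
    (hrL : ∀ x, 0 < x → L < x → r x = 0) {t x : ℝ} (ht : t ∈ Ico 0 T) (hx : 0 < x) (hLx : L < x) :
    ω t x = 0 := by
  obtain ⟨a, ha, rfl⟩ := h.surj t ht x hx
  have haL : L < a := hLx.trans_le (h.path_le hw hr ha ht)
  have hcc : Icc 0 t ⊆ Ico 0 T := fun s hs => ⟨hs.1, hs.2.trans_lt ht.2⟩
  have := constant_of_has_deriv_right_zero ((h.continuousOn_omega_path ha).mono hcc)
    (fun s hs => by
      have := h.hasDerivAt_omega s (hcc (Ico_subset_Icc_self hs)) a ha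
      rw [hrL a ha haL, zero_div] at this
      exact this.hasDerivWithinAt) t ⟨ht.1, le_rfl⟩
  simp only [h.init] at this
  rw [this, h.omega_init a ha, hwL a ha haL]

end IsFlow

theorem tailMean_le_log {f : ℝ → ℝ} {c x L : ℝ} (hx : 0 < x) (hxL : x ≤ L)
    (hf : IntegrableOn (fun z => f z / z) (Ioi x)) (hb : ∀ z ∈ Icc x L, f z ≤ c)
    (hL : ∀ z, L < z → f z = 0) : tailMean f x ≤ c * Real.log (L / x) := by
  have h0 : tailMean f L = 0 := by
    rw [tailMean, setIntegral_congr_fun (g := fun _ => (0 : ℝ)) measurableSet_Ioi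
      (fun z hz => by simp only [hL z hz, zero_div])]
    simp
  rw [tailMean_split hf hxL, h0, add_zero, ← integral_one_div_of_pos hx (hx.trans_le hxL),
    ← intervalIntegral.integral_const_mul]
  refine intervalIntegral.integral_mono_on hxL (intervalIntegrable_of_Ioi hf hxL)
    ?_ fun z hz => ?_
  · refine ContinuousOn.intervalIntegrable ?_
    refine continuousOn_const.mul (continuousOn_const.div continuousOn_id fun z hz => ?_)
    rw [uIcc_of_le hxL] at hz
    exact (hx.trans_le hz.1).ne'
  · have := hx.trans_le hz.1
    rw [mul_one_div]
    gcongr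
    exact hb z hz

theorem log_le_tailMean {f : ℝ → ℝ} {c x y : ℝ} (hx : 0 < x) (hxy : x ≤ y)
    (hf : IntegrableOn (fun z => f z / z) (Ioi x)) (hb : ∀ z ∈ Icc x y, c ≤ f z)
    (hy : 0 ≤ tailMean f y) : c * Real.log (y / x) ≤ tailMean f x := by
  have h1 : c * Real.log (y / x) ≤ ∫ z in x..y, f z / z := by
    rw [← integral_one_div_of_pos hx (hx.trans_le hxy), ← intervalIntegral.integral_const_mul]
    refine intervalIntegral.integral_mono_on hxy ?_ (intervalIntegrable_of_Ioi hf hxy)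
      fun z hz => ?_
    · refine ContinuousOn.intervalIntegrable ?_
      refine continuousOn_const.mul (continuousOn_const.div continuousOn_id fun z hz => ?_)
      rw [uIcc_of_le hxy] at hz
      exact (hx.trans_le hz.1).ne'
    · have := hx.trans_le hz.1
      rw [mul_one_div]
      gcongr
      exact hb z hz
  rw [tailMean_split hf hxy]
  linarith

/-- A flow whose data are suitably prepared, and a time scale `τ` on which the far field does not
change much. -/
structure PreparedFlow (P : Parameters) (φ ψ δ R A₀ τ K : ℝ) (w r : ℝ → ℝ) (T : ℝ)
    (X ω ρ : ℝ → ℝ → ℝ) : Prop where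
  trapping : P.Trapping φ ψ
  flow : IsFlow w r T X ω ρ
  prepared : SuitablyPrepared P δ R A₀ w r
  one_le_R : 1 ≤ R
  source_small : τ * R / P.lam 0 ≤ δ
  speed : P.upper 0 (P.lam 0) * Real.log ((P.lamNegTwo + δ) / P.lam 0) < K
  gap_upper : Real.log ((P.lamNegTwo + δ) / P.lam 0) < 1 / P.p 1
  gap_lower : 1 / P.q 1 < Real.log (P.lamNegOne / P.lam 0) - K * τ

namespace PreparedFlow

variable {P : Parameters} {φ ψ δ R A₀ τ K : ℝ} {w r : ℝ → ℝ} {T : ℝ} {X ω ρ : ℝ → ℝ → ℝ}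

section FarField

variable (h : PreparedFlow P φ ψ δ R A₀ τ K w r T X ω ρ)
include h

theorem integrableOn {t x : ℝ} (ht : t ∈ Ico 0 T) (hx : 0 < x) :
    IntegrableOn (fun z => ω t z / z) (Ioi x) := h.flow.integrableOn ht hx

theorem lam_lt_edge : P.lam 0 < P.lamNegTwo + δ := by
  linarith [h.trapping.lam_zero_lt, h.trapping.lamNegOne_lt, h.prepared.δ_pos]

theorem eq_zero_right {x : ℝ} (hx : 0 < x) (hLx : P.lamNegTwo + δ < x) : w x = 0 ∧ r x = 0 := by
  obtain ⟨ε, _, _, hs⟩ := h.prepared.support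
  exact hs x hx fun hc => absurd hc.2 (not_le.2 hLx)

theorem omega_eq_zero {t x : ℝ} (ht : t ∈ Ico 0 T) (hLx : P.lamNegTwo + δ < x) : ω t x = 0 :=
  h.flow.omega_eq_zero h.prepared.omega_nonneg h.prepared.rho_nonneg
    (fun _ hx hL => (h.eq_zero_right hx hL).1) (fun _ hx hL => (h.eq_zero_right hx hL).2) ht
    ((h.trapping.lam_pos 0).trans (h.lam_lt_edge.trans hLx)) hLx

theorem path_le_path {a s t : ℝ} (ha : 0 < a) (hs : 0 ≤ s) (hst : s ≤ t) (ht : t < T) :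
    X t a ≤ X s a :=
  h.flow.path_antitone h.prepared.omega_nonneg h.prepared.rho_nonneg ha ⟨hs, hst.trans_lt ht⟩
    ⟨hs.trans hst, ht⟩ hst

theorem path_le {a t : ℝ} (ha : 0 < a) (ht : t ∈ Ico 0 T) : X t a ≤ a :=
  h.flow.path_le h.prepared.omega_nonneg h.prepared.rho_nonneg ha ht

theorem source_le {a : ℝ} (ha : P.lam 0 ≤ a) : r a ≤ R := by
  rcases le_total a P.lamNegTwo with h1 | h1
  · rw [h.prepared.rho_eq_one a ⟨h.prepared.A₀_lt.le.trans ha, h1⟩]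
    exact h.one_le_R
  · exact h.prepared.rho_le a h1

/-- While a particle is to the right of `λ_0` its vorticity grows at rate at most `R / λ_0`. Up to
time `τ` it therefore gains no more than the margin `δ` reserved in the data. -/
theorem omega_lt_far {t x : ℝ} (ht : t ∈ Ico 0 T) (hτ : t ≤ τ) (hx : P.lam 0 ≤ x) :
    ω t x < P.upper 0 (P.lam 0) := by
  have hl0 := h.trapping.lam_pos 0
  obtain ⟨a, ha, rfl⟩ := h.flow.surj t ht x (hl0.trans_le hx)
  have hxa := h.path_le ha ht
  have haL : P.lam 0 ≤ a := hx.trans hxa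
  rcases le_or_gt a (P.lamNegTwo + δ) with haE | haE
  · have hcc : Icc 0 t ⊆ Ico 0 T := fun s hs => ⟨hs.1, hs.2.trans_lt ht.2⟩
    have hb := image_le_of_deriv_right_le_deriv_boundary (f := fun s => ω s (X s a))
      (f' := fun s => r a / X s a) (B := fun s => w a + R / P.lam 0 * s)
      (B' := fun _ => R / P.lam 0) (a := 0) (b := t)
      ((h.flow.continuousOn_omega_path ha).mono hcc)
      (fun s hs => (h.flow.hasDerivAt_omega s (hcc (Ico_subset_Icc_self hs)) a ha).hasDerivWithinAt)
      (by simp only [h.flow.init, h.flow.omega_init a ha, mul_zero, add_zero, le_refl])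
      (by fun_prop)
      (fun s _ => by
        have := ((hasDerivAt_id s).const_mul (R / P.lam 0)).const_add (w a)
        simpa using this.hasDerivWithinAt)
      (fun s hs => by
        have h1 := h.path_le_path ha hs.1 hs.2.le ht.2
        exact div_le_div₀ (zero_le_one.trans h.one_le_R) (h.source_le haL) hl0 (hx.trans h1))
      (x := t) ⟨ht.1, le_rfl⟩
    have h2 := h.prepared.upper a ⟨haL, haE⟩
    have h3 : R / P.lam 0 * t ≤ δ := by
      refine le_trans ?_ h.source_small
      have := h.one_le_R
      rw [div_mul_eq_mul_div, mul_comm R t]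
      gcongr
    change _ < P.ψ 1 * P.lam 0 ^ (-P.q 1)
    linarith
  · have hz : ω t (X t a) = 0 := by
      have hcc : Icc 0 t ⊆ Ico 0 T := fun s hs => ⟨hs.1, hs.2.trans_lt ht.2⟩
      have := constant_of_has_deriv_right_zero ((h.flow.continuousOn_omega_path ha).mono hcc)
        (fun s hs => by
          have := h.flow.hasDerivAt_omega s (hcc (Ico_subset_Icc_self hs)) a ha
          rw [(h.eq_zero_right ha haE).2, zero_div] at this
          exact this.hasDerivWithinAt) t ⟨ht.1, le_rfl⟩
      simp only [h.flow.init] at this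
      rw [this, h.flow.omega_init a ha, (h.eq_zero_right ha haE).1]
    rw [hz]
    exact h.trapping.upper_pos 0 hl0

theorem tailMean_far_le {t x : ℝ} (ht : t ∈ Ico 0 T) (hτ : t ≤ τ) (hx : P.lam 0 ≤ x) :
    tailMean (ω t) x ≤ P.upper 0 (P.lam 0) * Real.log ((P.lamNegTwo + δ) / P.lam 0) := by
  have hl0 := h.trapping.lam_pos 0
  have h1 : tailMean (ω t) (P.lam 0) ≤
      P.upper 0 (P.lam 0) * Real.log ((P.lamNegTwo + δ) / P.lam 0) :=
    tailMean_le_log hl0 h.lam_lt_edge.le (h.integrableOn ht hl0)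
      (fun z hz => (h.omega_lt_far ht hτ hz.1).le) fun z hz => h.omega_eq_zero ht hz
  have h2 : 0 ≤ ∫ z in P.lam 0..x, ω t z / z :=
    intervalIntegral.integral_nonneg hx fun z hz => div_nonneg
      (h.flow.omega_nonneg h.prepared.omega_nonneg h.prepared.rho_nonneg ht (hl0.trans_le hz.1))
      (hl0.trans_le hz.1).le
  rw [tailMean_split (h.integrableOn ht hl0) hx] at h1
  linarith

/-- The tail mean is the speed of `-log X`. This keeps the particle from `λ_{-1}`, and with it the
region of vorticity above `φ_1 λ_0^{-p_1}`, to the right of `λ_0` up to time `τ`. -/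
theorem log_path_le {t : ℝ} (ht : t ∈ Ico 0 T) (hτ : t ≤ τ) :
    Real.log P.lamNegOne - K * t ≤ Real.log (X t P.lamNegOne) := by
  have hl0 := h.trapping.lam_pos 0
  have hm : 0 < P.lamNegOne := hl0.trans h.trapping.lam_zero_lt
  have hcc : Icc 0 t ⊆ Ico 0 T := fun s hs => ⟨hs.1, hs.2.trans_lt ht.2⟩
  have hK : 0 < K := by
    refine lt_trans ?_ h.speed
    exact mul_pos (h.trapping.upper_pos 0 hl0)
      (Real.log_pos ((one_lt_div hl0).2 h.lam_lt_edge))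
  have hd : ∀ s ∈ Ico 0 T, HasDerivAt (fun s => -Real.log (X s P.lamNegOne))
      (tailMean (ω s) (X s P.lamNegOne)) s := by
    intro s hs
    have hp := h.flow.pos s hs _ hm
    refine ((h.flow.hasDerivAt_path hm hs).log hp.ne').fun_neg.congr_deriv ?_
    field_simp
  have hb := image_le_of_deriv_right_lt_deriv_boundary
    (f := fun s => -Real.log (X s P.lamNegOne))
    (f' := fun s => tailMean (ω s) (X s P.lamNegOne))
    (B := fun s => K * s - Real.log P.lamNegOne) (B' := fun _ => K) (a := 0) (b := t)
    (fun s hs => (hd s (hcc hs)).continuousAt.continuousWithinAt)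
    (fun s hs => (hd s (hcc (Ico_subset_Icc_self hs))).hasDerivWithinAt)
    (by simp [h.flow.init])
    (fun s => by simpa using ((hasDerivAt_id s).const_mul K).sub_const (Real.log P.lamNegOne))
    -- The bound for the speed requires `X ≥ λ_0`. The comparison only asks for it at times of
    -- equality `he`, where `gap_lower` supplies it.
    (fun s hs he => by
      refine (h.tailMean_far_le (hcc (Ico_subset_Icc_self hs)) (hs.2.le.trans hτ) ?_).trans_lt
        h.speed
      have hp := h.flow.pos s (hcc (Ico_subset_Icc_self hs)) _ hm
      rw [← Real.log_le_log_iff hl0 hp]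
      have hg := h.gap_lower
      rw [Real.log_div hm.ne' hl0.ne'] at hg
      have hq : 0 < 1 / P.q 1 := one_div_pos.2 (h.trapping.q_succ_pos 0)
      have : K * s ≤ K * τ := mul_le_mul_of_nonneg_left (hs.2.le.trans hτ) hK.le
      linarith)
    (x := t) ⟨ht.1, le_rfl⟩
  linarith

theorem speed_pos : 0 < K := by
  have hl0 := h.trapping.lam_pos 0
  exact (mul_pos (h.trapping.upper_pos 0 hl0)
    (Real.log_pos ((one_lt_div hl0).2 h.lam_lt_edge))).trans h.speed

theorem one_div_q_lt_log {t : ℝ} (ht : t ∈ Ico 0 T) (hτ : t ≤ τ) :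
    1 / P.q 1 < Real.log (X t P.lamNegOne / P.lam 0) := by
  have hl0 := h.trapping.lam_pos 0
  have hm : 0 < P.lamNegOne := hl0.trans h.trapping.lam_zero_lt
  have h1 := h.log_path_le ht hτ
  have hg := h.gap_lower
  have hp := h.flow.pos t ht _ hm
  rw [Real.log_div hm.ne' hl0.ne'] at hg
  rw [Real.log_div hp.ne' hl0.ne']
  have : K * t ≤ K * τ := mul_le_mul_of_nonneg_left hτ h.speed_pos.le
  linarith

theorem lam_lt_path {t : ℝ} (ht : t ∈ Ico 0 T) (hτ : t ≤ τ) : P.lam 0 < X t P.lamNegOne := by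
  have hl0 := h.trapping.lam_pos 0
  have hm : 0 < P.lamNegOne := hl0.trans h.trapping.lam_zero_lt
  have hq : 0 < 1 / P.q 1 := one_div_pos.2 (h.trapping.q_succ_pos 0)
  have h1 := hq.trans (h.one_div_q_lt_log ht hτ)
  have h2 := (Real.log_pos_iff (div_pos (h.flow.pos t ht _ hm) hl0).le).1 h1
  exact (one_lt_div hl0).1 h2

theorem lt_omega_far {t x : ℝ} (ht : t ∈ Ico 0 T) (hx : P.lam 0 ≤ x) (hx' : x ≤ X t P.lamNegOne) :
    P.lower 0 (P.lam 0) < ω t x := by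
  have hl0 := h.trapping.lam_pos 0
  obtain ⟨a, ha, rfl⟩ := h.flow.surj t ht x (hl0.trans_le hx)
  have haL : P.lam 0 ≤ a := hx.trans (h.path_le ha ht)
  have haM : a ≤ P.lamNegOne := (h.flow.strictMono t ht).le_iff_le.1 hx'
  exact (h.prepared.lower a ⟨haL, haM⟩).trans_le
    (h.flow.init_le_omega h.prepared.rho_nonneg ha ht)

/-- Nearly constant bounds on the far field integrate to logarithms; the gaps between the largest
scales are chosen so that these logarithms lie on the right sides of `1 / q_1` and `1 / p_1`. This
starts the induction over scales. -/
theorem tailMean_lam_zero {t : ℝ} (ht : t ∈ Ico 0 T) (hτ : t ≤ τ) :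
    P.lower 0 (P.lam 0) / P.q 1 < tailMean (ω t) (P.lam 0) ∧
      tailMean (ω t) (P.lam 0) < P.upper 0 (P.lam 0) / P.p 1 := by
  have hl0 := h.trapping.lam_pos 0
  constructor
  · have hX := h.lam_lt_path ht hτ
    have h1 := log_le_tailMean hl0 hX.le (h.integrableOn ht hl0)
      (fun z hz => (h.lt_omega_far ht hz.1 hz.2).le)
      (h.flow.tailMean_nonneg h.prepared.omega_nonneg h.prepared.rho_nonneg ht (hl0.trans hX))
    refine lt_of_lt_of_le ?_ h1
    rw [div_eq_mul_one_div]
    exact mul_lt_mul_of_pos_left (h.one_div_q_lt_log ht hτ) (h.trapping.lower_pos 0 hl0)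
  · refine (h.tailMean_far_le ht hτ le_rfl).trans_lt ?_
    rw [div_eq_mul_one_div (P.upper 0 (P.lam 0))]
    exact mul_lt_mul_of_pos_left h.gap_upper (h.trapping.upper_pos 0 hl0)

end FarField

end PreparedFlow

end NonlocalTransport

/-! ### Trapping between the barriers and the collapse of the particle. -/

namespace NonlocalTransport

open MeasureTheory

namespace PreparedFlow

variable {P : Parameters} {φ ψ δ R A₀ τ K : ℝ} {w r : ℝ → ℝ} {T : ℝ} {X ω ρ : ℝ → ℝ → ℝ}

section Barrier

variable (h : PreparedFlow P φ ψ δ R A₀ τ K w r T X ω ρ)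
include h

theorem label_lt {t a : ℝ} (ht : t ∈ Ico 0 T) (hτ : t ≤ τ) (hX : X t a ≤ P.lam 0) :
    a < P.lamNegOne :=
  (h.flow.strictMono t ht).lt_iff_lt.1 (hX.trans_lt (h.lam_lt_path ht hτ))

/-- A path which is between the barriers when it enters an interval stays between them as long as
all the vorticity to its right is between the barriers. -/
theorem path_between {a s₀ t : ℝ} {n : ℕ} (ha : A₀ ≤ a) (hs₀ : 0 ≤ s₀) (hst : s₀ ≤ t)
    (ht : t < T) (hτ : t ≤ τ) (hb : ∀ s ∈ Ico 0 t, P.Between (X s A₀) (ω s))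
    (hle : X s₀ a ≤ P.lam n) (hge : P.lam (n + 1) ≤ X t a)
    (hlow : P.lower n (X s₀ a) < ω s₀ (X s₀ a)) (hup : ω s₀ (X s₀ a) < P.upper n (X s₀ a)) :
    P.lower n (X t a) < ω t (X t a) ∧ ω t (X t a) < P.upper n (X t a) := by
  have hA₀ := h.prepared.A₀_pos
  have ha0 : 0 < a := hA₀.trans_le ha
  have hcc : Icc s₀ t ⊆ Ico 0 T := fun s hs => ⟨hs₀.trans hs.1, hs.2.trans_lt ht⟩
  have hcX : ContinuousOn (fun s => X s a) (Icc s₀ t) := (h.flow.continuousOn_path ha0).mono hcc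
  have hcω : ContinuousOn (fun s => ω s (X s a)) (Icc s₀ t) :=
    (h.flow.continuousOn_omega_path ha0).mono hcc
  have hpos : ∀ s ∈ Icc s₀ t, 0 < X s a := fun s hs => h.flow.pos s (hcc hs) a ha0
  have hpow : ∀ e : ℝ, ContinuousOn (fun s => X s a ^ e) (Icc s₀ t) := fun e =>
    hcX.rpow_const fun s hs => Or.inl (hpos s hs).ne'
  -- A particle in `(0, λ_0]` by time `τ` started to the left of `λ_{-1}`; being also to the right
  -- of `A₀`, it carries density `1`.
  have hr : r a = 1 := by
    refine h.prepared.rho_eq_one a ⟨ha, ?_⟩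
    have h1 : X s₀ a ≤ P.lam 0 := hle.trans (h.trapping.lam_antitone (Nat.zero_le n))
    exact ((h.label_lt (hcc ⟨le_rfl, hst⟩) (hst.trans hτ) h1).trans
      h.trapping.lamNegOne_lt).le
  have hdω : ∀ s ∈ Ioo s₀ t, HasDerivAt (fun s => ω s (X s a)) (1 / X s a) s := by
    intro s hs
    rw [← hr]
    exact h.flow.hasDerivAt_omega s (hcc (Ioo_subset_Icc_self hs)) a ha0
  have hdpow : ∀ c e : ℝ, ∀ s ∈ Ioo s₀ t, HasDerivAt (fun s => c * X s a ^ (-e))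
      (e * (c * X s a ^ (-e)) * tailMean (ω s) (X s a)) s := by
    intro c e s hs
    have hs' := Ioo_subset_Icc_self hs
    have hX := hpos s hs'
    refine (((h.flow.hasDerivAt_path ha0 (hcc hs')).rpow_const (p := -e)
      (Or.inl hX.ne')).const_mul c).congr_deriv ?_
    rw [Real.rpow_sub_one hX.ne']
    field_simp
  -- Only times strictly before `t` are used. Continuity extends the monotonicity below to `[s₀,
  -- t]`, which gives the conclusion at time `t` itself.
  have hI : ∀ s ∈ Ioo s₀ t, P.lower n (X s a) / P.q (n + 1) < tailMean (ω s) (X s a) ∧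
      tailMean (ω s) (X s a) < P.upper n (X s a) / P.p (n + 1) := by
    intro s hs
    have hs' := Ioo_subset_Icc_self hs
    have hsI := hcc hs'
    obtain ⟨i1, i2⟩ := h.tailMean_lam_zero hsI (hs.2.le.trans hτ)
    refine h.trapping.tailMean_bounds (h.flow.pos s hsI A₀ hA₀)
      (fun x hx => h.integrableOn hsI hx) (hb s ⟨hsI.1, hs.2⟩) i1 i2 n ⟨?_, ?_⟩ ?_
    · exact hge.trans (h.path_le_path ha0 hsI.1 hs.2.le ht)
    · exact (h.path_le_path ha0 hs₀ hs.1.le hsI.2).trans hle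
    · exact (h.flow.strictMono s hsI).monotone ha
  have hp := h.trapping.p_succ_pos n
  have hq := h.trapping.q_succ_pos n
  constructor
  · have hmono : MonotoneOn (fun s => ω s (X s a) - P.φ (n + 1) * X s a ^ (-P.p (n + 1)))
        (Icc s₀ t) := by
      refine monotoneOn_of_hasDerivWithinAt_nonneg (convex_Icc s₀ t)
        (hcω.sub (continuousOn_const.mul (hpow _)))
        (f' := fun s => 1 / X s a - P.p (n + 1) * (P.φ (n + 1) * X s a ^ (-P.p (n + 1))) *
          tailMean (ω s) (X s a)) (fun s hs => ?_) fun s hs => ?_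
      all_goals rw [interior_Icc] at hs
      · exact ((hdω s hs).sub (hdpow _ _ s hs)).hasDerivWithinAt
      · have hX := hpos s (Ioo_subset_Icc_self hs)
        have hl := h.trapping.lower_pos n hX
        -- With `1 / X = lower * upper`, the derivative is `lower * (upper - p * tailMean)`, and the
        -- bound on the tail mean gives its sign.
        rw [sub_nonneg, ← h.trapping.lower_mul_upper n hX]
        have h2 := (hI s hs).2
        rw [lt_div_iff₀ hp] at h2
        have h3 := mul_le_mul_of_nonneg_left h2.le hl.le
        simp only [Parameters.lower, Parameters.upper] at h3 ⊢
        linarith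
    have := hmono (left_mem_Icc.2 hst) (right_mem_Icc.2 hst) hst
    simp only [Parameters.lower] at this hlow ⊢
    linarith
  · have hmono : AntitoneOn (fun s => ω s (X s a) - P.ψ (n + 1) * X s a ^ (-P.q (n + 1)))
        (Icc s₀ t) := by
      refine antitoneOn_of_hasDerivWithinAt_nonpos (convex_Icc s₀ t)
        (hcω.sub (continuousOn_const.mul (hpow _)))
        (f' := fun s => 1 / X s a - P.q (n + 1) * (P.ψ (n + 1) * X s a ^ (-P.q (n + 1))) *
          tailMean (ω s) (X s a)) (fun s hs => ?_) fun s hs => ?_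
      all_goals rw [interior_Icc] at hs
      · exact ((hdω s hs).sub (hdpow _ _ s hs)).hasDerivWithinAt
      · have hX := hpos s (Ioo_subset_Icc_self hs)
        have hl := h.trapping.upper_pos n hX
        rw [sub_nonpos, ← h.trapping.lower_mul_upper n hX]
        have h2 := (hI s hs).1
        rw [div_lt_iff₀ hq] at h2
        have h3 := mul_le_mul_of_nonneg_left h2.le hl.le
        simp only [Parameters.lower, Parameters.upper] at h3 ⊢
        linarith
    have := hmono (left_mem_Icc.2 hst) (right_mem_Icc.2 hst) hst
    simp only [Parameters.upper] at this hup ⊢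
    linarith

/-- A particle in `[λ_{n+1}, λ_n]` either started there, where the data are between the barriers, or
entered through `λ_n` at some earlier time. In the latter case the relay conditions pass on the
bounds of the previous interval. -/
theorem between_closed {t : ℝ} (ht : t ∈ Ico 0 T) (hτ : t ≤ τ)
    (hb : ∀ s ∈ Ico 0 t, P.Between (X s A₀) (ω s)) : P.Between (X t A₀) (ω t) := by
  have hcc : Icc 0 t ⊆ Ico 0 T := fun s hs => ⟨hs.1, hs.2.trans_lt ht.2⟩
  have step : ∀ n, (∀ s ∈ Icc 0 t, X s A₀ ≤ P.lam n →
      P.lower n (P.lam n) < ω s (P.lam n) ∧ ω s (P.lam n) < P.upper n (P.lam n)) →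
      ∀ x ∈ Icc (P.lam (n + 1)) (P.lam n), X t A₀ ≤ x →
        P.lower n x < ω t x ∧ ω t x < P.upper n x := by
    intro n hentry x hx hAx
    obtain ⟨a, ha, rfl⟩ := h.flow.surj t ht x ((h.trapping.lam_pos _).trans_le hx.1)
    have haA : A₀ ≤ a := (h.flow.strictMono t ht).le_iff_le.1 hAx
    rcases le_or_gt a (P.lam n) with hal | hal
    · have hw := h.prepared.barrier n a ⟨hx.1.trans (h.path_le ha ht), hal⟩ haA
      rw [← h.flow.omega_init a ha] at hw
      refine h.path_between haA le_rfl ht.1 ht.2 hτ hb ?_ hx.1 ?_ ?_ <;> rw [h.flow.init]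
      exacts [hal, hw.1, hw.2]
    · obtain ⟨s₀, hs₀, he⟩ := intermediate_value_Icc' ht.1
        ((h.flow.continuousOn_path ha).mono hcc)
        (show P.lam n ∈ Icc (X t a) (X 0 a) from ⟨hx.2, by rw [h.flow.init]; exact hal.le⟩)
      simp only at he
      have hk := hentry s₀ hs₀ (he ▸ (h.flow.strictMono s₀ (hcc hs₀)).monotone haA)
      refine h.path_between haA hs₀.1 hs₀.2 ht.2 hτ hb he.le hx.1 ?_ ?_ <;> rw [he]
      exacts [hk.1, hk.2]
  intro n
  induction n with
  -- Particles crossing `λ_0` come from the far field.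
  | zero =>
    refine step 0 fun s hs _ => ⟨?_, ?_⟩
    · exact h.lt_omega_far (hcc hs) le_rfl (h.lam_lt_path (hcc hs) (hs.2.trans hτ)).le
    · exact h.omega_lt_far (hcc hs) (hs.2.trans hτ) le_rfl
  | succ n ih =>
    refine step (n + 1) fun s hs hAs => ?_
    have hmem : P.lam (n + 1) ∈ Icc (P.lam (n + 1)) (P.lam n) :=
      ⟨le_rfl, (h.trapping.lam_anti n).le⟩
    have hk : P.lower n (P.lam (n + 1)) < ω s (P.lam (n + 1)) ∧
        ω s (P.lam (n + 1)) < P.upper n (P.lam (n + 1)) := by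
      -- Entry at the final time is not covered by `hb`, but by the induction over scales.
      rcases eq_or_lt_of_le hs.2 with rfl | hlt
      · exact ih _ hmem hAs
      · exact hb s ⟨hs.1, hlt⟩ n _ hmem hAs
    exact ⟨(h.trapping.lower_relay n).trans_lt hk.1, hk.2.trans_le (h.trapping.upper_relay n)⟩

/-- The inequalities are strict and the relevant labels form the compact set `[A₀, λ_{-1}]`. Near
each label the position is bounded away from `0`, so only finitely many scales matter there. -/
theorem between_open {t : ℝ} (ht : t ∈ Ico 0 T) (hτ : t < τ) (hb : P.Between (X t A₀) (ω t)) :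
    ∀ᶠ s in 𝓝[>] t, P.Between (X s A₀) (ω s) := by
  have hA₀ := h.prepared.A₀_pos
  -- Freezing time below `0` gives functions continuous on full neighbourhoods, also at `t = 0`.
  set Y : ℝ × ℝ → ℝ := fun z => X (max z.1 0) z.2 with hY
  set W : ℝ × ℝ → ℝ := fun z => ω (max z.1 0) (Y z) with hW
  have key : ∀ a ∈ Icc A₀ P.lamNegOne, ∀ᶠ z : ℝ × ℝ in 𝓝 (t, a),
      ∀ n, Y z ∈ Icc (P.lam (n + 1)) (P.lam n) →
        P.lower n (Y z) < W z ∧ W z < P.upper n (Y z) := by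
    intro a ha
    have ha0 : 0 < a := hA₀.trans_le ha.1
    have hmax : max t 0 = t := max_eq_left ht.1
    have hYt : Y (t, a) = X t a := by simp only [hY, hmax]
    have hWt : W (t, a) = ω t (X t a) := by simp only [hW, hY, hmax]
    have hUo : IsOpen {z : ℝ × ℝ | z.1 < T} := isOpen_lt continuous_fst continuous_const
    have hm : MapsTo (fun z : ℝ × ℝ => (max z.1 0, z.2)) {z : ℝ × ℝ | z.1 < T}
        (Ico 0 T ×ˢ univ) := fun z hz => ⟨⟨le_max_right _ _, max_lt hz h.flow.T_pos⟩, mem_univ _⟩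
    have cY' : ContinuousOn Y {z : ℝ × ℝ | z.1 < T} :=
      h.flow.continuousOn_flow.comp (by fun_prop) hm
    have hm' : MapsTo (fun z : ℝ × ℝ => (max z.1 0, Y z)) {z : ℝ × ℝ | z.1 < T}
        (Ico 0 T ×ˢ univ) := fun z hz => ⟨⟨le_max_right _ _, max_lt hz h.flow.T_pos⟩, mem_univ _⟩
    have cW' : ContinuousOn W {z : ℝ × ℝ | z.1 < T} :=
      h.flow.continuousOn_omega.comp (ContinuousOn.prodMk (by fun_prop) cY') hm'
    have cY : ContinuousAt Y (t, a) := cY'.continuousAt (hUo.mem_nhds ht.2)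
    have cW : ContinuousAt W (t, a) := cW'.continuousAt (hUo.mem_nhds ht.2)
    have hX0 : 0 < Y (t, a) := by rw [hYt]; exact h.flow.pos t ht a ha0
    have cpow : ∀ c e : ℝ, ContinuousAt (fun z => c * Y z ^ e) (t, a) := fun c e =>
      continuousAt_const.mul (cY.rpow_const (Or.inl hX0.ne'))
    obtain ⟨N, hN⟩ := (h.trapping.lam_tendsto.eventually (gt_mem_nhds hX0)).exists
    have hsmall : ∀ᶠ z in 𝓝 (t, a), ∀ n ∈ Finset.range N,
        Y z ∈ Icc (P.lam (n + 1)) (P.lam n) →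
          P.lower n (Y z) < W z ∧ W z < P.upper n (Y z) := by
      rw [Filter.eventually_all_finset]
      intro n _
      by_cases hmem : Y (t, a) ∈ Icc (P.lam (n + 1)) (P.lam n)
      · have hbn := hb n (Y (t, a)) hmem
          (by rw [hYt]; exact (h.flow.strictMono t ht).monotone ha.1)
        rw [hYt, ← hWt, ← hYt] at hbn
        filter_upwards [(cpow (P.φ (n + 1)) (-P.p (n + 1))).eventually_lt cW hbn.1,
          cW.eventually_lt (cpow (P.ψ (n + 1)) (-P.q (n + 1))) hbn.2] with z h1 h2 _
        exact ⟨h1, h2⟩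
      · filter_upwards [cY.eventually (isClosed_Icc.isOpen_compl.mem_nhds hmem)] with z hz hz'
        exact absurd hz' hz
    filter_upwards [hsmall, cY.eventually (lt_mem_nhds hN)] with z hz hzN n hn
    refine hz n (Finset.mem_range.2 ?_) hn
    by_contra! hNn
    exact absurd (hn.2.trans (h.trapping.lam_antitone hNn)) (not_le.2 hzN)
  have hev := isCompact_Icc.eventually_forall_of_forall_eventually
    (P := fun s a => ∀ n, Y (s, a) ∈ Icc (P.lam (n + 1)) (P.lam n) →
        P.lower n (Y (s, a)) < W (s, a) ∧ W (s, a) < P.upper n (Y (s, a))) key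
  filter_upwards [nhdsWithin_le_nhds hev, self_mem_nhdsWithin,
    nhdsWithin_le_nhds (Iio_mem_nhds ht.2), nhdsWithin_le_nhds (Iio_mem_nhds hτ)]
    with s hs hts hsT hsτ n x hx hAx
  have hs0 : 0 ≤ s := ht.1.trans (le_of_lt hts)
  have hsI : s ∈ Ico 0 T := ⟨hs0, hsT⟩
  obtain ⟨a, ha, rfl⟩ := h.flow.surj s hsI x ((h.trapping.lam_pos _).trans_le hx.1)
  have haA : A₀ ≤ a := (h.flow.strictMono s hsI).le_iff_le.1 hAx
  have haM := h.label_lt hsI (le_of_lt hsτ)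
    (hx.2.trans (h.trapping.lam_antitone (Nat.zero_le n)))
  have := hs a ⟨haA, haM.le⟩ n
  simp only [hW, hY, max_eq_left hs0] at this
  exact this hx

theorem between {t : ℝ} (ht : t ∈ Ico 0 T) (hτ : t ≤ τ) : P.Between (X t A₀) (ω t) := by
  -- The opening step needs time strictly below `τ`; the end point `t = τ` is reached by closedness
  -- alone.
  rcases eq_or_lt_of_le hτ with rfl | hlt
  · rcases eq_or_lt_of_le ht.1 with rfl | h0
    · exact h.between_closed ht le_rfl fun s hs => absurd hs.2 (not_lt.2 hs.1)
    · refine h.between_closed ht le_rfl fun s hs => ?_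
      refine forall_mem_Icc_of_continuous_induction
        (p := fun s => P.Between (X s A₀) (ω s)) (S := s) (fun u hu hb => ?_)
        (fun u hu hb => ?_) s ⟨hs.1, le_rfl⟩
      · exact h.between_closed ⟨hu.1, (hu.2.trans_lt hs.2).trans ht.2⟩ (hu.2.trans hs.2.le) hb
      · exact h.between_open ⟨hu.1, (hu.2.trans_lt hs.2).trans ht.2⟩ (hu.2.trans_lt hs.2) hb
  · refine forall_mem_Icc_of_continuous_induction
        (p := fun s => P.Between (X s A₀) (ω s)) (S := t) (fun u hu hb => ?_)
        (fun u hu hb => ?_) t ⟨ht.1, le_rfl⟩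
    · exact h.between_closed ⟨hu.1, hu.2.trans_lt ht.2⟩ (hu.2.trans hτ) hb
    · exact h.between_open ⟨hu.1, hu.2.trans_lt ht.2⟩ (hu.2.trans_lt hlt) hb

theorem profile {t x : ℝ} (ht : t ∈ Ico 0 T) (hτ : t ≤ τ) (hx : x ∈ Icc (X t A₀) (P.lam 0)) :
    φ * x ^ (-(1 / 2) : ℝ) ≤ ω t x ∧ ω t x ≤ ψ * x ^ (-(1 / 2) : ℝ) := by
  have hx0 : 0 < x := (h.flow.pos t ht A₀ h.prepared.A₀_pos).trans_le hx.1
  obtain ⟨n, hn⟩ := h.trapping.exists_mem_Icc hx0 hx.2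
  obtain ⟨h1, h2⟩ := h.between ht hτ n x hn hx.1
  exact ⟨(h.trapping.le_lower n x hn).trans h1.le, h2.le.trans (h.trapping.upper_le n x hn)⟩

/-- The particle which starts at `A₀` moves to the origin at least at a constant speed in the
variable `√A`. -/
theorem sqrt_path_le (hA : A₀ ≤ P.lam 0 / 4) {t : ℝ} (ht : t ∈ Ico 0 T) (hτ : t ≤ τ) :
    √(X t A₀) ≤ √A₀ - φ / 2 * t := by
  have hA₀ := h.prepared.A₀_pos
  have hφ := h.trapping.profile_phi_pos
  have hl0 := h.trapping.lam_pos 0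
  have hcc : Icc 0 t ⊆ Ico 0 T := fun s hs => ⟨hs.1, hs.2.trans_lt ht.2⟩
  have hd : ∀ s ∈ Icc 0 t, HasDerivAt (fun s => √(X s A₀))
      (-(X s A₀ * tailMean (ω s) (X s A₀)) / (2 * √(X s A₀))) s := fun s hs =>
    (h.flow.hasDerivAt_path hA₀ (hcc hs)).sqrt (h.flow.pos s (hcc hs) A₀ hA₀).ne'
  have hbound : ∀ s ∈ Icc 0 t,
      -(X s A₀ * tailMean (ω s) (X s A₀)) / (2 * √(X s A₀)) ≤ -(φ / 2) := by
    intro s hs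
    have hX := h.flow.pos s (hcc hs) A₀ hA₀
    have hXA : X s A₀ ≤ P.lam 0 / 4 := (h.path_le hA₀ (hcc hs)).trans hA
    have hXl : X s A₀ ≤ P.lam 0 := by linarith
    have h1 := le_tailMean (f := ω s) (c := φ) (s := 1 / 2) hX hXl (by norm_num)
      (h.integrableOn (hcc hs) hX) fun z hz => (h.profile (hcc hs) (hs.2.trans hτ) hz).1
    have h2 := h.flow.tailMean_nonneg h.prepared.omega_nonneg h.prepared.rho_nonneg (hcc hs) hl0
    have e : ∀ {y : ℝ}, 0 < y → y ^ (-(1 / 2) : ℝ) = 1 / √y := fun hy => by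
      rw [Real.rpow_neg hy.le, ← Real.sqrt_eq_rpow, one_div]
    rw [e hX, e hl0] at h1
    have hsX : 0 < √(X s A₀) := Real.sqrt_pos.2 hX
    have h3 : 2 * √(X s A₀) ≤ √(P.lam 0) := by
      rw [show (2 : ℝ) = √4 by rw [show (4 : ℝ) = 2 ^ 2 by norm_num]; simp,
        -- Here `A₀ ≤ λ_0 / 4` enters: the end point term at `λ_0` costs at most half of `2 φ
        -- X^{-1/2}`.
        ← Real.sqrt_mul (by norm_num)]
      exact Real.sqrt_le_sqrt (by linarith)
    have h4 : 1 / √(P.lam 0) ≤ 1 / √(X s A₀) / 2 := by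
      rw [div_div, mul_comm]
      exact one_div_le_one_div_of_le (by positivity) h3
    have h5 : φ * (1 / √(X s A₀)) ≤ tailMean (ω s) (X s A₀) := by
      have : φ / (1 / 2) * (1 / √(X s A₀) / 2) ≤
          φ / (1 / 2) * (1 / √(X s A₀) - 1 / √(P.lam 0)) := by
        gcongr
        linarith
      have e2 : φ / (1 / 2) * (1 / √(X s A₀) / 2) = φ * (1 / √(X s A₀)) := by ring
      linarith
    have h6 : φ * √(X s A₀) ≤ X s A₀ * tailMean (ω s) (X s A₀) := by
      have := mul_le_mul_of_nonneg_left h5 hX.le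
      have e3 : X s A₀ * (φ * (1 / √(X s A₀))) = φ * √(X s A₀) := by
        nth_rewrite 1 [← Real.mul_self_sqrt hX.le]
        field_simp
      linarith
    rw [div_le_iff₀ (by positivity)]
    linarith
  have hB := image_le_of_deriv_right_le_deriv_boundary (f := fun s => √(X s A₀))
    (f' := fun s => -(X s A₀ * tailMean (ω s) (X s A₀)) / (2 * √(X s A₀)))
    (B := fun s => √A₀ - φ / 2 * s) (B' := fun _ => -(φ / 2)) (a := 0) (b := t)
    (fun s hs => (hd s hs).continuousAt.continuousWithinAt)
    (fun s hs => (hd s (Ico_subset_Icc_self hs)).hasDerivWithinAt)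
    (by simp [h.flow.init]) (by fun_prop)
    (fun s _ => by
      have := ((hasDerivAt_id s).const_mul (φ / 2)).const_sub (√A₀)
      simpa using this.hasDerivWithinAt)
    (fun s hs => hbound s (Ico_subset_Icc_self hs)) (x := t) ⟨ht.1, le_rfl⟩
  exact hB

/-- At time `τ` the linear bound for `√X` vanishes, but the path of a smooth solution is still
positive. -/
theorem lifetime_le (hA : A₀ ≤ P.lam 0 / 4) (hτ : τ = 2 * √A₀ / φ) : T ≤ τ := by
  by_contra! hlt
  have hA₀ := h.prepared.A₀_pos
  have hφ := h.trapping.profile_phi_pos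
  have hτ0 : 0 < τ := by rw [hτ]; have := Real.sqrt_pos.2 hA₀; positivity
  have h1 := h.sqrt_path_le hA ⟨hτ0.le, hlt⟩ le_rfl
  have h2 := Real.sqrt_pos.2 (h.flow.pos τ ⟨hτ0.le, hlt⟩ A₀ hA₀)
  have h3 : φ / 2 * τ = √A₀ := by rw [hτ]; field_simp
  linarith

end Barrier

end PreparedFlow

end NonlocalTransport

/-! ### An explicit choice of parameters and of data. -/

namespace NonlocalTransport

/-- Doubly exponentially decaying scales, with exponents which approach `1/2` fast enough for the
barriers to be comparable to `x^{-1/2}` uniformly in all scales. -/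
noncomputable def doublyExponential : Parameters where
  lamNegTwo := Real.exp (-(3 / 2))
  lamNegOne := Real.exp (-2)
  lam n := Real.exp (-(4 * 2 ^ n))
  p n := 1 / 2 - (1 / 4) ^ n / 2
  q n := 1 / 2 + (1 / 4) ^ n / 2
  -- At `λ_n` the change of exponents amounts to `(3/8) 4^{-n} * 4 * 2^n = (3/2) 2^{-n}` in the
  -- logarithm. The prefactors absorb exactly this summable amount, so adjacent barriers meet with
  -- equality, and the prefactors stay within `exp (±3)`.
  φ n := Real.exp (-(3 - 3 * (1 / 2) ^ n))
  ψ n := Real.exp (3 - 3 * (1 / 2) ^ n)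
  m n := 1 - (1 / 4) ^ n
  M n := 1 + (1 / 4) ^ n

namespace doublyExponential

theorem quarter_pow (n : ℕ) : (1 / 4 : ℝ) ^ n = (1 / 2) ^ n * (1 / 2) ^ n := by
  rw [← mul_pow]; norm_num

theorem two_mul_half_pow (n : ℕ) : (2 : ℝ) ^ n * (1 / 2) ^ n = 1 := by
  rw [← mul_pow]; norm_num

theorem quarter_pow_pos (n : ℕ) : (0 : ℝ) < (1 / 4) ^ n := by positivity

theorem quarter_pow_le {n : ℕ} (hn : 1 ≤ n) : (1 / 4 : ℝ) ^ n ≤ 1 / 4 := by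
  simpa using pow_le_pow_of_le_one (by norm_num : (0 : ℝ) ≤ 1 / 4) (by norm_num) hn

theorem half_pow_le {n : ℕ} (hn : 1 ≤ n) : (1 / 2 : ℝ) ^ n ≤ 1 / 2 := by
  simpa using pow_le_pow_of_le_one (by norm_num : (0 : ℝ) ≤ 1 / 2) (by norm_num) hn

theorem quarter_pow_succ (n : ℕ) : (1 / 4 : ℝ) ^ (n + 1) = (1 / 4) ^ n / 4 := by ring

theorem tendsto_quarter_pow : Tendsto (fun n : ℕ => (1 / 4 : ℝ) ^ n) atTop (𝓝 0) :=
  tendsto_pow_atTop_nhds_zero_of_lt_one (by norm_num) (by norm_num)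

theorem tendsto_half_pow : Tendsto (fun n : ℕ => (1 / 2 : ℝ) ^ n) atTop (𝓝 0) :=
  tendsto_pow_atTop_nhds_zero_of_lt_one (by norm_num) (by norm_num)

theorem tendsto_exp_two_pow : Tendsto (fun n : ℕ => Real.exp (-(4 * 2 ^ n))) atTop (𝓝 0) := by
  refine Real.tendsto_exp_neg_atTop_nhds_zero.comp ?_
  exact (tendsto_pow_atTop_atTop_of_one_lt one_lt_two).const_mul_atTop (by norm_num)

theorem exp_rpow (a b : ℝ) : Real.exp a ^ b = Real.exp (a * b) := (Real.exp_mul a b).symm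

theorem lam_div (n : ℕ) : Real.exp (-(4 * 2 ^ (n + 1))) / Real.exp (-(4 * 2 ^ n)) =
    Real.exp (-(4 * 2 ^ n)) := by
  rw [← Real.exp_sub]
  congr 1
  ring

theorem admissible : doublyExponential.Admissible where
  lamNegTwo_lt := by simp [doublyExponential]
  lamNegOne_lt := by simp only [doublyExponential, Real.exp_lt_exp]; norm_num
  lam_zero_lt := by simp only [doublyExponential, Real.exp_lt_exp]; norm_num
  lam_pos n := Real.exp_pos _
  lam_anti n := by
    simp only [doublyExponential, Real.exp_lt_exp]
    have : (0 : ℝ) < 2 ^ n := by positivity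
    rw [pow_succ]
    linarith
  lam_tendsto := tendsto_exp_two_pow
  phi_pos n _ := Real.exp_pos _
  phi_lt_psi n hn := by
    simp only [doublyExponential, Real.exp_lt_exp]
    linarith [half_pow_le hn]
  p_pos n hn := by simp only [doublyExponential]; linarith [quarter_pow_le hn]
  p_mono n _ := by
    simp only [doublyExponential, quarter_pow_succ]; linarith [quarter_pow_pos n]
  p_tendsto := by
    have := (tendsto_quarter_pow.div_const 2).const_sub (1 / 2)
    rw [zero_div, sub_zero] at this
    exact this
  q_anti n _ := by
    simp only [doublyExponential, quarter_pow_succ]; linarith [quarter_pow_pos n]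
  q_tendsto := by
    have := (tendsto_quarter_pow.div_const 2).const_add (1 / 2)
    rw [zero_div, add_zero] at this
    exact this
  p_add_q n _ := by simp only [doublyExponential]; ring
  m_pos n hn := by simp only [doublyExponential]; linarith [quarter_pow_le hn]
  m_mono n _ := by
    simp only [doublyExponential, quarter_pow_succ]; linarith [quarter_pow_pos n]
  m_tendsto := by
    have := tendsto_quarter_pow.const_sub 1
    rw [sub_zero] at this
    exact this
  M_anti n _ := by
    simp only [doublyExponential, quarter_pow_succ]; linarith [quarter_pow_pos n]
  M_tendsto := by
    have := tendsto_quarter_pow.const_add 1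
    rw [add_zero] at this
    exact this
  phi_mul_psi n _ := by
    simp only [doublyExponential]; rw [← Real.exp_add, neg_add_cancel, Real.exp_zero]
  lam_ratio := by
    simp only [doublyExponential, lam_div]
    exact tendsto_exp_two_pow
  lam_rpow := by
    have e : ∀ n : ℕ, doublyExponential.lam (n + 1) ^
        (doublyExponential.q (n + 1) - doublyExponential.q n) = Real.exp (3 * (1 / 2) ^ n) := by
      intro n
      simp only [doublyExponential, exp_rpow]
      congr 1
      rw [quarter_pow_succ, quarter_pow, pow_succ]
      linear_combination 3 * (1 / 2 : ℝ) ^ n * two_mul_half_pow n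
    simp only [e]
    have := (tendsto_half_pow.const_mul 3)
    rw [mul_zero] at this
    have h := (Real.continuous_exp.tendsto 0).comp this
    rw [Real.exp_zero] at h
    exact h
  psi_quot n hn := by
    have hq : (0 : ℝ) < 1 / 2 + (1 / 4) ^ n / 2 := by linarith [quarter_pow_pos n]
    have e : doublyExponential.ψ n / doublyExponential.ψ (n + 1) *
        doublyExponential.lam n ^ (doublyExponential.q (n + 1) - doublyExponential.q n) = 1 := by
      simp only [doublyExponential, exp_rpow]
      rw [← Real.exp_sub, ← Real.exp_add, Real.exp_eq_one_iff, quarter_pow_succ, quarter_pow,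
        pow_succ]
      linear_combination (3 / 2) * (1 / 2 : ℝ) ^ n * two_mul_half_pow n
    rw [mul_assoc, e, mul_one]
    simp only [doublyExponential]
    rw [div_le_one hq, quarter_pow_succ]
    linarith [quarter_pow_pos n]
  phi_quot n hn := by
    have hp : (0 : ℝ) < 1 / 2 - (1 / 4) ^ n / 2 := by linarith [quarter_pow_le hn]
    have e : doublyExponential.φ n / doublyExponential.φ (n + 1) *
        doublyExponential.lam n ^ (doublyExponential.p (n + 1) - doublyExponential.p n) = 1 := by
      simp only [doublyExponential, exp_rpow]
      rw [← Real.exp_sub, ← Real.exp_add, Real.exp_eq_one_iff, quarter_pow_succ, quarter_pow,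
        pow_succ]
      linear_combination -(3 / 2) * (1 / 2 : ℝ) ^ n * two_mul_half_pow n
    rw [mul_assoc, e, mul_one]
    simp only [doublyExponential]
    rw [one_le_div hp, quarter_pow_succ]
    linarith [quarter_pow_pos n]
  relay_start := by
    simp only [doublyExponential, exp_rpow]
    rw [← Real.exp_add, ← Real.exp_add, Real.exp_lt_exp]
    norm_num
  relay_lower n _ := by
    simp only [doublyExponential, exp_rpow]
    rw [← Real.exp_add, ← Real.exp_add, Real.exp_le_exp, quarter_pow_succ, quarter_pow, pow_succ]
    apply le_of_eq
    linear_combination (3 / 2) * (1 / 2 : ℝ) ^ n * two_mul_half_pow n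
  relay_upper n _ := by
    simp only [doublyExponential, exp_rpow]
    rw [← Real.exp_add, ← Real.exp_add, Real.exp_le_exp, quarter_pow_succ, quarter_pow, pow_succ]
    apply le_of_eq
    linear_combination (3 / 2) * (1 / 2 : ℝ) ^ n * two_mul_half_pow n
  trapping_lower n hn := by
    simp only [doublyExponential]
    have h1 := quarter_pow_le hn
    have h0 := quarter_pow_pos n
    rw [div_lt_one (by apply mul_pos <;> linarith)]
    nlinarith
  trapping_upper n hn := by
    simp only [doublyExponential]
    have h1 := quarter_pow_le hn
    have h0 := quarter_pow_pos n
    rw [one_lt_div (by apply mul_pos <;> linarith)]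
    nlinarith

theorem exp_neg_one_le : Real.exp (-1) ≤ 1 / 2 := by
  rw [Real.exp_neg, ← one_div]
  exact one_div_le_one_div_of_le (by norm_num) (by linarith [Real.add_one_le_exp (1 : ℝ)])

theorem exp_neg_two_le : Real.exp (-2) ≤ 1 / 4 := by
  have : Real.exp (-2) = Real.exp (-1) * Real.exp (-1) := by rw [← Real.exp_add]; norm_num
  rw [this]
  nlinarith [exp_neg_one_le, Real.exp_pos (-1)]

theorem trapping : doublyExponential.Trapping (Real.exp (-3)) (Real.exp 3) where
  toAdmissible := admissible
  profile_phi_pos := Real.exp_pos _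
  p_lt_half n _ := by simp only [doublyExponential]; linarith [quarter_pow_pos n]
  ratio_rpow_q n := by
    simp only [doublyExponential, lam_div, exp_rpow]
    have h1 := quarter_pow_le (n := n + 1) (by omega)
    have h0 := quarter_pow_pos (n + 1)
    have h2 : (1 : ℝ) ≤ 2 ^ n := one_le_pow₀ (by norm_num)
    -- The ratio `λ_{n+1} / λ_n` equals `λ_n ≤ exp (-4)`; already its square root is at most `exp
    -- (-2) ≤ 1/4`, below the smallest exponent `p_1 = 3/8`.
    have h3 : -(4 * 2 ^ n) * (1 / 2 + (1 / 4) ^ (n + 1) / 2) ≤ (-2 : ℝ) := by nlinarith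
    exact (Real.exp_le_exp.2 h3).trans (exp_neg_two_le.trans (by linarith))
  ratio_rpow_p n := by
    simp only [doublyExponential, lam_div, exp_rpow]
    have h1 := quarter_pow_le (n := n + 1) (by omega)
    have h0 := quarter_pow_pos (n + 1)
    have h2 : (1 : ℝ) ≤ 2 ^ n := one_le_pow₀ (by norm_num)
    have h3 : -(4 * 2 ^ n) * (1 / 2 - (1 / 4) ^ (n + 1) / 2) ≤ (-1 : ℝ) := by nlinarith
    exact (Real.exp_le_exp.2 h3).trans (exp_neg_one_le.trans (by linarith))
  le_lower n x hx := by
    have hx0 : 0 < x := (Real.exp_pos _).trans_le hx.1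
    simp only [Parameters.lower, doublyExponential] at hx ⊢
    rw [← Real.exp_log hx0, exp_rpow, exp_rpow, ← Real.exp_add, ← Real.exp_add, Real.exp_le_exp]
    have hl : -(4 * 2 ^ (n + 1)) ≤ Real.log x := (Real.le_log_iff_exp_le hx0).2 hx.1
    have h1 := mul_le_mul_of_nonneg_left hl (quarter_pow_pos (n + 1)).le
    -- The deviation of the exponent from `1/2` costs at most `2 * (1/2)^(n+1)` in the logarithm,
    -- less than the reserve `3 * (1/2)^(n+1)` in the prefactor.
    have h2 : (1 / 4 : ℝ) ^ (n + 1) * -(4 * 2 ^ (n + 1)) = -(4 * (1 / 2) ^ (n + 1)) := by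
      rw [quarter_pow]
      linear_combination -4 * (1 / 2 : ℝ) ^ (n + 1) * two_mul_half_pow (n + 1)
    have h3 : (0 : ℝ) < (1 / 2) ^ (n + 1) := by positivity
    rw [h2] at h1
    linarith
  upper_le n x hx := by
    have hx0 : 0 < x := (Real.exp_pos _).trans_le hx.1
    simp only [Parameters.upper, doublyExponential] at hx ⊢
    rw [← Real.exp_log hx0, exp_rpow, exp_rpow, ← Real.exp_add, ← Real.exp_add, Real.exp_le_exp]
    have hl : -(4 * 2 ^ (n + 1)) ≤ Real.log x := (Real.le_log_iff_exp_le hx0).2 hx.1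
    have h1 := mul_le_mul_of_nonneg_left hl (quarter_pow_pos (n + 1)).le
    have h2 : (1 / 4 : ℝ) ^ (n + 1) * -(4 * 2 ^ (n + 1)) = -(4 * (1 / 2) ^ (n + 1)) := by
      rw [quarter_pow]
      linear_combination -4 * (1 / 2 : ℝ) ^ (n + 1) * two_mul_half_pow (n + 1)
    have h3 : (0 : ℝ) < (1 / 2) ^ (n + 1) := by positivity
    rw [h2] at h1
    linarith

theorem upper_lam_zero : doublyExponential.ψ 1 * doublyExponential.lam 0 ^ (-doublyExponential.q 1) =
    Real.exp 4 := by
  simp only [doublyExponential, exp_rpow]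
  rw [← Real.exp_add]
  norm_num

theorem lower_lam_zero : doublyExponential.φ 1 * doublyExponential.lam 0 ^ (-doublyExponential.p 1) =
    1 := by
  simp only [doublyExponential, exp_rpow]
  rw [← Real.exp_add]
  norm_num

theorem exp_two_add_one_lt : Real.exp 2 + 1 < Real.exp 4 := by
  have e : Real.exp 4 = Real.exp 2 * Real.exp 2 := by rw [← Real.exp_add]; norm_num
  have := Real.add_one_le_exp (2 : ℝ)
  rw [e]
  nlinarith

/-- For `x < 1` both effects have the same sign: `p < 1/2 < q` and `φ_n < 1 < ψ_n`. So `x^{-1/2}` is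
admissible at all scales at once. -/
theorem lt_rpow_neg_half {n : ℕ} {x : ℝ} (hx0 : 0 < x) (hx1 : x < 1) :
    doublyExponential.lower n x < x ^ (-(1 / 2) : ℝ) ∧
      x ^ (-(1 / 2) : ℝ) < doublyExponential.upper n x := by
  have h := half_pow_le (n := n + 1) (by omega)
  have h0 := quarter_pow_pos (n + 1)
  have hx := Real.rpow_pos_of_pos hx0 (-(1 / 2))
  simp only [Parameters.lower, Parameters.upper, doublyExponential]
  constructor
  · calc _ ≤ Real.exp (-(3 - 3 * (1 / 2) ^ (n + 1))) * x ^ (-(1 / 2) : ℝ) := by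
          refine mul_le_mul_of_nonneg_left ?_ (Real.exp_pos _).le
          exact Real.rpow_le_rpow_of_exponent_ge hx0 hx1.le (by linarith)
      _ < 1 * x ^ (-(1 / 2) : ℝ) := by
          refine mul_lt_mul_of_pos_right ?_ hx
          rw [Real.exp_lt_one_iff]
          linarith
      _ = _ := one_mul _
  · calc x ^ (-(1 / 2) : ℝ) = 1 * x ^ (-(1 / 2) : ℝ) := (one_mul _).symm
      _ < Real.exp (3 - 3 * (1 / 2) ^ (n + 1)) * x ^ (-(1 / 2) : ℝ) := by
          refine mul_lt_mul_of_pos_right ?_ hx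
          rw [Real.one_lt_exp_iff]
          linarith
      _ ≤ _ := by
          refine mul_le_mul_of_nonneg_left ?_ (Real.exp_pos _).le
          exact Real.rpow_le_rpow_of_exponent_ge hx0 hx1.le (by linarith)

/-- The witnesses are a smooth cutoff `χ`, equal to `1` on `[A₀, λ_{-2}]`, as density and `χ
x^{-1/2}` as vorticity. -/
theorem exists_suitablyPrepared {δ R A₀ : ℝ} (hδ : 0 < δ) (hδ1 : δ < 1) (hR : 1 ≤ R) (hA : 0 < A₀)
    (hA' : A₀ < doublyExponential.lam 0) :
    ∃ w r : ℝ → ℝ, SuitablyPrepared doublyExponential δ R A₀ w r := by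
  set E := doublyExponential.lamNegTwo with hE
  have hadm := admissible
  have hAE : A₀ < E := hA'.trans (hadm.lam_zero_lt.trans hadm.lamNegOne_lt)
  have hE1 : E < 1 := hadm.lamNegTwo_lt
  -- The width of the transition layers keeps the support in `[A₀ / 2, λ_{-2} + δ]`.
  set η := min (A₀ / 2) δ with hη
  have hη0 : 0 < η := lt_min (by linarith) hδ
  have hηA : η ≤ A₀ / 2 := min_le_left _ _
  have hηδ : η ≤ δ := min_le_right _ _
  let χ : ContDiffBump ((A₀ + E) / 2) :=
    ⟨(E - A₀) / 2, (E - A₀) / 2 + η, by linarith, by linarith⟩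
  have hχ1 : ∀ x ∈ Icc A₀ E, χ x = 1 := by
    intro x hx
    refine χ.one_of_mem_closedBall ?_
    rw [Metric.mem_closedBall, Real.dist_eq, abs_le]
    constructor <;> simp only [χ] <;> linarith [hx.1, hx.2]
  have hχ0 : ∀ x, x ∉ Icc (A₀ / 2) (E + δ) → χ x = 0 := by
    intro x hx
    refine χ.zero_of_le_dist ?_
    rw [Real.dist_eq]
    simp only [χ]
    by_contra! hlt
    rw [abs_lt] at hlt
    exact hx ⟨by linarith [hlt.1], by linarith [hlt.2]⟩
  have hχd : ContDiff ℝ 1 (χ : ℝ → ℝ) := χ.contDiff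
  refine ⟨fun x => χ x * x ^ (-(1 / 2) : ℝ), χ, ?_⟩
  have hval : ∀ x ∈ Icc A₀ E, χ x * x ^ (-(1 / 2) : ℝ) = x ^ (-(1 / 2) : ℝ) := fun x hx => by
    rw [hχ1 x hx, one_mul]
  refine
    { omega_C1 := ⟨?_, A₀ / 2, E + δ, by linarith, fun x _ hx => by simp only [hχ0 x hx, zero_mul]⟩
      rho_C1 := ⟨hχd.contDiffOn, A₀ / 2, E + δ, by linarith, fun x _ hx => hχ0 x hx⟩
      A₀_pos := hA
      A₀_lt := hA'
      δ_pos := hδ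
      δ_small := ?_
      omega_nonneg := fun x hx => mul_nonneg χ.nonneg (Real.rpow_nonneg hx.le _)
      rho_nonneg := fun x _ => χ.nonneg
      support := ⟨A₀ / 2, by linarith, by linarith, fun x _ hx => ?_⟩
      barrier := fun n x hx hAx => ?_
      upper := fun x hx => ?_
      lower := fun x hx => ?_
      rho_eq_one := hχ1
      rho_le := fun x _ => χ.le_one.trans hR }
  · exact hχd.contDiffOn.mul (contDiffOn_id.rpow_const_of_ne fun x hx => (mem_Ioi.1 hx).ne')
  · rw [upper_lam_zero, lower_lam_zero]
    linarith [exp_two_add_one_lt, Real.add_one_le_exp (2 : ℝ)]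
  · rw [hχ0 x hx]; simp
  · have hx0 : x ≤ doublyExponential.lam 0 :=
      hx.2.trans (trapping.lam_antitone (Nat.zero_le n))
    have hxE : x ≤ E := hx0.trans (hadm.lam_zero_lt.trans hadm.lamNegOne_lt).le
    simp only [hval x ⟨hAx, hxE⟩]
    exact lt_rpow_neg_half (hA.trans_le hAx) (hxE.trans_lt hE1)
  · rw [upper_lam_zero]
    have hl0 := hadm.lam_pos 0
    have h1 : x ^ (-(1 / 2) : ℝ) ≤ Real.exp 2 := by
      have : doublyExponential.lam 0 ^ (-(1 / 2) : ℝ) = Real.exp 2 := by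
        simp only [doublyExponential, exp_rpow]; norm_num
      rw [← this]
      exact Real.rpow_le_rpow_of_nonpos hl0 hx.1 (by norm_num)
    have h2 : χ x * x ^ (-(1 / 2) : ℝ) ≤ x ^ (-(1 / 2) : ℝ) :=
      mul_le_of_le_one_left (Real.rpow_nonneg (hl0.le.trans hx.1) _) χ.le_one
    linarith [exp_two_add_one_lt]
  · rw [lower_lam_zero]
    have hx0 := (hadm.lam_pos 0).trans_le hx.1
    have hxE : x ≤ E := hx.2.trans hadm.lamNegOne_lt.le
    simp only [hval x ⟨hA'.le.trans hx.1, hxE⟩]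
    exact Real.one_lt_rpow_of_pos_of_lt_one_of_neg hx0 (hxE.trans_lt hE1) (by norm_num)

end doublyExponential

end NonlocalTransport

/-! ### Smallness of the margins and the conclusion. -/

namespace NonlocalTransport

namespace doublyExponential

theorem inv_p : 1 / doublyExponential.p 1 = 8 / 3 := by
  simp only [doublyExponential]; norm_num

theorem inv_q : 1 / doublyExponential.q 1 = 8 / 5 := by
  simp only [doublyExponential]; norm_num

theorem log_lamNegOne_div :
    Real.log (doublyExponential.lamNegOne / doublyExponential.lam 0) = 2 := by
  simp only [doublyExponential]
  rw [← Real.exp_sub, Real.log_exp]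
  norm_num

/-- The largest margin which is allowed for the prepared data. -/
noncomputable def margin : ℝ := min 1 (Real.exp (-(4 / 3)) - Real.exp (-(3 / 2)))

theorem margin_pos : 0 < margin :=
  lt_min one_pos (sub_pos.2 (Real.exp_lt_exp.2 (by norm_num)))

/-- The margin keeps the right edge below `exp (-4/3)`, and `4 - 4/3 = 8/3` is `1 / p_1`. -/
theorem log_lt_of_lt_margin {δ : ℝ} (hδ : 0 < δ) (h : δ < margin) :
    Real.log ((doublyExponential.lamNegTwo + δ) / doublyExponential.lam 0) < 8 / 3 := by
  have h1 : doublyExponential.lamNegTwo + δ < Real.exp (-(4 / 3)) := by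
    have := h.trans_le (min_le_right _ _)
    simp only [doublyExponential]
    linarith
  have h2 : 0 < doublyExponential.lamNegTwo := Real.exp_pos _
  have h3 : doublyExponential.lam 0 = Real.exp (-4) := by simp [doublyExponential]
  rw [Real.log_lt_iff_lt_exp (div_pos (by linarith) (admissible.lam_pos 0)),
    div_lt_iff₀ (admissible.lam_pos 0), h3, ← Real.exp_add]
  refine h1.trans_eq ?_
  norm_num

/-- If the particle starts close enough to the origin, the time `2 √A / φ` which it needs to get
there is so short that the sources and the motion of the far field are negligible. -/
theorem exists_threshold {δ : ℝ} (hδ : 0 < δ) (R K : ℝ) :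
    ∃ a, 0 < a ∧ a ≤ doublyExponential.lam 0 / 4 ∧ ∀ A, 0 < A → A < a →
      2 * √A / Real.exp (-3) * R / doublyExponential.lam 0 ≤ δ ∧
      -- `2 / 5` is the slack `log (λ_{-1} / λ_0) - 1 / q_1 = 2 - 8/5` that the motion of the far
      -- field may use up.
      K * (2 * √A / Real.exp (-3)) < 2 / 5 := by
  have h1 : Tendsto (fun A : ℝ => 2 * √A / Real.exp (-3) * R / doublyExponential.lam 0)
      (𝓝[>] 0) (𝓝 0) := by
    have hc : Continuous fun A : ℝ => 2 * √A / Real.exp (-3) * R / doublyExponential.lam 0 := by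
      fun_prop
    simpa using (hc.tendsto 0).mono_left nhdsWithin_le_nhds
  have h2 : Tendsto (fun A : ℝ => K * (2 * √A / Real.exp (-3))) (𝓝[>] 0) (𝓝 0) := by
    have hc : Continuous fun A : ℝ => K * (2 * √A / Real.exp (-3)) := by fun_prop
    simpa using (hc.tendsto 0).mono_left nhdsWithin_le_nhds
  have hev := (h1.eventually (gt_mem_nhds hδ)).and
    (h2.eventually (gt_mem_nhds (by norm_num : (0 : ℝ) < 2 / 5)))
  obtain ⟨u, hu, hsub⟩ := mem_nhdsGT_iff_exists_Ioo_subset.1 hev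
  have hl0 := admissible.lam_pos 0
  refine ⟨min u (doublyExponential.lam 0 / 4), lt_min hu (by linarith), min_le_right _ _,
    fun A hA hA' => ?_⟩
  have := hsub ⟨hA, hA'.trans_le (min_le_left _ _)⟩
  exact ⟨this.1.le, this.2⟩

end doublyExponential

theorem IsFlow.isTrajectory {w r : ℝ → ℝ} {T : ℝ} {X ω ρ : ℝ → ℝ → ℝ}
    (h : IsFlow w r T X ω ρ) {a : ℝ} (ha : 0 < a) : IsTrajectory ω T a fun t => X t a where
  init := h.init a
  pos t ht := h.pos t ht a ha
  ode t ht := (h.hasDerivAt_flow t ht a ha).hasDerivWithinAt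

end NonlocalTransport

open NonlocalTransport in
theorem theorem3 :
    ∃ P : Parameters, P.Admissible ∧
    ∃ φ ψ δ₀ : ℝ, 0 < φ ∧ 0 < ψ ∧ 0 < δ₀ ∧
    ∀ δ : ℝ, 0 < δ → δ < δ₀ → ∀ R : ℝ, 1 ≤ R →
    ∃ a : ℝ, 0 < a ∧ a < P.lam 0 ∧ ∀ A₀ : ℝ, 0 < A₀ → A₀ < a →
      -- the class of suitably prepared data is nonempty
      (∃ ω₀ ρ₀ : ℝ → ℝ, SuitablyPrepared P δ R A₀ ω₀ ρ₀) ∧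
      ∃ T₁ : ℝ, 0 < T₁ ∧
      ∀ ω₀ ρ₀ : ℝ → ℝ, SuitablyPrepared P δ R A₀ ω₀ ρ₀ →
      ∃ (Ts : ℝ) (ω ρ : ℝ → ℝ → ℝ) (A : ℝ → ℝ),
        -- the solution has the finite lifetime `Ts`
        IsMaximalSolution ω₀ ρ₀ Ts ω ρ ∧
        IsTrajectory ω Ts A₀ A ∧
        Tendsto (fun t => ∫ s in (0 : ℝ)..t, supNorm (ω s)) (𝓝[<] Ts) atTop ∧
        -- the exact profile up to the blowup time
        (∀ t ∈ Ico 0 Ts, ∀ x ∈ Ioc (A t) (P.lam 0),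
          φ * x ^ (-(1 / 2) : ℝ) ≤ ω t x ∧ ω t x ≤ ψ * x ^ (-(1 / 2) : ℝ)) ∧
        -- the particle is driven to the origin, and gets there if the solution lasts until `T₁`
        (∀ t ∈ Ico 0 Ts, √(A t) ≤ √A₀ * (1 - t / T₁)) ∧
        (T₁ ≤ Ts → Tendsto A (𝓝[<] T₁) (𝓝 0)) := by
  refine ⟨doublyExponential, doublyExponential.admissible, Real.exp (-3), Real.exp 3,
    doublyExponential.margin, Real.exp_pos _, Real.exp_pos _, doublyExponential.margin_pos,
    fun δ hδ hδm R hR => ?_⟩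
  have hl0 := doublyExponential.admissible.lam_pos 0
  set L := Real.log ((doublyExponential.lamNegTwo + δ) / doublyExponential.lam 0) with hL
  -- The summand `1` makes the bound for the speed of the far field strict.
  set K := doublyExponential.upper 0 (doublyExponential.lam 0) * L + 1 with hK
  obtain ⟨a, ha, ha4, hsmall⟩ := doublyExponential.exists_threshold hδ R K
  refine ⟨a, ha, by linarith, fun A₀ hA hAa => ⟨doublyExponential.exists_suitablyPrepared hδ
    (hδm.trans_le (min_le_left _ _)) hR hA (by linarith), ?_⟩⟩
  obtain ⟨hs1, hs2⟩ := hsmall A₀ hA hAa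
  have hA4 : A₀ ≤ doublyExponential.lam 0 / 4 := by linarith
  have hφ := Real.exp_pos (-3)
  have hsA := Real.sqrt_pos.2 hA
  set T₁ := 2 * √A₀ / Real.exp (-3) with hT₁
  have hT₁0 : 0 < T₁ := by positivity
  refine ⟨T₁, hT₁0, fun w r hp => ?_⟩
  have prepared : ∀ {T X ω ρ}, IsFlow w r T X ω ρ → PreparedFlow doublyExponential
      (Real.exp (-3)) (Real.exp 3) δ R A₀ T₁ K w r T X ω ρ := fun hf =>
    { trapping := doublyExponential.trapping
      flow := hf
      prepared := hp
      one_le_R := hR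
      source_small := hs1
      speed := by linarith
      gap_upper := by
        rw [doublyExponential.inv_p]
        exact doublyExponential.log_lt_of_lt_margin hδ hδm
      gap_lower := by
        rw [doublyExponential.inv_q, doublyExponential.log_lamNegOne_div]
        linarith }
  obtain ⟨T, X, ω, ρ, hf, hb⟩ := exists_flow_blowup hp.omega_C1 hp.rho_C1 T₁
    fun T X ω ρ hf => (prepared hf).lifetime_le hA4 hT₁
  have h := prepared hf
  have hT : T ≤ T₁ := h.lifetime_le hA4 hT₁
  have hsqrt : ∀ t ∈ Ico 0 T, √(X t A₀) ≤ √A₀ * (1 - t / T₁) := fun t ht => by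
    have e : √A₀ * (1 - t / T₁) = √A₀ - Real.exp (-3) / 2 * t := by
      rw [hT₁]
      field_simp
    rw [e]
    exact h.sqrt_path_le hA4 ht (ht.2.le.trans hT)
  refine ⟨T, ω, ρ, fun t => X t A₀, hf.isMaximalSolution hb, hf.isTrajectory hA, hb,
    fun t ht x hx => h.profile ht (ht.2.le.trans hT) ⟨hx.1.le, hx.2⟩, hsqrt, fun hle => ?_⟩
  -- The lifetime never exceeds `T₁`, so survival up to `T₁` means equality, and the linear bound
  -- for `√A` tends to `0` there.
  obtain rfl : T = T₁ := le_antisymm hT hle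
  have hlim : Tendsto (fun t => √A₀ * (1 - t / T₁)) (𝓝[<] T₁) (𝓝 0) := by
    have hc : Continuous fun t => √A₀ * (1 - t / T₁) := by fun_prop
    have := (hc.tendsto T₁).mono_left (nhdsWithin_le_nhds (s := Iio T₁))
    rwa [div_self hT₁0.ne', sub_self, mul_zero] at this
  have hev : ∀ᶠ t in 𝓝[<] T₁, t ∈ Ico 0 T₁ := Ico_mem_nhdsLT hT₁0
  have hs : Tendsto (fun t => √(X t A₀)) (𝓝[<] T₁) (𝓝 0) :=
    tendsto_of_tendsto_of_tendsto_of_le_of_le' tendsto_const_nhds hlim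
      (Eventually.of_forall fun t => Real.sqrt_nonneg _) (hev.mono hsqrt)
  have := hs.pow 2
  rw [zero_pow two_ne_zero] at this
  exact this.congr' (hev.mono fun t ht => Real.sq_sqrt (hf.pos t ht A₀ hA).le)
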